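/- \textbf{Setting.} Let $(X,d)$ be a Gromov hyperbolic metric space (not assumed proper or geodesic), i.e. with $\langle x|y\rangle_z=\frac12[d(x,z)+d(y,z)-d(x,y)]$ there is a constant $C$ such that $\langle x|z\rangle_w\ge\min(\langle x|y\rangle_w,\langle y|z\rangle_w)-C$ for all $x,y,z,w\in X$. Let $\partial X$ be its Gromov boundary, with the Gromov product extended to it by infima of lower limits over representing sequences. Fix $o\in X$ and $b>1$, and let $D$ be a visual metric on $\partial X$, i.e. a metric with $D(\xi,\eta)\asymp b^{-\langle\xi|\eta\rangle_o}$ up to a multiplicative constant. Let $G\le\mathrm{Isom}(X)$ be strongly discrete ($\{g\in G: d(o,g(o))\le r\}$ is finite for every $r>0$) and of general type ($G$ contains two loxodromic isometries with no common fixed point in $\partial X$). Let $\delta=\inf\{s\ge 0:\sum_{g\in G}b^{-s\,d(o,g(o))}<\infty\}\in[0,\infty]$, with $\inf\emptyset=\infty$. For $x\in X$ and $\sigma>0$ let $\mathrm{Shad}(x,\sigma)=\{\eta\in\partial X:\langle o|\eta\rangle_x\le\sigma\}$. The radial limit set $\Lambda_{r}$ is the set of $\eta\in\partial X$ for which there are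 $\sigma>0$ and $g_n\in G$ with $g_n(o)\to\eta$ and $\eta\in \mathrm{Shad}(g_n(o),\sigma)$ for all $n\geq 1$. If in addition the $g_n$ can be chosen with $g_1(o)=o$ and $d(g_n(o),g_{n+1}(o))\le\sigma$ for all $n$, then $\eta$ belongs to the uniformly radial limit set $\Lambda_{ur}$. For $\xi\in\partial X$ let $$\mathrm{BA}_\xi=\{\eta\in\Lambda_r:\ \exists\varepsilon>0\ \forall g\in G\quad D(g(\xi),\eta)\ge\varepsilon b^{-d(o,g(o))}\}.$$ A \emph{partition structure} on a metric space $Z$ is a tree $T\subset\mathbb N^*$ (a set of finite words closed under initial segments) with closed sets $P_\omega\subset Z$ $(\omega\in T)$ of positive finite diameter $D_\omega$ such that $P_\tau\subset P_\omega$ if $\omega$ is an initial segment of $\tau$, $P_\omega\cap P_\tau=\emptyset$ if neither word is an initial segment of the other, and, for some $\kappa>0$ and $0<\lambda<1$, $\mathrm{dist}(P_{\omega a},Z\setminus P_\omega)\ge\kappa D_\omega$ and $\kappa D_\omega\le D_{\omega a}\le\lambda D_\omega$ whenever $\omega,\omega a\in T$, $a\in\mathbb N$. Its \emph{limit set} is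 the union of the sets $\bigcap_n P_{\omega_1\cdots\omega_n}$ over all infinite branches $\omega$ of $T$. A metric space is \emph{Ahlfors $s$-regular} if it is the support of a Borel measure $\mu$ with $\mu(B(z,r))\asymp r^s$ for all $z\in\mathrm{Supp}(\mu)$ and $0<r<1$ (all balls are closed). \textbf{The game.} A metric space $Z$ is $c$-uniformly perfect ($0<c<1$) if $B(z,r)\setminus B(z,cr)\ne\emptyset$ for all $z\in Z$, $0<r<1$. For $\beta>0$, Bob and Alice alternately choose balls $B_k=B(z_k,r_k)$ and $A_k=B(\tilde z_k,\tilde r_k)$ in $Z$, given by centres and positive radii, with $B_{k+1}\subset B_k\setminus A_k$, $\tilde r_k\le\beta r_k$, $r_{k+1}\ge\beta\tilde r_k$ $(k\ge1)$; if Bob has no legal move, Alice wins by default. A set $S\subset Z$ is $\beta$-absolute winning if Alice has a strategy guaranteeing that she wins by default or that $\bigcap_k B_k\cap S\neq\emptyset$. If $Z$ is uniformly perfect, $S$ is \emph{absolute winning} on $Z$ if, for every $c$ such that $Z$ is $c$-uniformly perfect, $S$ is $\beta$-absolute winning for all $0<\beta\le c/5$. \textbf{Theorem.} Let $0<s<\delta$.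 Then for all sufficiently large $\sigma>0$: (1) there exist a tree $T\subset\mathbb N^*$ and an injective map $T\ni\omega\mapsto x_\omega\in G(o)$ such that the sets $P_\omega=\mathrm{Shad}(x_\omega,\sigma)$ form a partition structure on $(\partial X,D)$ whose limit set $\mathcal J_s$ is a nonempty Ahlfors $s$-regular subset of $\Lambda_{ur}$; (2) for every set $\mathcal J_s$ that is the limit set of a structure as in (1), and for every $\xi\in\partial X$, the space $(\mathcal J_s,D)$ is uniformly perfect and the set $\mathrm{BA}_\xi\cap\mathcal J_s$ is absolute winning on $\mathcal J_s$. -/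

import Mathlib

open Filter Topology Set
open scoped ENNReal NNReal

noncomputable section

namespace HypDioph

/-! ## Gromov hyperbolic spaces and their boundary -/

section Boundary

/-- The Gromov product `⟨x|y⟩_z`. -/
def gromovProduct {X : Type*} [MetricSpace X] (x y z : X) : ℝ :=
  (dist x z + dist y z - dist x y) / 2

/-- Gromov hyperbolicity, by the four point inequality. The space need be neither proper nor
geodesic. -/
class IsGromovHyperbolic (X : Type*) [MetricSpace X] : Prop where
  four_point : ∃ C : ℝ, ∀ x y z w : X,
    min (gromovProduct x y w) (gromovProduct y z w) - C ≤ gromovProduct x z w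

/-- `⟨x_n|x_m⟩_o → ∞` as `n, m → ∞`. The condition does not depend on `o`; it is required for all
`o` so that no base point has to be chosen. -/
def IsGromovSeq {X : Type*} [MetricSpace X] (x : ℕ → X) : Prop :=
  ∀ o : X, Tendsto (fun p : ℕ × ℕ => gromovProduct (x p.1) (x p.2) o) atTop atTop

/-- The type of Gromov sequences. -/
def GromovSeq (X : Type*) [MetricSpace X] : Type _ := {x : ℕ → X // IsGromovSeq x}

/-- Equivalence of Gromov sequences: `⟨x_n|y_n⟩_o → ∞`. -/
def GromovSeq.Equivalent {X : Type*} [MetricSpace X] (x y : GromovSeq X) : Prop :=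
  ∀ o : X, Tendsto (fun n => gromovProduct (x.1 n) (y.1 n) o) atTop atTop

theorem gromovProduct_comm {X : Type*} [MetricSpace X] (x y z : X) :
    gromovProduct x y z = gromovProduct y x z := by
  unfold gromovProduct
  rw [dist_comm x y]
  ring

theorem GromovSeq.equivalent_equivalence (X : Type*) [MetricSpace X] [IsGromovHyperbolic X] :
    Equivalence (GromovSeq.Equivalent (X := X)) where
  refl x o := by
    have hd : Tendsto (fun n : ℕ => (n, n)) atTop (atTop : Filter (ℕ × ℕ)) := by
      rw [← prod_atTop_atTop_eq]
      exact tendsto_id.prodMk tendsto_id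
    exact (x.2 o).comp hd
  symm {x y} h o := by
    simpa only [gromovProduct_comm] using h o
  trans {x y z} h₁ h₂ o := by
    obtain ⟨C, hC⟩ := IsGromovHyperbolic.four_point (X := X)
    rw [tendsto_atTop]
    intro M
    filter_upwards [(tendsto_atTop.1 (h₁ o)) (M + C), (tendsto_atTop.1 (h₂ o)) (M + C)]
      with n h1 h2
    have h3 := hC (x.1 n) (y.1 n) (z.1 n) o
    have h4 := le_min h1 h2
    linarith

instance gromovSetoid (X : Type*) [MetricSpace X] [IsGromovHyperbolic X] :
    Setoid (GromovSeq X) :=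
  ⟨GromovSeq.Equivalent, GromovSeq.equivalent_equivalence X⟩

/-- The Gromov boundary `∂X`: Gromov sequences modulo equivalence. -/
def GromovBoundary (X : Type*) [MetricSpace X] [IsGromovHyperbolic X] : Type _ :=
  Quotient (gromovSetoid X)

/-- The boundary point represented by a Gromov sequence. -/
def GromovSeq.toBoundary {X : Type*} [MetricSpace X] [IsGromovHyperbolic X] (x : GromovSeq X) :
    GromovBoundary X :=
  Quotient.mk (gromovSetoid X) x

theorem gromovProduct_isometry {X : Type*} [MetricSpace X] (g : X ≃ᵢ X) (x y o : X) :
    gromovProduct (g x) (g y) o = gromovProduct x y (g.symm o) := by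
  have h : ∀ u : X, dist (g u) o = dist u (g.symm o) := fun u => by
    rw [← g.dist_eq u (g.symm o), g.apply_symm_apply]
  unfold gromovProduct
  rw [h x, h y, g.dist_eq]

/-- An isometry maps Gromov sequences to Gromov sequences. -/
def GromovSeq.map {X : Type*} [MetricSpace X] (g : X ≃ᵢ X) (x : GromovSeq X) : GromovSeq X :=
  ⟨fun n => g (x.1 n), fun o => by
    simpa only [gromovProduct_isometry] using x.2 (g.symm o)⟩

/-- The extension of an isometry of `X` to the boundary. -/
def boundaryMap {X : Type*} [MetricSpace X] [IsGromovHyperbolic X] (g : X ≃ᵢ X) :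
    GromovBoundary X → GromovBoundary X :=
  Quotient.map (GromovSeq.map g) (fun x y (h : GromovSeq.Equivalent x y) o => by
    have h' := h (g.symm o)
    simp only [← gromovProduct_isometry] at h'
    exact h')

/-- `⟨ξ|η⟩_z` for boundary points `ξ, η`: the infimum of `liminf_{n,m} ⟨x_n|y_m⟩_z` over all
representatives; it is `⊤` when `ξ = η`. -/
def boundaryProduct {X : Type*} [MetricSpace X] [IsGromovHyperbolic X]
    (ξ η : GromovBoundary X) (z : X) : EReal :=
  ⨅ (x : GromovSeq X) (_ : x.toBoundary = ξ) (y : GromovSeq X) (_ : y.toBoundary = η),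
    liminf (fun p : ℕ × ℕ => ((gromovProduct (x.1 p.1) (y.1 p.2) z : ℝ) : EReal)) atTop

/-- `⟨y|ξ⟩_z` for a point `y` of the space and a boundary point `ξ`. -/
def mixedProduct {X : Type*} [MetricSpace X] [IsGromovHyperbolic X]
    (y : X) (ξ : GromovBoundary X) (z : X) : EReal :=
  ⨅ (x : GromovSeq X) (_ : x.toBoundary = ξ),
    liminf (fun n : ℕ => ((gromovProduct (x.1 n) y z : ℝ) : EReal)) atTop

/-- `b ^ (-t)`, with `b ^ (-∞) = 0`. -/
def negExp (b : ℝ) (t : EReal) : ℝ :=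
  if t = ⊤ then 0 else b ^ (-t.toReal)

/-- The metric carried by `∂X` is a visual metric with respect to the base point `o` and the
parameter `b`: it is comparable to `b ^ (-⟨ξ|η⟩_o)` up to a multiplicative constant. -/
def IsVisualMetric {X : Type*} [MetricSpace X] [IsGromovHyperbolic X]
    [MetricSpace (GromovBoundary X)] (o : X) (b : ℝ) : Prop :=
  ∃ C : ℝ, 0 < C ∧ ∀ ξ η : GromovBoundary X,
    C⁻¹ * negExp b (boundaryProduct ξ η o) ≤ dist ξ η ∧
      dist ξ η ≤ C * negExp b (boundaryProduct ξ η o)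

/-- The shadow cast by `x` from the light source `z`, with parameter `σ`. -/
def shadow {X : Type*} [MetricSpace X] [IsGromovHyperbolic X] (z x : X) (σ : ℝ) :
    Set (GromovBoundary X) :=
  {η | mixedProduct z η x ≤ (σ : EReal)}

/-- `x_n → ξ` in `X ∪ ∂X`, i.e. `⟨x_n|ξ⟩_o → ∞`. -/
def ConvergesToBoundary {X : Type*} [MetricSpace X] [IsGromovHyperbolic X] (o : X)
    (x : ℕ → X) (ξ : GromovBoundary X) : Prop :=
  Tendsto (fun n => mixedProduct (x n) ξ o) atTop (𝓝 ⊤)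

end Boundary

/-! ## Groups of isometries -/

section Groups

/-- Strong discreteness (metric properness) of a group of isometries. -/
def IsStronglyDiscrete {X : Type*} [MetricSpace X] (o : X) (G : Subgroup (X ≃ᵢ X)) : Prop :=
  ∀ r : ℝ, 0 < r → {g : X ≃ᵢ X | g ∈ G ∧ g o ∈ Metric.closedBall o r}.Finite

/-- North-south dynamics: the iterates of `g` converge to `p` uniformly off every neighbourhood
of `q`. -/
def AttractsOff {X : Type*} [MetricSpace X] [IsGromovHyperbolic X]
    [MetricSpace (GromovBoundary X)] (g : X ≃ᵢ X) (p q : GromovBoundary X) : Prop :=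
  ∀ U ∈ 𝓝 q, TendstoUniformlyOn (fun (n : ℕ) (ξ : GromovBoundary X) => (boundaryMap g)^[n] ξ)
    (fun _ => p) atTop Uᶜ

/-- Loxodromic isometries: two fixed points on the boundary, one attracting and one repelling. -/
def IsLoxodromic {X : Type*} [MetricSpace X] [IsGromovHyperbolic X]
    [MetricSpace (GromovBoundary X)] (g : X ≃ᵢ X) : Prop :=
  ∃ p q : GromovBoundary X, p ≠ q ∧ boundaryMap g p = p ∧ boundaryMap g q = q ∧
    AttractsOff g p q ∧ AttractsOff g.symm q p

/-- Groups of general type: there are two loxodromic elements without common boundary fixed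
point. -/
def IsGeneralType {X : Type*} [MetricSpace X] [IsGromovHyperbolic X]
    [MetricSpace (GromovBoundary X)] (G : Subgroup (X ≃ᵢ X)) : Prop :=
  ∃ g₁ ∈ G, ∃ g₂ ∈ G, IsLoxodromic g₁ ∧ IsLoxodromic g₂ ∧
    Disjoint {ξ | boundaryMap g₁ ξ = ξ} {ξ | boundaryMap g₂ ξ = ξ}

/-- The Poincaré exponent relative to `b`: the infimum of the exponents at which the Poincaré
series converges (`⊤` if there are none). -/
def poincareExponent {X : Type*} [MetricSpace X] (o : X) (b : ℝ) (G : Subgroup (X ≃ᵢ X)) :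
    ℝ≥0∞ :=
  ⨅ (s : ℝ≥0) (_ : Summable fun g : G => b ^ (-((s : ℝ) * dist o (g.1 o)))), (s : ℝ≥0∞)

/-- The radial limit set. -/
def radialLimitSet {X : Type*} [MetricSpace X] [IsGromovHyperbolic X] (o : X)
    (G : Subgroup (X ≃ᵢ X)) : Set (GromovBoundary X) :=
  {η | ∃ σ : ℝ, 0 < σ ∧ ∃ g : ℕ → X ≃ᵢ X, (∀ n, g n ∈ G) ∧
    ConvergesToBoundary o (fun n => g n o) η ∧ ∀ n, η ∈ shadow o (g n o) σ}

/-- The uniformly radial limit set. -/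
def uniformlyRadialLimitSet {X : Type*} [MetricSpace X] [IsGromovHyperbolic X] (o : X)
    (G : Subgroup (X ≃ᵢ X)) : Set (GromovBoundary X) :=
  {η | ∃ σ : ℝ, 0 < σ ∧ ∃ g : ℕ → X ≃ᵢ X, (∀ n, g n ∈ G) ∧
    ConvergesToBoundary o (fun n => g n o) η ∧ (∀ n, η ∈ shadow o (g n o) σ) ∧
    (∀ n, dist (g n o) (g (n + 1) o) ≤ σ) ∧ g 0 o = o}

/-- The points of the radial limit set that are badly approximable with respect to `ξ`. -/
def badlyApproximable {X : Type*} [MetricSpace X] [IsGromovHyperbolic X]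
    [MetricSpace (GromovBoundary X)] (o : X) (b : ℝ) (G : Subgroup (X ≃ᵢ X))
    (ξ : GromovBoundary X) : Set (GromovBoundary X) :=
  {η | η ∈ radialLimitSet o G ∧ ∃ ε : ℝ, 0 < ε ∧
    ∀ g ∈ G, ε * b ^ (-dist o (g o)) ≤ dist (boundaryMap g ξ) η}

end Groups

/-! ## Partition structures -/

section Partition

/-- A tree on `ℕ`: a set of finite words closed under initial segments. -/
def IsTree (T : Set (List ℕ)) : Prop :=
  ∀ ω τ : List ℕ, ω <+: τ → τ ∈ T → ω ∈ T

/-- Partition structures on a metric space `Z`; only the values of `P` on `T` matter. The distance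
condition `Dist(P_{ωa}, Z \ P_ω) ≥ κ D_ω` is written out pointwise. A set with `0 < Metric.diam` is
bounded, so `Metric.diam` is the true diameter. -/
structure IsPartitionStructure {Z : Type*} [MetricSpace Z] (T : Set (List ℕ))
    (P : List ℕ → Set Z) : Prop where
  tree : IsTree T
  closed : ∀ ω ∈ T, IsClosed (P ω)
  diam_pos : ∀ ω ∈ T, 0 < Metric.diam (P ω)
  nested : ∀ ω ∈ T, ∀ τ ∈ T, ω <+: τ → P τ ⊆ P ω
  disjoint : ∀ ω ∈ T, ∀ τ ∈ T, ¬ ω <+: τ → ¬ τ <+: ω → Disjoint (P ω) (P τ)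
  separation : ∃ κ : ℝ, 0 < κ ∧ ∃ lam : ℝ, 0 < lam ∧ lam < 1 ∧
    ∀ ω ∈ T, ∀ a : ℕ, ω ++ [a] ∈ T →
      (∀ z ∈ P (ω ++ [a]), ∀ w ∉ P ω, κ * Metric.diam (P ω) ≤ dist z w) ∧
      κ * Metric.diam (P ω) ≤ Metric.diam (P (ω ++ [a])) ∧
      Metric.diam (P (ω ++ [a])) ≤ lam * Metric.diam (P ω)

/-- The limit set: all points of the intersections `⋂_n P_{ω_1 … ω_n}` along the infinite branches
`ω` of the tree. -/
def partitionLimitSet {Z : Type*} (T : Set (List ℕ)) (P : List ℕ → Set Z) : Set Z :=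
  {z | ∃ ω : ℕ → ℕ, (∀ n : ℕ, (List.range n).map ω ∈ T) ∧
    ∀ n : ℕ, z ∈ P ((List.range n).map ω)}

/-- A metric space is Ahlfors `s`-regular: it is the support of a Borel measure for which the mass
of the closed ball of radius `r` about each point of the support is comparable to `r ^ s`, for
`0 < r < 1`. -/
def IsAhlforsRegular (s : ℝ) (Z : Type*) [MetricSpace Z] : Prop :=
  ∃ μ : @MeasureTheory.Measure Z (borel Z), ∃ C : ℝ, 0 < C ∧
    ∀ z : Z, ∀ r : ℝ, 0 < r → r < 1 →
      ENNReal.ofReal (C⁻¹ * r ^ s) ≤ μ (Metric.closedBall z r) ∧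
        μ (Metric.closedBall z r) ≤ ENNReal.ofReal (C * r ^ s)

/-- `T` and `ω ↦ x_ω` present a set `J = partitionLimitSet T (fun ω => shadow o (x ω) σ)` of the
kind `𝒥_s`: `x` embeds the tree `T` into the orbit `G(o)`, the shadows of the points `x_ω` form a
partition structure on `∂X`, and its limit set is an Ahlfors `s`-regular subset of the uniformly
radial limit set. -/
structure IsShadowStructure {X : Type*} [MetricSpace X] [IsGromovHyperbolic X]
    [MetricSpace (GromovBoundary X)] (o : X) (G : Subgroup (X ≃ᵢ X)) (s σ : ℝ)
    (T : Set (List ℕ)) (x : List ℕ → X) : Prop where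
  orbit : ∀ ω ∈ T, ∃ g ∈ G, x ω = g o
  injOn : Set.InjOn x T
  partition : IsPartitionStructure T (fun ω => shadow o (x ω) σ)
  uniformlyRadial :
    partitionLimitSet T (fun ω => shadow o (x ω) σ) ⊆ uniformlyRadialLimitSet o G
  ahlfors : IsAhlforsRegular s (partitionLimitSet T (fun ω => shadow o (x ω) σ))

end Partition

/-! ## The absolute winning game -/

section Game

/-- `Z` is `c`-uniformly perfect. -/
def IsUniformlyPerfect (c : ℝ) (Z : Type*) [MetricSpace Z] : Prop :=
  0 < c ∧ c < 1 ∧ ∀ z : Z, ∀ r : ℝ, 0 < r → r < 1 →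
    (Metric.closedBall z r \ Metric.closedBall z (c * r)).Nonempty

/-- A move in the game: a ball given by its centre and its positive radius. -/
structure FormalBall (Z : Type*) where
  center : Z
  radius : ℝ
  radius_pos : 0 < radius

/-- The (closed) ball described by a move. -/
def FormalBall.toSet {Z : Type*} [MetricSpace Z] (B : FormalBall Z) : Set Z :=
  Metric.closedBall B.center B.radius

/-- `S` is `β`-absolute winning. A strategy `F` for Alice answers the balls `B_0, …, B_n` chosen by
Bob so far with a ball of radius at most `β` times the radius of `B_n`. It is winning if
`⋂ B_n` meets `S` for every infinite sequence of moves of Bob that is legal against `F`. -/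
def IsBetaAbsoluteWinning {Z : Type*} [MetricSpace Z] (β : ℝ) (S : Set Z) : Prop :=
  ∃ F : (n : ℕ) → (Fin (n + 1) → FormalBall Z) → FormalBall Z,
    (∀ (n : ℕ) (B : Fin (n + 1) → FormalBall Z),
      (F n B).radius ≤ β * (B (Fin.last n)).radius) ∧
    ∀ B : ℕ → FormalBall Z,
      (∀ n : ℕ,
        (B (n + 1)).toSet ⊆ (B n).toSet \ (F n (fun i => B i)).toSet ∧
        β * (F n (fun i => B i)).radius ≤ (B (n + 1)).radius) →
      ((⋂ n, (B n).toSet) ∩ S).Nonempty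

/-- `S` is absolute winning on `Z`: the space `Z` is uniformly perfect, and `S` is `β`-absolute
winning for all `0 < β ≤ c / 5`, for every `c` for which `Z` is `c`-uniformly perfect. -/
def IsAbsoluteWinning {Z : Type*} [MetricSpace Z] (S : Set Z) : Prop :=
  (∃ c : ℝ, IsUniformlyPerfect c Z) ∧
    ∀ c : ℝ, IsUniformlyPerfect c Z → ∀ β : ℝ, 0 < β → β ≤ c / 5 → IsBetaAbsoluteWinning β S

end Game

end HypDioph

end

open HypDioph

/-! Part (1) rests on a tree of orbit points whose heights are prescribed up to a bounded error;
part (2) rests on a potential that Alice keeps small against the orbit of `ξ`.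

(1) Since `s < δ`, there are arbitrarily large `n` for which the annulus `n ≤ d(o, g o) ≤ n + 1`
contains at least `A * b ^ (s * n)` elements, with `A` as large as required
(`exists_large_annulus`); a fixed proportion of them has separated orbit points. General type
provides three elements, one of which always prevents backtracking (`IsGeneralType.exists_twist`).
Hence every orbit point has `N` children leading away from `o` (`exists_isBranching`), with disjoint
shadows lying deep inside its own shadow (`IsBranching.isPartitionStructure`). The length of a step
is known only up to an error, which could accumulate. To prevent this, write `N = b ^ (s * L)` and
take two steps at once whenever a vertex lags behind the height `|ω| * L`. Then `d(o, x_ω) = |ω| * L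
+ O(1)` (`IsBranching.abs_dist_treeElement_sub_le`). The uniform Bernoulli measure gives a set of
diameter about `b ^ (-n * L)` the mass `N ^ (-n) = b ^ (-s * n * L)`, which is `s`-regularity
(`IsPartitionStructure.isAhlforsRegular`).

(2) For any shadow structure, the limit set is compact and rays to its points stay near the orbit
(`IsVisualConst.exists_followsOrbit`). Alice must avoid the balls of radius `ε * b ^ (-d(o, g o))`
about `g ξ`. Her potential is the sum of `c`-th powers of the radii of those balls that meet Bob's
ball and are of larger scale. Either more than half of it sits near one point, and she removes a
neighbourhood of that point, or she waits until Bob's ball is so small that it carries at most half.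
So the potential is halved within a bounded range of scales, while new balls add little
(`IsSparseFamily.isBetaAbsoluteWinning`). The last claim needs `∑ w ^ c ≤ M * r ^ c` at every place
and scale `r`, for every `c > 0` (`IsVisualConst.isSparseFamily`). It holds because the scale of `g`
is taken to be `b ^ (-⟨g o|g ξ⟩_o)`, given by the height at which `g o` branches off the ray to `g
ξ`. Near the branch point there is an orbit point `h o`, and `g = h * f⁻¹` with `f o` near the ray
to `ξ`. There are boundedly many `h`, and boundedly many `f` per unit length, so the sum is
geometric. -/

namespace HypDioph

/-! ### Gromov products -/

section Products

variable {X : Type*} [MetricSpace X]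

theorem gromovProduct_nonneg (x y z : X) : 0 ≤ gromovProduct x y z := by
  unfold gromovProduct
  have := dist_triangle_right x y z
  linarith

theorem gromovProduct_le_dist_left (x y z : X) : gromovProduct x y z ≤ dist x z := by
  unfold gromovProduct
  have := dist_triangle_left y z x
  linarith

theorem gromovProduct_le_dist_right (x y z : X) : gromovProduct x y z ≤ dist y z := by
  rw [gromovProduct_comm]
  exact gromovProduct_le_dist_left y x z

theorem gromovProduct_add_gromovProduct (x y z : X) :
    gromovProduct x y z + gromovProduct x z y = dist y z := by
  unfold gromovProduct
  rw [dist_comm z y]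
  ring

theorem dist_eq_sub_gromovProduct (x y z : X) :
    dist x y = dist x z + dist y z - 2 * gromovProduct x y z := by
  unfold gromovProduct
  ring

theorem gromovProduct_sub_dist_le (x y z w : X) :
    gromovProduct x y z - dist z w ≤ gromovProduct x y w := by
  unfold gromovProduct
  have h1 := dist_triangle_right x z w
  have h2 := dist_triangle_right y z w
  linarith

theorem gromovProduct_map (g : X ≃ᵢ X) (x y z : X) :
    gromovProduct (g x) (g y) (g z) = gromovProduct x y z := by
  rw [gromovProduct_isometry, g.symm_apply_apply]

variable (X) in
/-- A nonnegative constant for the four point inequality. -/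
noncomputable def hypConst [IsGromovHyperbolic X] : ℝ :=
  max (Classical.choose (IsGromovHyperbolic.four_point (X := X))) 0

variable [IsGromovHyperbolic X]

variable (X) in
theorem hypConst_nonneg : 0 ≤ hypConst X := le_max_right _ _

theorem min_gromovProduct_sub_le (x y z w : X) :
    min (gromovProduct x y w) (gromovProduct y z w) - hypConst X ≤ gromovProduct x z w := by
  have h := Classical.choose_spec (IsGromovHyperbolic.four_point (X := X)) x y z w
  have := le_max_left (Classical.choose (IsGromovHyperbolic.four_point (X := X))) 0
  unfold hypConst
  linarith

theorem sub_hypConst_le_gromovProduct {x y z w : X} {t : ℝ} (h₁ : t ≤ gromovProduct x y w)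
    (h₂ : t ≤ gromovProduct y z w) : t - hypConst X ≤ gromovProduct x z w := by
  have := min_gromovProduct_sub_le x y z w
  have := le_min h₁ h₂
  linarith

/-! ### Products with one boundary point -/

/-- The Gromov product of a point of the space with a boundary point, as a real number. -/
noncomputable def bdryProd (y : X) (ξ : GromovBoundary X) (z : X) : ℝ :=
  (mixedProduct y ξ z).toReal

theorem exists_rep (ξ : GromovBoundary X) : ∃ x : GromovSeq X, x.toBoundary = ξ :=
  Quotient.exists_rep ξ

theorem mixedProduct_le_liminf (y z : X) {ξ : GromovBoundary X} {x : GromovSeq X}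
    (hx : x.toBoundary = ξ) :
    mixedProduct y ξ z ≤ liminf (fun n : ℕ => ((gromovProduct (x.1 n) y z : ℝ) : EReal)) atTop :=
  iInf₂_le x hx

theorem mixedProduct_nonneg (y : X) (ξ : GromovBoundary X) (z : X) : 0 ≤ mixedProduct y ξ z :=
  le_iInf₂ fun x _ => le_liminf_of_le (by isBoundedDefault) (Eventually.of_forall fun n => by
    exact_mod_cast gromovProduct_nonneg _ _ _)

theorem mixedProduct_le_dist (y : X) (ξ : GromovBoundary X) (z : X) :
    mixedProduct y ξ z ≤ (dist y z : ℝ) := by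
  obtain ⟨x, hx⟩ := exists_rep ξ
  refine (mixedProduct_le_liminf y z hx).trans (liminf_le_of_frequently_le'
    (Eventually.frequently (Eventually.of_forall fun n => ?_)))
  exact_mod_cast gromovProduct_le_dist_right _ _ _

theorem coe_bdryProd (y : X) (ξ : GromovBoundary X) (z : X) :
    (bdryProd y ξ z : EReal) = mixedProduct y ξ z := by
  refine EReal.coe_toReal (fun h => ?_) (fun h => ?_)
  · have := mixedProduct_le_dist y ξ z
    rw [h, top_le_iff] at this
    exact EReal.coe_ne_top _ this
  · have := mixedProduct_nonneg y ξ z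
    rw [h] at this
    exact absurd this (by simp)

theorem bdryProd_nonneg (y : X) (ξ : GromovBoundary X) (z : X) : 0 ≤ bdryProd y ξ z := by
  have := mixedProduct_nonneg y ξ z
  rw [← coe_bdryProd] at this
  exact_mod_cast this

theorem bdryProd_le_dist (y : X) (ξ : GromovBoundary X) (z : X) : bdryProd y ξ z ≤ dist y z := by
  have := mixedProduct_le_dist y ξ z
  rw [← coe_bdryProd] at this
  exact_mod_cast this

theorem eventually_lt_of_lt_bdryProd {y z : X} {ξ : GromovBoundary X} {x : GromovSeq X}
    (hx : x.toBoundary = ξ) {t : ℝ} (ht : t < bdryProd y ξ z) :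
    ∀ᶠ n in atTop, t < gromovProduct (x.1 n) y z := by
  have h : (t : EReal) <
      liminf (fun n : ℕ => ((gromovProduct (x.1 n) y z : ℝ) : EReal)) atTop :=
    lt_of_lt_of_le (by rw [← coe_bdryProd]; exact_mod_cast ht) (mixedProduct_le_liminf y z hx)
  filter_upwards [eventually_lt_of_lt_liminf h (by isBoundedDefault)] with n hn
  exact_mod_cast hn

theorem le_bdryProd_of_forall {y z : X} {ξ : GromovBoundary X} {t : ℝ}
    (h : ∀ x : GromovSeq X, x.toBoundary = ξ → ∀ᶠ n in atTop, t ≤ gromovProduct (x.1 n) y z) :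
    t ≤ bdryProd y ξ z := by
  have : (t : EReal) ≤ mixedProduct y ξ z := le_iInf₂ fun x hx =>
    le_liminf_of_le (by isBoundedDefault) ((h x hx).mono fun n hn => by exact_mod_cast hn)
  rw [← coe_bdryProd] at this
  exact_mod_cast this

theorem exists_forall_le_gromovProduct {x x' : GromovSeq X} (h : x.toBoundary = x'.toBoundary)
    (o : X) (M : ℝ) : ∃ N, ∀ n ≥ N, ∀ m ≥ N, M ≤ gromovProduct (x.1 n) (x'.1 m) o := by
  have he : GromovSeq.Equivalent x x' := Quotient.exact h
  have h1 := (tendsto_atTop.1 (he o)) (M + hypConst X)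
  have h2 := (tendsto_atTop.1 (x.2 o)) (M + hypConst X)
  obtain ⟨⟨i, j⟩, h2⟩ := eventually_atTop.1 h2
  obtain ⟨N, hN⟩ := eventually_atTop.1
    (h1.and ((eventually_ge_atTop i).and (eventually_ge_atTop j)))
  refine ⟨N, fun n hn m hm => ?_⟩
  have := sub_hypConst_le_gromovProduct (h2 (n, m) ⟨(hN n hn).2.1, (hN m hm).2.2⟩) (hN m hm).1
  linarith

/-- Two representatives of `ξ` are eventually close to each other, so a change of representative
costs one `hypConst`; therefore a bound along a subsequence of a single representative controls the
infimum. -/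
theorem sub_le_bdryProd_of_frequently {y z : X} {ξ : GromovBoundary X} {x : GromovSeq X}
    (hx : x.toBoundary = ξ) {t : ℝ} (h : ∃ᶠ n in atTop, t ≤ gromovProduct (x.1 n) y z) :
    t - hypConst X ≤ bdryProd y ξ z := by
  refine le_bdryProd_of_forall fun x' hx' => ?_
  obtain ⟨N, hN⟩ := exists_forall_le_gromovProduct (hx'.trans hx.symm) z t
  filter_upwards [eventually_ge_atTop N] with n hn
  obtain ⟨m, hm, hm'⟩ := (h.and_eventually (eventually_ge_atTop N)).exists
  exact sub_hypConst_le_gromovProduct (hN n hn m hm') hm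

theorem sub_le_gromovProduct_of_le_bdryProd {x y z : X} {ξ : GromovBoundary X} {t : ℝ}
    (h₁ : t ≤ bdryProd x ξ z) (h₂ : t ≤ bdryProd y ξ z) :
    t - hypConst X ≤ gromovProduct x y z := by
  refine le_of_forall_pos_sub_le fun ε hε => ?_
  obtain ⟨u, hu⟩ := exists_rep ξ
  obtain ⟨n, h1, h2⟩ := ((eventually_lt_of_lt_bdryProd hu
    (show t - ε < bdryProd x ξ z by linarith)).and (eventually_lt_of_lt_bdryProd hu
    (show t - ε < bdryProd y ξ z by linarith))).exists
  rw [gromovProduct_comm] at h1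
  have := sub_hypConst_le_gromovProduct h1.le h2.le
  linarith

theorem sub_le_bdryProd {x y z : X} {ξ : GromovBoundary X} {t : ℝ}
    (h₁ : t ≤ gromovProduct x y z) (h₂ : t ≤ bdryProd y ξ z) :
    t - hypConst X ≤ bdryProd x ξ z := by
  refine le_of_forall_pos_sub_le fun ε hε => ?_
  refine le_bdryProd_of_forall fun u hu => ?_
  filter_upwards [eventually_lt_of_lt_bdryProd hu
    (show t - ε < bdryProd y ξ z by linarith)] with n hn
  rw [gromovProduct_comm] at h₁
  have := sub_hypConst_le_gromovProduct hn.le (show t - ε ≤ gromovProduct y x z by linarith)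
  linarith

theorem bdryProd_add_le (x z : X) (ξ : GromovBoundary X) :
    bdryProd x ξ z + bdryProd z ξ x ≤ dist x z := by
  refine le_of_forall_pos_sub_le fun ε hε => ?_
  obtain ⟨u, hu⟩ := exists_rep ξ
  obtain ⟨n, h1, h2⟩ := ((eventually_lt_of_lt_bdryProd hu
    (show bdryProd x ξ z - ε / 2 < bdryProd x ξ z by linarith)).and
    (eventually_lt_of_lt_bdryProd hu
    (show bdryProd z ξ x - ε / 2 < bdryProd z ξ x by linarith))).exists
  have := gromovProduct_add_gromovProduct (u.1 n) x z
  linarith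

/-- Along a sequence the two products add up exactly to the distance. One `hypConst` is lost in
bounding the first product from above along a representative, another in returning to the infimum
for the second. -/
theorem le_bdryProd_add (x z : X) (ξ : GromovBoundary X) :
    dist x z - 2 * hypConst X ≤ bdryProd x ξ z + bdryProd z ξ x := by
  refine le_of_forall_pos_sub_le fun ε hε => ?_
  obtain ⟨u, hu⟩ := exists_rep ξ
  have h : ∀ᶠ n in atTop,
      ¬ (bdryProd x ξ z + hypConst X + ε ≤ gromovProduct (u.1 n) x z) := by
    rw [← not_frequently]
    intro h
    have := sub_le_bdryProd_of_frequently hu h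
    linarith
  have h' : ∃ᶠ n in atTop,
      dist x z - (bdryProd x ξ z + hypConst X + ε) ≤ gromovProduct (u.1 n) z x := by
    refine (h.mono fun n hn => ?_).frequently
    have := gromovProduct_add_gromovProduct (u.1 n) x z
    linarith
  have := sub_le_bdryProd_of_frequently hu h'
  linarith

theorem tendsto_bdryProd_rep {η : GromovBoundary X} {y : GromovSeq X} (hy : y.toBoundary = η)
    (o : X) : Tendsto (fun n => bdryProd (y.1 n) η o) atTop atTop := by
  refine tendsto_atTop.2 fun M => ?_
  obtain ⟨N, hN⟩ := exists_forall_le_gromovProduct (rfl : y.toBoundary = y.toBoundary) o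
    (M + hypConst X)
  filter_upwards [eventually_ge_atTop N] with n hn
  have := sub_le_bdryProd_of_frequently hy (y := y.1 n) (z := o)
    ((eventually_ge_atTop N).mono fun m hm => hN m hm n hn).frequently
  linarith

/-- Points that follow `η` for a long time follow one another for a long time. This recognises a
given sequence as a representative of `η`. -/
theorem exists_rep_of_tendsto_bdryProd {η : GromovBoundary X} {y : ℕ → X} {o : X}
    (h : Tendsto (fun n => bdryProd (y n) η o) atTop atTop) :
    ∃ u : GromovSeq X, u.1 = y ∧ u.toBoundary = η := by
  have hy : IsGromovSeq y := fun o' => by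
    refine tendsto_atTop.2 fun M => ?_
    obtain ⟨N, hN⟩ := eventually_atTop.1 ((tendsto_atTop.1 h) (M + hypConst X + dist o o'))
    rw [← prod_atTop_atTop_eq]
    filter_upwards [prod_mem_prod (Ici_mem_atTop N) (Ici_mem_atTop N)] with p hp
    have h1 := sub_le_gromovProduct_of_le_bdryProd (hN p.1 hp.1) (hN p.2 hp.2)
    have h2 := gromovProduct_sub_dist_le (y p.1) (y p.2) o o'
    linarith
  obtain ⟨v, hv⟩ := exists_rep η
  refine ⟨⟨y, hy⟩, rfl, ?_⟩
  rw [← hv]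
  refine Quotient.sound fun o' => ?_
  refine tendsto_atTop.2 fun M => ?_
  filter_upwards [(tendsto_atTop.1 h) (M + hypConst X + dist o o'),
    (tendsto_atTop.1 (tendsto_bdryProd_rep hv o)) (M + hypConst X + dist o o')] with n h1 h2
  have h3 := sub_le_gromovProduct_of_le_bdryProd h1 h2
  have h4 := gromovProduct_sub_dist_le (y n) (v.1 n) o o'
  linarith

/-! ### Isometries -/

theorem boundaryMap_toBoundary (g : X ≃ᵢ X) (x : GromovSeq X) :
    boundaryMap g x.toBoundary = (x.map g).toBoundary := rfl

theorem boundaryMap_mul (g h : X ≃ᵢ X) (ξ : GromovBoundary X) :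
    boundaryMap (g * h) ξ = boundaryMap g (boundaryMap h ξ) := by
  obtain ⟨x, rfl⟩ := exists_rep ξ
  rfl

theorem boundaryMap_one (ξ : GromovBoundary X) : boundaryMap (1 : X ≃ᵢ X) ξ = ξ := by
  obtain ⟨x, rfl⟩ := exists_rep ξ
  rfl

theorem boundaryMap_inv_apply (g : X ≃ᵢ X) (ξ : GromovBoundary X) :
    boundaryMap g⁻¹ (boundaryMap g ξ) = ξ := by
  rw [← boundaryMap_mul, inv_mul_cancel, boundaryMap_one]

theorem boundaryMap_apply_inv (g : X ≃ᵢ X) (ξ : GromovBoundary X) :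
    boundaryMap g (boundaryMap g⁻¹ ξ) = ξ := by
  rw [← boundaryMap_mul, mul_inv_cancel, boundaryMap_one]

theorem boundaryMap_iterate (g : X ≃ᵢ X) (n : ℕ) (ξ : GromovBoundary X) :
    (boundaryMap g)^[n] ξ = boundaryMap (g ^ n) ξ := by
  induction n with
  | zero => rw [pow_zero, boundaryMap_one, Function.iterate_zero_apply]
  | succ n ih => rw [Function.iterate_succ_apply', ih, pow_succ', boundaryMap_mul]

theorem le_bdryProd_map (g : X ≃ᵢ X) (y z : X) (ξ : GromovBoundary X) :
    bdryProd y ξ z ≤ bdryProd (g y) (boundaryMap g ξ) (g z) := by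
  refine le_of_forall_pos_sub_le fun ε hε => ?_
  refine le_bdryProd_of_forall fun u hu => ?_
  have hu' : (u.map g⁻¹).toBoundary = ξ := by
    rw [← boundaryMap_toBoundary, hu, boundaryMap_inv_apply]
  filter_upwards [eventually_lt_of_lt_bdryProd hu'
    (show bdryProd y ξ z - ε < bdryProd y ξ z by linarith)] with n hn
  have h : u.1 n = g ((u.map g⁻¹).1 n) := (g.apply_symm_apply (u.1 n)).symm
  rw [h, gromovProduct_map]
  exact hn.le

theorem bdryProd_map (g : X ≃ᵢ X) (y z : X) (ξ : GromovBoundary X) :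
    bdryProd (g y) (boundaryMap g ξ) (g z) = bdryProd y ξ z := by
  refine le_antisymm ?_ (le_bdryProd_map g y z ξ)
  have h := le_bdryProd_map g⁻¹ (g y) (g z) (boundaryMap g ξ)
  rw [boundaryMap_inv_apply] at h
  have h' : ∀ x, g⁻¹ (g x) = x := g.symm_apply_apply
  rwa [h', h'] at h

/-! ### The boundary product -/

theorem le_boundaryProduct {ξ η : GromovBoundary X} {z : X} {t : ℝ}
    (h : ∀ x y : GromovSeq X, x.toBoundary = ξ → y.toBoundary = η →
      ∀ᶠ p : ℕ × ℕ in atTop, t ≤ gromovProduct (x.1 p.1) (y.1 p.2) z) :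
    (t : EReal) ≤ boundaryProduct ξ η z :=
  le_iInf₂ fun x hx => le_iInf₂ fun y hy => le_liminf_of_le (by isBoundedDefault)
    ((h x y hx hy).mono fun p hp => by exact_mod_cast hp)

theorem eventually_lt_of_lt_boundaryProduct {ξ η : GromovBoundary X} {z : X} {t : ℝ}
    (h : (t : EReal) < boundaryProduct ξ η z) {x y : GromovSeq X} (hx : x.toBoundary = ξ)
    (hy : y.toBoundary = η) :
    ∀ᶠ p : ℕ × ℕ in atTop, t < gromovProduct (x.1 p.1) (y.1 p.2) z := by
  have h' := lt_of_lt_of_le h (iInf₂_le x hx |>.trans (iInf₂_le y hy))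
  filter_upwards [eventually_lt_of_lt_liminf h' (by isBoundedDefault)] with p hp
  exact_mod_cast hp

theorem boundaryProduct_nonneg (ξ η : GromovBoundary X) (z : X) : 0 ≤ boundaryProduct ξ η z := by
  have := le_boundaryProduct (ξ := ξ) (η := η) (z := z) (t := 0) fun x y _ _ =>
    Eventually.of_forall fun p => gromovProduct_nonneg _ _ _
  exact_mod_cast this

theorem eventually_prod_of_forall {P : ℕ × ℕ → Prop} {p q : ℕ → Prop} (hp : ∀ᶠ n in atTop, p n)
    (hq : ∀ᶠ n in atTop, q n) (h : ∀ n m, p n → q m → P (n, m)) : ∀ᶠ x in atTop, P x := by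
  rw [← prod_atTop_atTop_eq]
  filter_upwards [hp.prod_mk hq] with x hx
  exact h _ _ hx.1 hx.2

theorem sub_le_boundaryProduct {y z : X} {ξ η : GromovBoundary X} {t : ℝ}
    (h₁ : t < bdryProd y ξ z) (h₂ : t < bdryProd y η z) :
    ((t - hypConst X : ℝ) : EReal) ≤ boundaryProduct ξ η z := by
  refine le_boundaryProduct fun u v hu hv => ?_
  refine eventually_prod_of_forall (eventually_lt_of_lt_bdryProd hu h₁)
    (eventually_lt_of_lt_bdryProd hv h₂) fun n m hn hm => ?_
  rw [gromovProduct_comm] at hm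
  exact sub_hypConst_le_gromovProduct hn.le hm.le

theorem sub_le_bdryProd_of_boundaryProduct {y z : X} {ξ η : GromovBoundary X} {t : ℝ}
    (h₁ : (t : EReal) < boundaryProduct ξ η z) (h₂ : t < bdryProd y ξ z) :
    t - hypConst X ≤ bdryProd y η z := by
  obtain ⟨u, hu⟩ := exists_rep ξ
  refine le_bdryProd_of_forall fun v hv => ?_
  have h := eventually_lt_of_lt_boundaryProduct h₁ hu hv
  obtain ⟨⟨i, j⟩, h⟩ := eventually_atTop.1 h
  filter_upwards [eventually_ge_atTop j] with m hm
  obtain ⟨n, hn, hn'⟩ := ((eventually_ge_atTop i).and (eventually_lt_of_lt_bdryProd hu h₂)).exists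
  have hn := h (n, m) ⟨hn, hm⟩
  rw [gromovProduct_comm] at hn
  exact sub_hypConst_le_gromovProduct hn.le hn'.le

theorem le_boundaryProduct_map {ξ η : GromovBoundary X} {z : X} {t : ℝ}
    (h : (t : EReal) < boundaryProduct ξ η z) (g : X ≃ᵢ X) :
    ((t - dist z (g z) : ℝ) : EReal) ≤ boundaryProduct (boundaryMap g ξ) (boundaryMap g η) z := by
  refine le_boundaryProduct fun u v hu hv => ?_
  have hu' : (u.map g⁻¹).toBoundary = ξ := by
    rw [← boundaryMap_toBoundary, hu, boundaryMap_inv_apply]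
  have hv' : (v.map g⁻¹).toBoundary = η := by
    rw [← boundaryMap_toBoundary, hv, boundaryMap_inv_apply]
  filter_upwards [eventually_lt_of_lt_boundaryProduct h hu' hv'] with p hp
  have h1 : u.1 p.1 = g ((u.map g⁻¹).1 p.1) := (g.apply_symm_apply _).symm
  have h2 : v.1 p.2 = g ((v.map g⁻¹).1 p.2) := (g.apply_symm_apply _).symm
  have h3 := gromovProduct_sub_dist_le (u.1 p.1) (v.1 p.2) (g z) z
  rw [h1, h2, gromovProduct_map] at h3
  rw [h1, h2]
  rw [dist_comm z]
  linarith

end Products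

/-! ### Visual metrics -/

section Visual

variable {X : Type*} [MetricSpace X] [IsGromovHyperbolic X] [MetricSpace (GromovBoundary X)]
  {o : X} {b : ℝ}

/-- `V` is a constant for the comparison of the visual metric with Gromov products. -/
structure IsVisualConst (o : X) (b V : ℝ) : Prop where
  nonneg : 0 ≤ V
  dist_le : ∀ (y : X) (ξ η : GromovBoundary X) (t : ℝ), t ≤ bdryProd y ξ o →
    t ≤ bdryProd y η o → dist ξ η ≤ b ^ (V - t)
  le_bdryProd : ∀ (y : X) (ξ η : GromovBoundary X) (t : ℝ), dist ξ η ≤ b ^ (-t) →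
    t ≤ bdryProd y ξ o → t - V ≤ bdryProd y η o
  dist_map_le : ∀ (g : X ≃ᵢ X) (ξ η : GromovBoundary X),
    dist (boundaryMap g ξ) (boundaryMap g η) ≤ b ^ (V + dist o (g o)) * dist ξ η

theorem negExp_le (hb : 1 < b) {t : ℝ} {u : EReal} (hu : (t : EReal) ≤ u) :
    negExp b u ≤ b ^ (-t) := by
  unfold negExp
  split_ifs with h
  · positivity
  · have hbot : u ≠ ⊥ := by
      rintro rfl
      exact absurd hu (by simp)
    refine Real.rpow_le_rpow_of_exponent_le hb.le ?_
    rw [← EReal.coe_toReal h hbot] at hu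
    have : t ≤ u.toReal := by exact_mod_cast hu
    linarith

theorem le_of_negExp_le (hb : 1 < b) {t : ℝ} {u : EReal} (hu0 : 0 ≤ u)
    (hu : negExp b u ≤ b ^ (-t)) : (t : EReal) ≤ u := by
  unfold negExp at hu
  split_ifs at hu with h
  · rw [h]
    exact le_top
  · have hbot : u ≠ ⊥ := by
      rintro rfl
      exact absurd hu0 (by simp)
    rw [Real.rpow_le_rpow_left_iff hb] at hu
    rw [← EReal.coe_toReal h hbot]
    exact_mod_cast (by linarith : t ≤ u.toReal)

theorem exists_isVisualConst (hb : 1 < b) (hvis : IsVisualMetric (X := X) o b) :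
    ∃ V, IsVisualConst o b V := by
  obtain ⟨C, hC, h⟩ := hvis
  have hb0 : 0 < b := by linarith
  obtain ⟨v, hv0, hv⟩ : ∃ v : ℝ, 0 ≤ v ∧ C ≤ b ^ v := by
    refine ⟨max (Real.logb b C) 0, le_max_right _ _, ?_⟩
    calc C = b ^ (Real.logb b C) := (Real.rpow_logb hb0 hb.ne' hC).symm
      _ ≤ _ := Real.rpow_le_rpow_of_exponent_le hb.le (le_max_left _ _)
  have up : ∀ (ξ η : GromovBoundary X) (t : ℝ), (t : EReal) ≤ boundaryProduct ξ η o →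
      dist ξ η ≤ b ^ (v - t) := fun ξ η t ht => by
    refine (h ξ η).2.trans ?_
    rw [sub_eq_add_neg, Real.rpow_add hb0]
    exact mul_le_mul hv (negExp_le hb ht) (by unfold negExp; split_ifs <;> positivity)
      (by positivity)
  have low : ∀ (ξ η : GromovBoundary X) (t : ℝ), dist ξ η ≤ b ^ (-t) →
      ((t - v : ℝ) : EReal) ≤ boundaryProduct ξ η o := fun ξ η t ht => by
    refine le_of_negExp_le hb (boundaryProduct_nonneg _ _ _) ?_
    have h1 := (h ξ η).1.trans ht
    rw [inv_mul_le_iff₀ hC] at h1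
    refine h1.trans ?_
    rw [neg_sub, sub_eq_add_neg, Real.rpow_add hb0]
    gcongr
  have hH := hypConst_nonneg X
  -- `v` is paid for each comparison of the metric with the product, at most twice; `hypConst` pays
  -- for the four point inequality and `1` for strict inequalities.
  refine ⟨2 * v + hypConst X + 1, by linarith, ?_, ?_, ?_⟩
  · intro y ξ η t h1 h2
    refine (up ξ η (t - 1 - hypConst X) (sub_le_boundaryProduct (y := y) ?_ ?_)).trans
      (Real.rpow_le_rpow_of_exponent_le hb.le ?_) <;> linarith
  · intro y ξ η t h1 h2
    have h3 := sub_le_bdryProd_of_boundaryProduct (y := y) (t := t - v - 1 / 2) (ξ := ξ) (η := η)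
      (z := o) (lt_of_lt_of_le (by exact_mod_cast (by linarith)) (low ξ η t h1)) (by linarith)
    linarith
  · intro g ξ η
    rcases eq_or_ne ξ η with rfl | hne
    · simp
    · have hpos : 0 < dist ξ η := dist_pos.2 hne
      set t := -Real.logb b (dist ξ η) with ht
      have hd : b ^ (-t) = dist ξ η := by
        rw [ht, neg_neg, Real.rpow_logb hb0 hb.ne' hpos]
      have h1 : ((t - v - 1 : ℝ) : EReal) < boundaryProduct ξ η o :=
        lt_of_lt_of_le (by exact_mod_cast (by linarith)) (low ξ η t hd.ge)
      refine (up _ _ _ (le_boundaryProduct_map h1 g)).trans ?_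
      rw [← hd, ← Real.rpow_add hb0]
      exact Real.rpow_le_rpow_of_exponent_le hb.le (by linarith)

end Visual

/-! ### Branches of partition structures -/

section Branches

/-- The initial segment of length `n` of an infinite word. -/
def initialWord (ω : ℕ → ℕ) (n : ℕ) : List ℕ := (List.range n).map ω

theorem initialWord_zero (ω : ℕ → ℕ) : initialWord ω 0 = [] := rfl

theorem initialWord_succ (ω : ℕ → ℕ) (n : ℕ) :
    initialWord ω (n + 1) = initialWord ω n ++ [ω n] := by
  simp [initialWord, List.range_succ]

theorem length_initialWord (ω : ℕ → ℕ) (n : ℕ) : (initialWord ω n).length = n := by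
  simp [initialWord]

theorem initialWord_prefix (ω : ℕ → ℕ) {n m : ℕ} (h : n ≤ m) :
    initialWord ω n <+: initialWord ω m := by
  induction m, h using Nat.le_induction with
  | base => exact List.prefix_rfl
  | succ m _ ih =>
    rw [initialWord_succ]
    exact ih.trans (List.prefix_append _ _)

theorem initialWord_congr {ω ω' : ℕ → ℕ} {n : ℕ} (h : ∀ i < n, ω i = ω' i) :
    initialWord ω n = initialWord ω' n :=
  List.map_congr_left fun i hi => h i (List.mem_range.1 hi)

theorem eq_of_initialWord_eq {ω ω' : ℕ → ℕ} {n : ℕ} (h : initialWord ω n = initialWord ω' n) :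
    ∀ i < n, ω i = ω' i := fun i hi =>
  (List.map_inj_left.1 h) i (List.mem_range.2 hi)

theorem eventually_initialWord_eq (ω : ℕ → ℕ) (n : ℕ) :
    ∀ᶠ ω' in 𝓝 ω, initialWord ω' n = initialWord ω n := by
  have h : ∀ᶠ ω' in 𝓝 ω, ∀ i ∈ Finset.range n, ω' i = ω i :=
    (Finset.eventually_all _).2 fun i _ =>
      (continuous_apply (A := fun _ : ℕ => ℕ) i).continuousAt.eventually
        (show ∀ᶠ a in 𝓝 (ω i), a = ω i by simp)
  filter_upwards [h] with ω' h
  exact initialWord_congr fun i hi => h i (Finset.mem_range.2 hi)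

variable {Z : Type*} [MetricSpace Z] {T : Set (List ℕ)} {P : List ℕ → Set Z}

theorem isBounded_of_diam_pos {s : Set Z} (h : 0 < Metric.diam s) : Bornology.IsBounded s := by
  by_contra hs
  rw [Metric.diam_eq_zero_of_unbounded hs] at h
  exact lt_irrefl _ h

theorem nonempty_of_diam_pos {s : Set Z} (h : 0 < Metric.diam s) : s.Nonempty := by
  rw [nonempty_iff_ne_empty]
  rintro rfl
  simp at h

theorem IsPartitionStructure.tendsto_diam (hP : IsPartitionStructure T P) :
    ∃ u : ℕ → ℝ, Tendsto u atTop (𝓝 0) ∧ ∀ ω : ℕ → ℕ, (∀ n, initialWord ω n ∈ T) →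
      ∀ n, Metric.diam (P (initialWord ω n)) ≤ u n := by
  obtain ⟨κ, -, lam, h0, h1, h⟩ := hP.separation
  refine ⟨fun n => lam ^ n * Metric.diam (P []), ?_, fun ω hω n => ?_⟩
  · simpa using (tendsto_pow_atTop_nhds_zero_of_lt_one h0.le h1).mul_const (Metric.diam (P []))
  · induction n with
    | zero => simp [initialWord_zero]
    | succ n ih =>
      have h2 := hω (n + 1)
      rw [initialWord_succ] at h2 ⊢
      refine (h _ (hω n) _ h2).2.2.trans ?_
      calc lam * Metric.diam (P (initialWord ω n)) ≤ lam * (lam ^ n * Metric.diam (P [])) := by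
            gcongr
        _ = lam ^ (n + 1) * Metric.diam (P []) := by ring

theorem IsPartitionStructure.dist_le_diam (hP : IsPartitionStructure T P) {ω : List ℕ}
    (hω : ω ∈ T) {z w : Z} (hz : z ∈ P ω) (hw : w ∈ P ω) : dist z w ≤ Metric.diam (P ω) :=
  Metric.dist_le_diam_of_mem (isBounded_of_diam_pos (hP.diam_pos ω hω)) hz hw

theorem IsPartitionStructure.eq_of_mem_branch (hP : IsPartitionStructure T P) {ω : ℕ → ℕ}
    (hω : ∀ n, initialWord ω n ∈ T) {z w : Z} (hz : ∀ n, z ∈ P (initialWord ω n))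
    (hw : ∀ n, w ∈ P (initialWord ω n)) : z = w := by
  obtain ⟨u, hu, hu'⟩ := hP.tendsto_diam
  refine dist_le_zero.1 (ge_of_tendsto' hu fun n => ?_)
  exact (hP.dist_le_diam (hω n) (hz n) (hw n)).trans (hu' ω hω n)

theorem IsPartitionStructure.continuous_of_branch (hP : IsPartitionStructure T P) {Y : Type*}
    [TopologicalSpace Y] {f : Y → Z} {c : Y → ℕ → ℕ} (hc : Continuous c)
    (hT : ∀ y n, initialWord (c y) n ∈ T) (hf : ∀ y n, f y ∈ P (initialWord (c y) n)) :
    Continuous f := by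
  obtain ⟨u, hu, hu'⟩ := hP.tendsto_diam
  refine continuous_iff_continuousAt.2 fun y => Metric.tendsto_nhds.2 fun ε hε => ?_
  obtain ⟨n, hn⟩ := (hu.eventually (gt_mem_nhds hε)).exists
  filter_upwards [hc.continuousAt.eventually (eventually_initialWord_eq (c y) n)] with y' hy'
  have h := hf y' n
  rw [hy'] at h
  exact ((hP.dist_le_diam (hT y n) h (hf y n)).trans (hu' _ (hT y) n)).trans_lt hn

/-- Finite branching makes every level finite, so the branches form a closed subset of a product of
finite sets. -/
theorem isCompact_branches (hT : IsTree T) (hfin : ∀ ω ∈ T, {a | ω ++ [a] ∈ T}.Finite) :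
    IsCompact {ω : ℕ → ℕ | ∀ n, initialWord ω n ∈ T} := by
  have hlev : ∀ n, {ω : List ℕ | ω ∈ T ∧ ω.length = n}.Finite := fun n => by
    induction n with
    | zero =>
      refine (finite_singleton []).subset fun ω hω => ?_
      exact List.length_eq_zero_iff.1 hω.2
    | succ n ih =>
      refine (ih.biUnion (t := fun ω => (fun a => ω ++ [a]) '' {a | ω ++ [a] ∈ T})
        fun ω hω => (hfin ω hω.1).image _).subset fun ω hω => ?_
      have hne : ω ≠ [] := by
        rintro rfl
        simp at hω
      have hd := List.dropLast_append_getLast hne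
      refine mem_biUnion (x := ω.dropLast) ⟨hT _ ω (List.dropLast_prefix ω) hω.1, ?_⟩
        ⟨ω.getLast hne, ?_, hd⟩
      · rw [List.length_dropLast, hω.2, Nat.add_sub_cancel]
      · rw [mem_ofPred_eq, hd]
        exact hω.1
  have hK : IsCompact (Set.pi univ fun n =>
      ⋃ ω ∈ {ω : List ℕ | ω ∈ T ∧ ω.length = n}, {a | ω ++ [a] ∈ T}) :=
    isCompact_univ_pi fun n => ((hlev n).biUnion fun ω hω => hfin ω hω.1).isCompact
  refine hK.of_isClosed_subset ?_ fun ω hω n _ => ?_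
  · rw [ofPred_forall]
    refine isClosed_iInter fun n => ?_
    rw [← isOpen_compl_iff, isOpen_iff_eventually]
    intro ω hω
    filter_upwards [eventually_initialWord_eq ω n] with ω' h
    rwa [mem_compl_iff, mem_ofPred_eq, h]
  · refine mem_biUnion (x := initialWord ω n) ⟨hω n, length_initialWord ω n⟩ ?_
    rw [mem_ofPred_eq, ← initialWord_succ]
    exact hω (n + 1)

/-- The limit set is the continuous image of the compact space of branches. Since `Z` need not be
complete, nonempty intersections along branches are assumed. -/
theorem IsPartitionStructure.isCompact_limitSet (hP : IsPartitionStructure T P)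
    (hfin : ∀ ω ∈ T, {a | ω ++ [a] ∈ T}.Finite)
    (hne : ∀ ω : ℕ → ℕ, (∀ n, initialWord ω n ∈ T) → ∃ z, ∀ n, z ∈ P (initialWord ω n)) :
    IsCompact (partitionLimitSet T P) := by
  have hK := isCompact_branches hP.tree hfin
  rw [isCompact_iff_compactSpace] at hK
  choose f hf using fun ω : {ω : ℕ → ℕ | ∀ n, initialWord ω n ∈ T} => hne ω ω.2
  have hc : Continuous f := hP.continuous_of_branch continuous_subtype_val
    (fun ω n => ω.2 n) hf
  convert isCompact_range hc
  ext z
  constructor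
  · rintro ⟨ω, h1, h2⟩
    exact ⟨⟨ω, h1⟩, hP.eq_of_mem_branch h1 (hf ⟨ω, h1⟩) h2⟩
  · rintro ⟨ω, rfl⟩
    exact ⟨ω, ω.2, hf ω⟩

end Branches

/-! ### Shadows -/

section Shadows

theorem dist_inv_apply {X : Type*} [MetricSpace X] (o : X) (g : X ≃ᵢ X) : dist o (g⁻¹ o) = dist o (g o) := by
  have h : g (g⁻¹ o) = o := g.apply_symm_apply o
  rw [← g.dist_eq, h, dist_comm]

theorem IsStronglyDiscrete.finite_orbit {X : Type*} [MetricSpace X] {o : X}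
    {G : Subgroup (X ≃ᵢ X)} (hG : IsStronglyDiscrete o G)
    (R : ℝ) : {g : X ≃ᵢ X | g ∈ G ∧ dist o (g o) ≤ R}.Finite := by
  refine (hG (max R 1) (lt_max_of_lt_right one_pos)).subset fun g hg => ⟨hg.1, ?_⟩
  rw [Metric.mem_closedBall, dist_comm]
  exact hg.2.trans (le_max_left _ _)

variable {X : Type*} [MetricSpace X] [IsGromovHyperbolic X]

theorem bdryProd_inv (o : X) (g : X ≃ᵢ X) (y : X) (ξ : GromovBoundary X) :
    bdryProd (g⁻¹ y) (boundaryMap g⁻¹ ξ) o = bdryProd y ξ (g o) := by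
  have h := bdryProd_map g⁻¹ y (g o) ξ
  rwa [show g⁻¹ (g o) = o from g.symm_apply_apply o] at h

theorem mem_shadow_iff {z x : X} {σ : ℝ} {η : GromovBoundary X} :
    η ∈ shadow z x σ ↔ bdryProd z η x ≤ σ := by
  rw [shadow, mem_ofPred_eq, ← coe_bdryProd, EReal.coe_le_coe_iff]

theorem le_bdryProd_of_mem_shadow {z x : X} {σ : ℝ} {η : GromovBoundary X}
    (h : η ∈ shadow z x σ) : dist z x - σ - 2 * hypConst X ≤ bdryProd x η z := by
  rw [mem_shadow_iff] at h
  have := le_bdryProd_add z x η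
  linarith

theorem exists_frequently_lt_of_bdryProd_lt {y z : X} {ξ : GromovBoundary X} {t : ℝ}
    (h : bdryProd y ξ z < t) : ∃ u : GromovSeq X, u.toBoundary = ξ ∧
      ∃ᶠ n in atTop, gromovProduct (u.1 n) y z < t := by
  have h' : mixedProduct y ξ z < (t : EReal) := by
    rw [← coe_bdryProd]
    exact_mod_cast h
  rw [mixedProduct, iInf_lt_iff] at h'
  obtain ⟨u, h'⟩ := h'
  rw [iInf_lt_iff] at h'
  obtain ⟨hu, h'⟩ := h'
  refine ⟨u, hu, (frequently_lt_of_liminf_lt (by isBoundedDefault) h').mono fun n hn => ?_⟩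
  exact_mod_cast hn

variable [MetricSpace (GromovBoundary X)] {o : X} {b V : ℝ}

theorem IsVisualConst.dist_le_of_mem_shadow (hV : IsVisualConst o b V) {x : X} {σ : ℝ}
    {ξ η : GromovBoundary X} (hξ : ξ ∈ shadow o x σ) (hη : η ∈ shadow o x σ) :
    dist ξ η ≤ b ^ (V + σ + 2 * hypConst X - dist o x) := by
  refine (hV.dist_le x ξ η _ (le_bdryProd_of_mem_shadow hξ)
    (le_bdryProd_of_mem_shadow hη)).trans (le_of_eq ?_)
  ring_nf

theorem IsVisualConst.isBounded (hV : IsVisualConst o b V) (s : Set (GromovBoundary X)) :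
    Bornology.IsBounded s :=
  Metric.isBounded_iff.2 ⟨b ^ (V - 0), fun ξ _ η _ =>
    hV.dist_le o ξ η 0 (bdryProd_nonneg _ _ _) (bdryProd_nonneg _ _ _)⟩

theorem IsVisualConst.diam_shadow_le (hb : 1 < b) (hV : IsVisualConst o b V) (x : X) (σ : ℝ) :
    Metric.diam (shadow o x σ) ≤ b ^ (V + σ + 2 * hypConst X - dist o x) :=
  Metric.diam_le_of_forall_dist_le (by positivity) fun _ hξ _ hη => hV.dist_le_of_mem_shadow hξ hη

/-- Closedness is exact, without loss of constants, by a diagonal argument: points of `X` chosen far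
along representatives of nearby shadow points represent the limit point, and their Gromov products
bound its product from above. -/
theorem IsVisualConst.isClosed_shadow (hb : 1 < b) (hV : IsVisualConst o b V) (x : X) (σ : ℝ) :
    IsClosed (shadow o x σ) := by
  refine isClosed_of_closure_subset fun η hη => mem_shadow_iff.2 ?_
  refine le_of_forall_pos_le_add fun ε hε => ?_
  have hy : ∀ k : ℕ, ∃ y : X, (k : ℝ) - V ≤ bdryProd y η o ∧ gromovProduct y o x < σ + ε := by
    intro k
    obtain ⟨ξ, hξ, hd⟩ := Metric.mem_closure_iff.1 hη (b ^ (-(k : ℝ))) (by positivity)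
    rw [mem_shadow_iff] at hξ
    obtain ⟨u, hu, hf⟩ := exists_frequently_lt_of_bdryProd_lt
      (show bdryProd o ξ x < σ + ε by linarith)
    obtain ⟨n, h1, h2⟩ := (hf.and_eventually
      ((tendsto_atTop.1 (tendsto_bdryProd_rep hu o)) (k : ℝ))).exists
    rw [dist_comm] at hd
    exact ⟨u.1 n, hV.le_bdryProd _ ξ η _ hd.le h2, h1⟩
  choose y hy1 hy2 using hy
  have ht : Tendsto (fun k => bdryProd (y k) η o) atTop atTop :=
    tendsto_atTop_mono hy1 (tendsto_atTop_add_const_right _ _ tendsto_natCast_atTop_atTop)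
  obtain ⟨u, hu, hu'⟩ := exists_rep_of_tendsto_bdryProd ht
  by_contra! hlt
  obtain ⟨n, hn⟩ := (eventually_lt_of_lt_bdryProd hu' hlt).exists
  rw [hu] at hn
  exact absurd (hy2 n) (not_lt.2 hn.le)

theorem IsVisualConst.le_dist_map (hb : 1 < b) (hV : IsVisualConst o b V) (g : X ≃ᵢ X)
    (ξ η : GromovBoundary X) :
    b ^ (-(V + dist o (g o))) * dist ξ η ≤ dist (boundaryMap g ξ) (boundaryMap g η) := by
  have h := hV.dist_map_le g⁻¹ (boundaryMap g ξ) (boundaryMap g η)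
  rw [boundaryMap_inv_apply, boundaryMap_inv_apply, dist_inv_apply] at h
  rw [Real.rpow_neg (by linarith), inv_mul_le_iff₀ (by positivity)]
  exact h

/-- At most one of three distinct boundary points can lie far in the direction of `g⁻¹ o`. The other
two are mapped by `g` into the shadow of `g o`, and `g` contracts their distance by at most a
constant times `b ^ (-d(o, g o))`. -/
theorem IsVisualConst.exists_le_diam_shadow (hb : 1 < b) (hV : IsVisualConst o b V)
    {p q r : GromovBoundary X} (hpq : p ≠ q) (hpr : p ≠ r) (hqr : q ≠ r) :
    ∃ σ₁ c : ℝ, ∀ σ, σ₁ ≤ σ → ∀ g : X ≃ᵢ X,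
      b ^ (-(c + dist o (g o))) ≤ Metric.diam (shadow o (g o) σ) := by
  have hb0 : 0 < b := by linarith
  obtain ⟨m, hm, h1, h2, h3⟩ : ∃ m : ℝ, 0 < m ∧ m ≤ dist p q ∧ m ≤ dist p r ∧ m ≤ dist q r :=
    ⟨min (dist p q) (min (dist p r) (dist q r)),
      lt_min (dist_pos.2 hpq) (lt_min (dist_pos.2 hpr) (dist_pos.2 hqr)), min_le_left _ _,
      (min_le_right _ _).trans (min_le_left _ _), (min_le_right _ _).trans (min_le_right _ _)⟩
  have hm' : b ^ Real.logb b m = m := Real.rpow_logb hb0 hb.ne' hm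
  refine ⟨V + 1 - Real.logb b m, V - Real.logb b m, fun σ hσ g => ?_⟩
  have key : ∀ ξ η : GromovBoundary X, m ≤ dist ξ η → σ < bdryProd (g⁻¹ o) ξ o →
      ¬ σ < bdryProd (g⁻¹ o) η o := fun ξ η h hξ hη => by
    have := (h.trans (hV.dist_le _ ξ η _ hξ.le hη.le)).trans
      (Real.rpow_le_rpow_of_exponent_le hb.le (show V - σ ≤ Real.logb b m - 1 by linarith))
    rw [← hm', Real.rpow_le_rpow_left_iff hb, Real.logb_rpow hb0 hb.ne'] at this
    linarith
  have hsh : ∀ ξ : GromovBoundary X, ¬ σ < bdryProd (g⁻¹ o) ξ o →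
      boundaryMap g ξ ∈ shadow o (g o) σ := fun ξ h => by
    rw [mem_shadow_iff, ← bdryProd_inv, boundaryMap_inv_apply]
    exact not_lt.1 h
  have main : ∀ ξ η : GromovBoundary X, m ≤ dist ξ η → ¬ σ < bdryProd (g⁻¹ o) ξ o →
      ¬ σ < bdryProd (g⁻¹ o) η o →
      b ^ (-(V - Real.logb b m + dist o (g o))) ≤ Metric.diam (shadow o (g o) σ) := by
    intro ξ η h hξ hη
    refine le_trans ?_ (Metric.dist_le_diam_of_mem (hV.isBounded _) (hsh ξ hξ) (hsh η hη))
    refine le_trans ?_ (hV.le_dist_map hb g ξ η)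
    calc b ^ (-(V - Real.logb b m + dist o (g o)))
        = b ^ (-(V + dist o (g o))) * m := by
          rw [show -(V - Real.logb b m + dist o (g o)) =
            -(V + dist o (g o)) + Real.logb b m by ring, Real.rpow_add hb0, hm']
      _ ≤ _ := by gcongr
  by_cases hp : σ < bdryProd (g⁻¹ o) p o
  · exact main q r h3 (key p q h1 hp) (key p r h2 hp)
  · by_cases hq : σ < bdryProd (g⁻¹ o) q o
    · exact main p r h2 hp (key q r h3 hq)
    · exact main p q h1 hp hq

/-! ### Partition structures of shadows -/

variable {T : Set (List ℕ)} {x : List ℕ → X} {σ c : ℝ}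

theorem tendsto_dist_branch (hb : 1 < b)
    (hP : IsPartitionStructure T fun ω => shadow o (x ω) σ)
    (hx : ∀ ω ∈ T, b ^ (-(c + dist o (x ω))) ≤ Metric.diam (shadow o (x ω) σ))
    {ω : ℕ → ℕ} (hω : ∀ n, initialWord ω n ∈ T) :
    Tendsto (fun n => dist o (x (initialWord ω n))) atTop atTop := by
  obtain ⟨u, hu, hu'⟩ := hP.tendsto_diam
  refine tendsto_atTop.2 fun M => ?_
  filter_upwards [hu.eventually (gt_mem_nhds (show 0 < b ^ (-(c + M)) by positivity))] with n hn
  have h := ((hx _ (hω n)).trans (hu' ω hω n)).trans_lt hn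
  rw [Real.rpow_lt_rpow_left_iff hb] at h
  linarith

/-- The vertices along a branch form a Gromov sequence themselves, because any two of them cast
shadows on a common point. Its class is a limit of points of the shadows, which are closed. -/
theorem IsVisualConst.exists_mem_branch (hb : 1 < b) (hV : IsVisualConst o b V)
    (hP : IsPartitionStructure T fun ω => shadow o (x ω) σ)
    (hx : ∀ ω ∈ T, b ^ (-(c + dist o (x ω))) ≤ Metric.diam (shadow o (x ω) σ))
    {ω : ℕ → ℕ} (hω : ∀ n, initialWord ω n ∈ T) :
    ∃ η, ∀ n, η ∈ shadow o (x (initialWord ω n)) σ := by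
  have ht := tendsto_dist_branch hb hP hx hω
  set y : ℕ → X := fun n => x (initialWord ω n) with hy
  choose z hz using fun n => nonempty_of_diam_pos (hP.diam_pos _ (hω n))
  have hz' : ∀ n m, n ≤ m → z m ∈ shadow o (y n) σ := fun n m h =>
    hP.nested _ (hω n) _ (hω m) (initialWord_prefix ω h) (hz m)
  have hyz : ∀ n m, n ≤ m → dist o (y n) - σ - 2 * hypConst X ≤ bdryProd (y n) (z m) o :=
    fun n m h => le_bdryProd_of_mem_shadow (hz' n m h)
  have hG : IsGromovSeq y := fun o' => by
    refine tendsto_atTop.2 fun M => ?_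
    obtain ⟨N, hN⟩ := eventually_atTop.1
      ((tendsto_atTop.1 ht) (M + σ + 3 * hypConst X + dist o o'))
    rw [← prod_atTop_atTop_eq]
    filter_upwards [prod_mem_prod (Ici_mem_atTop N) (Ici_mem_atTop N)] with p hp
    have h1 := hyz p.1 (max p.1 p.2) (le_max_left _ _)
    have h2 := hyz p.2 (max p.1 p.2) (le_max_right _ _)
    have h3 := hN p.1 hp.1
    have h4 := hN p.2 hp.2
    have h5 := sub_le_gromovProduct_of_le_bdryProd (t := M + hypConst X + dist o o')
      (show _ ≤ bdryProd (y p.1) (z (max p.1 p.2)) o by linarith)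
      (show _ ≤ bdryProd (y p.2) (z (max p.1 p.2)) o by linarith)
    have h6 := gromovProduct_sub_dist_le (y p.1) (y p.2) o o'
    linarith
  set u : GromovSeq X := ⟨y, hG⟩
  have hR := tendsto_bdryProd_rep (rfl : u.toBoundary = _) o
  set η := u.toBoundary
  have hlim : Tendsto z atTop (𝓝 η) := by
    refine Metric.tendsto_nhds.2 fun ε hε => ?_
    have hb0 : 0 < b := by linarith
    set t := V + 1 - Real.logb b ε
    filter_upwards [(tendsto_atTop.1 ht) (t + σ + 2 * hypConst X), (tendsto_atTop.1 hR) t]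
      with n h1 h2
    have h1' : t + σ + 2 * hypConst X ≤ dist o (y n) := h1
    have h3 := hyz n n le_rfl
    refine (hV.dist_le (y n) _ _ t (by linarith) h2).trans_lt ?_
    calc b ^ (V - t) < b ^ (Real.logb b ε) :=
          (Real.rpow_lt_rpow_left_iff hb).2 (by simp only [t]; linarith)
      _ = ε := Real.rpow_logb hb0 hb.ne' hε
  refine ⟨η, fun n => (hP.closed _ (hω n)).mem_of_tendsto hlim ?_⟩
  filter_upwards [eventually_ge_atTop n] with m hm
  exact hz' n m hm

/-- The shadow of a child is not much smaller than that of its parent, so the child's orbit point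
lies in a fixed ball, and strong discreteness applies. -/
theorem IsVisualConst.finite_children (hb : 1 < b) (hV : IsVisualConst o b V)
    {G : Subgroup (X ≃ᵢ X)} (hG : IsStronglyDiscrete o G)
    (hP : IsPartitionStructure T fun ω => shadow o (x ω) σ)
    (horb : ∀ ω ∈ T, ∃ g ∈ G, x ω = g o) (hinj : Set.InjOn x T) :
    ∀ ω ∈ T, {a | ω ++ [a] ∈ T}.Finite := by
  intro ω hω
  have hb0 : 0 < b := by linarith
  obtain ⟨κ, hκ, _, _, _, h⟩ := hP.separation
  have hpos : 0 < κ * Metric.diam (shadow o (x ω) σ) := mul_pos hκ (hP.diam_pos ω hω)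
  set R := V + σ + 2 * hypConst X - Real.logb b (κ * Metric.diam (shadow o (x ω) σ)) with hR
  refine Set.Finite.of_finite_image (f := fun a => x (ω ++ [a])) ?_ ?_
  · refine ((hG.finite_orbit R).image fun g => g o).subset ?_
    rintro _ ⟨a, ha, rfl⟩
    obtain ⟨g, hg, hgx⟩ := horb _ ha
    refine ⟨g, ⟨hg, ?_⟩, hgx.symm⟩
    have h1 := (h ω hω a ha).2.1.trans (hV.diam_shadow_le hb (x (ω ++ [a])) σ)
    rw [← Real.logb_le_iff_le_rpow hb hpos] at h1
    rw [← hgx]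
    linarith
  · intro a ha a' ha' hEq
    simpa using hinj ha ha' hEq

end Shadows

/-! ### A criterion for absolute winning sets -/

section Potential

variable {Z ι : Type*}

/-- The total weight of the sets `K i` that meet `S` and have scale at least `r`. -/
noncomputable def potential (v q : ι → ℝ) (K : ι → Set Z) (c r : ℝ) (S : Set Z) : ℝ≥0∞ :=
  ∑' i, {i | r ≤ q i ∧ (K i ∩ S).Nonempty}.indicator (fun i => ENNReal.ofReal (v i ^ c)) i

variable {v q : ι → ℝ} {K : ι → Set Z} {c r : ℝ}

theorem potential_mono {S S' : Set Z} (h : S ⊆ S') :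
    potential v q K c r S ≤ potential v q K c r S' :=
  ENNReal.tsum_le_tsum fun i => by
    refine indicator_le_indicator_of_subset (fun i hi => ?_) (fun _ => zero_le) i
    exact ⟨hi.1, hi.2.mono (inter_subset_inter_right _ h)⟩

theorem ofReal_le_potential {S : Set Z} {i : ι} (hi : r ≤ q i) (hi' : (K i ∩ S).Nonempty) :
    ENNReal.ofReal (v i ^ c) ≤ potential v q K c r S := by
  refine le_trans (le_of_eq ?_) (ENNReal.le_tsum i)
  rw [indicator_of_mem]
  exact ⟨hi, hi'⟩

theorem le_of_potential_le {S : Set Z} {i : ι} {A : ℝ} (hc : 0 < c) (hA : 0 ≤ A) (hv : 0 ≤ v i)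
    (hi : r ≤ q i) (hi' : (K i ∩ S).Nonempty)
    (h : potential v q K c r S ≤ ENNReal.ofReal (A ^ c)) : v i ≤ A := by
  have := (ofReal_le_potential hi hi').trans h
  rwa [ENNReal.ofReal_le_ofReal_iff (by positivity), Real.rpow_le_rpow_iff hv hA hc] at this

theorem potential_add_le {S S₁ S₂ : Set Z} (h₁ : S₁ ⊆ S) (h₂ : S₂ ⊆ S)
    (h : ∀ i, r ≤ q i → (K i ∩ S₁).Nonempty → ¬ (K i ∩ S₂).Nonempty) :
    potential v q K c r S₁ + potential v q K c r S₂ ≤ potential v q K c r S := by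
  unfold potential
  rw [← ENNReal.tsum_add]
  refine ENNReal.tsum_le_tsum fun i => ?_
  by_cases hr : r ≤ q i
  · by_cases hi : (K i ∩ S₁).Nonempty
    · have hS : (K i ∩ S).Nonempty := hi.mono (inter_subset_inter_right _ h₁)
      simp [indicator, hr, hi, hS, h i hr hi]
    · by_cases hi2 : (K i ∩ S₂).Nonempty
      · have hS : (K i ∩ S).Nonempty := hi2.mono (inter_subset_inter_right _ h₂)
        simp [indicator, hr, hi, hS, hi2]
      · simp [indicator, hi, hi2]
  · simp [indicator, hr]

theorem two_mul_potential_le {S S₁ S₂ : Set Z} (h₁ : S₁ ⊆ S) (h₂ : S₂ ⊆ S)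
    (h : ∀ i, r ≤ q i → (K i ∩ S₁).Nonempty → ¬ (K i ∩ S₂).Nonempty)
    (hfin : potential v q K c r S ≠ ∞)
    (hS : potential v q K c r S < 2 * potential v q K c r S₂) :
    2 * potential v q K c r S₁ ≤ potential v q K c r S := by
  have h3 := potential_add_le (c := c) (v := v) h₁ h₂ h
  have f1 := ne_top_of_le_ne_top hfin (potential_mono (v := v) (q := q) (K := K) (c := c)
    (r := r) h₁)
  have f2 := ne_top_of_le_ne_top hfin (potential_mono (v := v) (q := q) (K := K) (c := c)
    (r := r) h₂)
  lift potential v q K c r S to ℝ≥0 using hfin with A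
  lift potential v q K c r S₁ to ℝ≥0 using f1 with A₁
  lift potential v q K c r S₂ to ℝ≥0 using f2 with A₂
  norm_cast at *
  rw [← NNReal.coe_le_coe] at h3 ⊢
  rw [← NNReal.coe_lt_coe] at hS
  push_cast at *
  linarith

variable {w : ι → ℝ}

theorem potential_smul (hw : ∀ i, 0 < w i) {ε : ℝ} (hε : 0 ≤ ε) (S : Set Z) :
    potential (fun i => ε * w i) q K c r S =
      ENNReal.ofReal (ε ^ c) * potential w q K c r S := by
  unfold potential
  rw [← ENNReal.tsum_mul_left]
  congr 1
  ext i
  by_cases hi : i ∈ {i | r ≤ q i ∧ (K i ∩ S).Nonempty}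
  · rw [indicator_of_mem hi, indicator_of_mem hi, Real.mul_rpow hε (hw i).le,
      ENNReal.ofReal_mul (by positivity)]
  · rw [indicator_of_notMem hi, indicator_of_notMem hi, mul_zero]

end Potential

/-! ### Alice's strategy by means of a potential -/

section Game

variable {Z : Type*} [MetricSpace Z]

/-- Forces Bob's radii to tend to zero: the centres of Alice's balls are separated in terms of these
radii, and a compact space has no infinite uniformly separated sequence. -/
theorem eventually_lt_of_separated [CompactSpace Z] {x : ℕ → Z} {r : ℕ → ℝ} {β : ℝ} (hβ : 0 < β)
    (h : ∀ j k, j < k → β * r j < dist (x k) (x j)) {ρ : ℝ} (hρ : 0 < ρ) :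
    ∀ᶠ k in atTop, r k < ρ := by
  by_contra hcon
  have hf : ∃ᶠ k in atTop, ρ ≤ r k := by
    rw [Filter.not_eventually] at hcon
    exact hcon.mono fun k hk => not_lt.1 hk
  obtain ⟨φ, hφ, hφ'⟩ := extraction_of_frequently_atTop hf
  obtain ⟨a, -, ψ, hψ, hlim⟩ := isCompact_univ.tendsto_subseq (x := x ∘ φ) fun _ => mem_univ _
  obtain ⟨N, hN⟩ := Metric.cauchySeq_iff.1 hlim.cauchySeq (β * ρ) (by positivity)
  have h1 := hN (N + 1) (Nat.le_succ N) N le_rfl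
  have h2 := h _ _ (hφ (hψ (Nat.lt_succ_self N)))
  have h3 : β * ρ ≤ β * r (φ (ψ N)) := by
    gcongr
    exact hφ' _
  exact absurd (h3.trans_lt h2) (not_lt.2 h1.le)

/-- The weights and scales of a family of sets that Alice can avoid one after the other. -/
structure IsSparseFamily {ι : Type*} (w q : ι → ℝ) (K : ℝ → ι → Set Z) : Prop where
  weight_pos : ∀ i, 0 < w i
  scale_pos : ∀ i, 0 < q i
  scale_lt : ∃ R, ∀ i, q i < R
  dist_le : ∀ ε i, ∀ z ∈ K ε i, ∀ z' ∈ K ε i, dist z z' ≤ 2 * (ε * w i)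
  mono : ∀ ε ≤ 1, ∀ i, K ε i ⊆ K 1 i
  sum_le : ∀ c : ℝ, 0 < c → ∀ θ : ℝ, 0 < θ → ∃ M : ℝ, 0 ≤ M ∧ ∀ r > 0, ∀ z : Z,
    ∑' i, {i | θ * r ≤ q i ∧ q i < r ∧ (K 1 i ∩ Metric.closedBall z r).Nonempty}.indicator
      (fun i => ENNReal.ofReal (w i ^ c)) i ≤ ENNReal.ofReal (M * r ^ c)

variable {ι : Type*} {w q : ι → ℝ} {K : ℝ → ι → Set Z}

theorem exists_rpow_mul_le {c A B : ℝ} (hc : 0 < c) (hA : 0 ≤ A) (hB : 0 < B) :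
    ∃ ε₀ > 0, ∀ ε, 0 ≤ ε → ε ≤ ε₀ → ε ^ c * A ≤ B := by
  refine ⟨(B / (A + 1)) ^ (1 / c), by positivity, fun ε h0 hε => ?_⟩
  have h1 : ε ^ c ≤ B / (A + 1) := by
    calc ε ^ c ≤ ((B / (A + 1)) ^ (1 / c)) ^ c := Real.rpow_le_rpow h0 hε hc.le
      _ = B / (A + 1) := by
        rw [← Real.rpow_mul (by positivity), one_div_mul_cancel hc.ne', Real.rpow_one]
  calc ε ^ c * A ≤ B / (A + 1) * A := by gcongr
    _ ≤ B := by
      rw [div_mul_eq_mul_div, div_le_iff₀ (by positivity)]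
      nlinarith

theorem IsSparseFamily.exists_potential_le [CompactSpace Z] (h : IsSparseFamily w q K) {c r B : ℝ}
    (hc : 0 < c) (hr : 0 < r) (hB : 0 < B) : ∃ ε₀ > 0, ∀ ε, 0 < ε → ε ≤ ε₀ → ε ≤ 1 → ∀ S : Set Z,
      potential (fun i => ε * w i) q (K ε) c r S ≤ ENNReal.ofReal B := by
  rcases isEmpty_or_nonempty Z with hZ | ⟨⟨z⟩⟩
  · refine ⟨1, one_pos, fun ε _ _ _ S => ?_⟩
    have hi : ∀ i, ¬ (K ε i ∩ S).Nonempty := fun i hi => hZ.false hi.some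
    simp [potential, hi]
  obtain ⟨R, hR⟩ := h.scale_lt
  -- With a radius exceeding all scales and the diameter of `Z`, the bound `sum_le` at a single
  -- point covers the whole family of scale at least `r`.
  set R' := max R 0 + Metric.diam (univ : Set Z) + 1 with hR'
  have hd : 0 ≤ Metric.diam (univ : Set Z) := Metric.diam_nonneg
  have hm : 0 ≤ max R 0 := le_max_right _ _
  have hm' : R ≤ max R 0 := le_max_left _ _
  have hR0 : 0 < R' := by linarith
  obtain ⟨M, hM0, hM⟩ := h.sum_le c hc (r / R') (by positivity)
  obtain ⟨ε₀, hε₀, hε⟩ := exists_rpow_mul_le hc (show 0 ≤ M * R' ^ c by positivity) hB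
  refine ⟨ε₀, hε₀, fun ε h0 h1 h2 S => ?_⟩
  rw [potential_smul h.weight_pos h0.le]
  calc ENNReal.ofReal (ε ^ c) * potential w q (K ε) c r S
      ≤ ENNReal.ofReal (ε ^ c) * ENNReal.ofReal (M * R' ^ c) := by
        gcongr
        refine le_trans (ENNReal.tsum_le_tsum fun i => ?_) (hM R' hR0 z)
        refine indicator_le_indicator_of_subset (fun i hi => ?_) (fun _ => zero_le) i
        refine ⟨?_, ?_, ?_⟩
        · rw [div_mul_cancel₀ _ hR0.ne']
          exact hi.1
        · linarith [hR i]
        · obtain ⟨y, hy, -⟩ := hi.2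
          refine ⟨y, h.mono ε h2 i hy, ?_⟩
          have := Metric.dist_le_diam_of_mem isCompact_univ.isBounded (mem_univ y) (mem_univ z)
          rw [Metric.mem_closedBall]
          linarith
    _ = ENNReal.ofReal (ε ^ c * (M * R' ^ c)) := (ENNReal.ofReal_mul (by positivity)).symm
    _ ≤ ENNReal.ofReal B := ENNReal.ofReal_le_ofReal (hε ε h0.le h1)

/-- The centre of Alice's next ball: a point around which more than half of the potential is
concentrated, and a dummy point if there is none. -/
theorem exists_heavy_point (B : FormalBall Z) (φ : Set Z → ℝ≥0∞) (a : ℝ) :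
    ∃ x ∈ B.toSet, ∀ y ∈ B.toSet,
      φ B.toSet < 2 * φ (B.toSet ∩ Metric.closedBall y a) →
      φ B.toSet < 2 * φ (B.toSet ∩ Metric.closedBall x a) := by
  by_cases h : ∃ x ∈ B.toSet, φ B.toSet < 2 * φ (B.toSet ∩ Metric.closedBall x a)
  · obtain ⟨x, hx, hx'⟩ := h
    exact ⟨x, hx, fun _ _ _ => hx'⟩
  · exact ⟨B.center, Metric.mem_closedBall_self B.radius_pos.le, fun y hy hy' =>
      (h ⟨y, hy, hy'⟩).elim⟩

/-- One round of the game in which the potential drops relative to the radius. -/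
theorem IsSparseFamily.potential_le_of_halved (h : IsSparseFamily w q K) {c θ γ M ε r r' : ℝ}
    (hc : 0 < c) (hr : 0 < r) (hθ : 0 < θ) (hγ : 0 < γ) (hθc : θ ^ c = 3 / 4)
    (hM0 : 0 ≤ M) (hM : ∀ r > 0, ∀ z : Z,
      ∑' i, {i | θ * r ≤ q i ∧ q i < r ∧ (K 1 i ∩ Metric.closedBall z r).Nonempty}.indicator
        (fun i => ENNReal.ofReal (w i ^ c)) i ≤ ENNReal.ofReal (M * r ^ c))
    (hε0 : 0 < ε) (hε1 : ε ≤ 1) (hε : ε ^ c * M ≤ γ ^ c / 4) (hr' : θ * r ≤ r')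
    {S S' : Set Z} {z : Z} (hS' : S' ⊆ Metric.closedBall z r)
    (hinv : potential (fun i => ε * w i) q (K ε) c r S ≤ ENNReal.ofReal ((γ * r) ^ c))
    (hhalf : 2 * potential (fun i => ε * w i) q (K ε) c r S' ≤
      potential (fun i => ε * w i) q (K ε) c r S) :
    potential (fun i => ε * w i) q (K ε) c r' S' ≤ ENNReal.ofReal ((γ * r') ^ c) := by
  have h1 : potential (fun i => ε * w i) q (K ε) c r S' ≤ ENNReal.ofReal ((γ * r) ^ c / 2) := by
    have := hhalf.trans hinv
    rw [show (γ * r) ^ c = 2 * ((γ * r) ^ c / 2) by ring,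
      ENNReal.ofReal_mul (by norm_num)] at this
    rw [show ENNReal.ofReal 2 = 2 by simp] at this
    exact (ENNReal.mul_le_mul_iff_right (by norm_num) (by norm_num)).1 this
  -- Lowering the threshold from `r` to `r'` only adds members of scale between `θ * r` and `r`.
  have h2 : potential (fun i => ε * w i) q (K ε) c r' S' ≤
      potential (fun i => ε * w i) q (K ε) c r S' + ENNReal.ofReal (ε ^ c) *
      ∑' i, {i | θ * r ≤ q i ∧ q i < r ∧ (K 1 i ∩ Metric.closedBall z r).Nonempty}.indicator
        (fun i => ENNReal.ofReal (w i ^ c)) i := by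
    unfold potential
    rw [← ENNReal.tsum_mul_left, ← ENNReal.tsum_add]
    refine ENNReal.tsum_le_tsum fun i => ?_
    by_cases hi : i ∈ {i | r' ≤ q i ∧ (K ε i ∩ S').Nonempty}
    · rw [indicator_of_mem hi]
      by_cases hq : r ≤ q i
      · refine le_trans (le_of_eq ?_) le_self_add
        rw [indicator_of_mem]
        exact ⟨hq, hi.2⟩
      · refine le_trans (le_of_eq ?_) le_add_self
        rw [indicator_of_mem, ← ENNReal.ofReal_mul (by positivity),
          Real.mul_rpow hε0.le (h.weight_pos i).le]
        obtain ⟨y, hy, hy'⟩ := hi.2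
        exact ⟨hr'.trans hi.1, not_le.1 hq, y, h.mono ε hε1 i hy, hS' hy'⟩
    · rw [indicator_of_notMem hi]
      exact zero_le
  refine h2.trans ((add_le_add h1 (mul_le_mul_right (hM r hr z) _)).trans ?_)
  rw [← ENNReal.ofReal_mul (by positivity), ← ENNReal.ofReal_add (by positivity) (by positivity)]
  refine ENNReal.ofReal_le_ofReal ?_
  -- One half survives and one quarter is new, in units of `(γ * r) ^ c`; the sum is `3 / 4 = θ ^
  -- c`, exactly what the decrease of the radius allows.
  have h3 : (γ * (θ * r)) ^ c ≤ (γ * r') ^ c := by gcongr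
  refine le_trans ?_ h3
  rw [show γ * (θ * r) = θ * (γ * r) by ring, Real.mul_rpow hθ.le (by positivity), hθc,
    Real.mul_rpow hγ.le hr.le]
  have h4 : ε ^ c * (M * r ^ c) ≤ γ ^ c / 4 * r ^ c := by
    rw [← mul_assoc]
    gcongr
  linarith

/-- The invariant is that the potential of `B k` at scale `r k` is at most `(γ * r k) ^ c`, for
infinitely many `k`. A point of `K ε i` in all of Bob's balls would give `ε * w i ≤ γ * r k` for
arbitrarily small radii. -/
theorem IsSparseFamily.isBetaAbsoluteWinning [CompactSpace Z] (h : IsSparseFamily w q K) {β : ℝ}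
    (hβ : 0 < β) (hβ1 : β < 1) :
    IsBetaAbsoluteWinning β {η : Z | ∃ ε : ℝ, 0 < ε ∧ ∀ i, η ∉ K ε i} := by
  -- The largest loss of radius between two good times: a factor `β / 2` while waiting, and `β ^ 2`
  -- for one round, as Bob's radius is at least `β` times Alice's, which is `β` times his previous
  -- one.
  set θ := β ^ 2 * (β / 2) with hθdef
  have hθ : 0 < θ := by positivity
  have hθ2 : θ ≤ β ^ 2 := by
    have : β ^ 2 * (β / 2) ≤ β ^ 2 * 1 := by gcongr; linarith
    linarith
  have hθ1 : θ < 1 := by nlinarith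
  set c := Real.logb θ (3 / 4) with hcdef
  have hc : 0 < c := Real.logb_pos_of_base_lt_one hθ hθ1 (by norm_num) (by norm_num)
  have hθc : θ ^ c = 3 / 4 := Real.rpow_logb hθ hθ1.ne (by norm_num)
  -- Under the invariant a set of the family has diameter at most `2 * γ * r = β / 2 * r`.
  set γ := β / 4 with hγdef
  have hγ : 0 < γ := by positivity
  obtain ⟨M, hM0, hM⟩ := h.sum_le c hc θ hθ
  obtain ⟨ε₁, hε₁, hε₁'⟩ := exists_rpow_mul_le hc hM0 (show 0 < γ ^ c / 4 by positivity)
  have hE : ∀ B : FormalBall Z, ∃ ε : ℝ, 0 < ε ∧ ε ≤ 1 ∧ ε ^ c * M ≤ γ ^ c / 4 ∧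
      potential (fun i => ε * w i) q (K ε) c B.radius B.toSet ≤
        ENNReal.ofReal ((γ * B.radius) ^ c) := fun B => by
    have hB := B.radius_pos
    obtain ⟨ε₂, hε₂, hε₂'⟩ := h.exists_potential_le hc hB
      (show 0 < (γ * B.radius) ^ c by positivity)
    refine ⟨min 1 (min ε₁ ε₂), by positivity, min_le_left _ _, hε₁' _ (by positivity) ?_,
      hε₂' _ (by positivity) ?_ (min_le_left _ _) _⟩
    · exact (min_le_right _ _).trans (min_le_left _ _)
    · exact (min_le_right _ _).trans (min_le_right _ _)
  choose E hE0 hE1 hEM hE using hE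
  choose x hx hx' using fun (ε : ℝ) (B : FormalBall Z) => exists_heavy_point B
    (potential (fun i => ε * w i) q (K ε) c B.radius) (β / 2 * B.radius)
  -- The parameter `ε` is read off from Bob's first ball and stays fixed, so this is a strategy.
  refine ⟨fun n B => ⟨x (E (B 0)) (B (Fin.last n)), β * (B (Fin.last n)).radius,
    mul_pos hβ (B (Fin.last n)).radius_pos⟩, fun n B => le_rfl, fun B hB => ?_⟩
  set ε := E (B 0) with hε
  have hB1 : ∀ n, (B (n + 1)).toSet ⊆ (B n).toSet := fun n => (hB n).1.trans sdiff_subset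
  have hB2 : ∀ n, ∀ z ∈ (B (n + 1)).toSet, β * (B n).radius < dist z (x ε (B n)) := fun n z hz =>
    not_le.1 ((hB n).1 hz).2
  have hB3 : ∀ n, β ^ 2 * (B n).radius ≤ (B (n + 1)).radius := fun n => by
    rw [sq, mul_assoc]
    exact (hB n).2
  have hanti : Antitone fun n => (B n).toSet := antitone_nat_of_succ_le hB1
  have hrpos : ∀ n, 0 < (B n).radius := fun n => (B n).radius_pos
  have hcen : ∀ n, (B n).center ∈ (B n).toSet := fun n =>
    Metric.mem_closedBall_self (hrpos n).le
  have hsmall : ∀ ρ > 0, ∀ᶠ k in atTop, (B k).radius < ρ := fun ρ hρ =>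
    eventually_lt_of_separated (x := fun n => x ε (B n)) hβ
      (fun j k hjk => hB2 j _ (hanti (Nat.succ_le_of_lt hjk) (hx ε (B k)))) hρ
  obtain ⟨η, hη⟩ : (⋂ n, (B n).toSet).Nonempty :=
    IsCompact.nonempty_iInter_of_sequence_nonempty_isCompact_isClosed _ hB1
      (fun n => ⟨_, hcen n⟩) Metric.isClosed_closedBall.isCompact
      (fun n => Metric.isClosed_closedBall)
  have hη' := mem_iInter.1 hη
  refine ⟨η, hη, ε, hE0 _, fun i hi => ?_⟩
  set φ := fun r S => potential (fun i => ε * w i) q (K ε) c r S with hφ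
  have hstep : ∀ k, φ (B k).radius (B k).toSet ≤ ENNReal.ofReal ((γ * (B k).radius) ^ c) →
      ∃ k' > k, φ (B k').radius (B k').toSet ≤ ENNReal.ofReal ((γ * (B k').radius) ^ c) := by
    intro k hk
    suffices hh : ∃ k' > k, θ * (B k).radius ≤ (B k').radius ∧
        2 * φ (B k).radius (B k').toSet ≤ φ (B k).radius (B k).toSet by
      obtain ⟨k', hk', h1, h2⟩ := hh
      exact ⟨k', hk', h.potential_le_of_halved hc (hrpos k) hθ hγ hθc hM0 hM (hE0 _) (hE1 _)
        (hEM _) h1 (hanti hk'.le) hk h2⟩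
    by_cases hheavy : ∃ y ∈ (B k).toSet, φ (B k).radius (B k).toSet <
        2 * φ (B k).radius ((B k).toSet ∩ Metric.closedBall y (β / 2 * (B k).radius))
    · obtain ⟨y, hy, hy'⟩ := hheavy
      refine ⟨k + 1, Nat.lt_succ_self k, le_trans ?_ (hB3 k), ?_⟩
      · have := hrpos k
        gcongr
      · refine two_mul_potential_le (hB1 k) inter_subset_left ?_
          (ne_top_of_le_ne_top ENNReal.ofReal_ne_top hk) (hx' ε (B k) y hy hy')
        -- A set meeting both the next ball and the heavy part would contain points more than `β / 2
        -- * r` apart, which its weight forbids.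
        rintro j hj ⟨z₂, hz₂, hz₂'⟩ ⟨z₁, hz₁, hz₁', hz₁''⟩
        have hj' := le_of_potential_le (v := fun i => ε * w i) (K := K ε) (q := q) (i := j) hc
          (mul_pos hγ (hrpos k)).le (mul_pos (hE0 (B 0)) (h.weight_pos j)).le hj ⟨z₁, hz₁, hz₁'⟩ hk
        have h1 := h.dist_le _ _ _ hz₂ _ hz₁
        have h2 := hB2 k _ hz₂'
        have h3 := dist_triangle z₂ z₁ (x ε (B k))
        rw [Metric.mem_closedBall] at hz₁''
        have h4 : ε * w j ≤ β / 4 * (B k).radius := hj'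
        linarith
    · push Not at hheavy
      have hex : ∃ j, k < j ∧ (B j).radius ≤ β / 2 * (B k).radius := by
        obtain ⟨j, h1, h2⟩ := ((hsmall (β / 2 * (B k).radius)
          (mul_pos (by positivity) (hrpos k))).and (eventually_gt_atTop k)).exists
        exact ⟨j, h2, h1.le⟩
      classical
      obtain ⟨hk1, hk2⟩ := Nat.find_spec hex
      set k' := Nat.find hex with hk'
      refine ⟨k', hk1, ?_, ?_⟩
      · obtain ⟨j, hj⟩ : ∃ j, k' = j + 1 := ⟨k' - 1, by omega⟩
        have hjr : β / 2 * (B k).radius ≤ (B j).radius := by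
          have := Nat.find_min hex (m := j) (by omega)
          push Not at this
          rcases (show k ≤ j by omega).eq_or_lt with rfl | hlt
          · have := hrpos k
            nlinarith
          · exact (this hlt).le
        rw [hj]
        refine le_trans ?_ (hB3 j)
        rw [hθdef, mul_assoc]
        gcongr
      · refine le_trans ?_ (hheavy _ (hanti hk1.le (hcen k')))
        gcongr
        refine potential_mono (subset_inter (hanti hk1.le) ?_)
        exact Metric.closedBall_subset_closedBall hk2
  have hinf : ∀ n, ∃ k ≥ n, φ (B k).radius (B k).toSet ≤
      ENNReal.ofReal ((γ * (B k).radius) ^ c) := fun n => by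
    induction n with
    | zero => exact ⟨0, le_rfl, hE (B 0)⟩
    | succ n ih =>
      obtain ⟨k, hk, hk'⟩ := ih
      obtain ⟨k', h1, h2⟩ := hstep k hk'
      exact ⟨k', by omega, h2⟩
  have hpos : 0 < ε * w i := mul_pos (hE0 _) (h.weight_pos i)
  obtain ⟨N, hN⟩ := eventually_atTop.1 ((hsmall (q i) (h.scale_pos i)).and
    (hsmall (ε * w i / γ) (by positivity)))
  obtain ⟨k, hk, hk'⟩ := hinf N
  have h1 := le_of_potential_le (v := fun i => ε * w i) (K := K ε) (q := q) (i := i) hc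
    (mul_pos hγ (hrpos k)).le hpos.le (hN k hk).1.le ⟨η, hi, hη' k⟩ hk'
  have h2 := (hN k hk).2
  rw [lt_div_iff₀ hγ] at h2
  linarith

end Game

/-! ### Counting orbit points near a ray -/

section Counting

variable {X : Type*} [MetricSpace X] {o : X} {b : ℝ}

theorem dist_inv_mul_apply (o : X) (g h : X ≃ᵢ X) : dist o ((g⁻¹ * h) o) = dist (g o) (h o) := by
  have h1 : g ((g⁻¹ * h) o) = h o := g.apply_symm_apply (h o)
  rw [← g.dist_eq, h1]

/-- The elements of `G` that move `o` by at most `R`. -/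
abbrev OrbitBall (o : X) (G : Subgroup (X ≃ᵢ X)) (R : ℝ) : Type _ :=
  {g : X ≃ᵢ X | g ∈ G ∧ dist o (g o) ≤ R}

theorem tsum_le_of_injective {α β κ : Type*} [Fintype κ] {f : α → ℝ≥0∞} {u : β → ℝ≥0∞}
    (π : α → κ × β) (hπ : Function.Injective π) (h : ∀ a, f a ≤ u (π a).2) :
    ∑' a, f a ≤ Fintype.card κ * ∑' n, u n :=
  calc ∑' a, f a ≤ ∑' a, u (π a).2 := ENNReal.tsum_le_tsum h
    _ ≤ ∑' p : κ × β, u p.2 := ENNReal.tsum_comp_le_tsum_of_injective hπ fun p => u p.2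
    _ = Fintype.card κ * ∑' n, u n := by
      rw [ENNReal.tsum_prod', tsum_fintype]
      simp

theorem tsum_ofReal_rpow_ne_top (hb : 1 < b) {c : ℝ} (hc : 0 < c) :
    ∑' n : ℕ, ENNReal.ofReal (b ^ (-(c * n))) ≠ ∞ := by
  refine Summable.tsum_ofReal_ne_top ?_
  have h : ∀ n : ℕ, b ^ (-(c * n)) = (b ^ (-c)) ^ n := fun n => by
    rw [← Real.rpow_natCast, ← Real.rpow_mul (by linarith)]
    ring_nf
  simp_rw [h]
  exact summable_geometric_of_lt_one (by positivity)
    (Real.rpow_lt_one_of_one_lt_of_neg hb (by linarith))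

variable [IsGromovHyperbolic X]

/-- The elements of `G` whose orbit point is within bounded distance of a ray to `ξ`. -/
abbrev NearRay (o : X) (G : Subgroup (X ≃ᵢ X)) (ξ : GromovBoundary X) (C : ℝ) : Type _ :=
  {f : X ≃ᵢ X | f ∈ G ∧ dist o (f o) - C ≤ bdryProd (f o) ξ o}

/-- Orbit points near the same ray and at about the same height are boundedly close to one another.
Relative to a reference element `ρ n` for each height `n` they range over a finite set, and the
series is dominated by a geometric one. -/
theorem tsum_nearRay_ne_top (hb : 1 < b) {G : Subgroup (X ≃ᵢ X)} (hG : IsStronglyDiscrete o G)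
    (ξ : GromovBoundary X) (C : ℝ) {c : ℝ} (hc : 0 < c) :
    ∑' f : NearRay o G ξ C, ENNReal.ofReal (b ^ (-(c * dist o (f.1 o)))) ≠ ∞ := by
  set R := 2 + 2 * C + 2 * hypConst X with hR
  have hfin := hG.finite_orbit R
  have : Fintype (OrbitBall o G R) := hfin.fintype
  have hρ : ∀ n : ℕ, ∃ ρ : X ≃ᵢ X, ∀ f : NearRay o G ξ C, ⌊dist o (f.1 o)⌋₊ = n →
      (ρ⁻¹ * f.1) ∈ G ∧ dist o ((ρ⁻¹ * f.1) o) ≤ R := fun n => by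
    by_cases h : ∃ f : NearRay o G ξ C, ⌊dist o (f.1 o)⌋₊ = n
    · obtain ⟨f₀, hf₀⟩ := h
      refine ⟨f₀.1, fun f hf => ⟨G.mul_mem (G.inv_mem f₀.2.1) f.2.1, ?_⟩⟩
      rw [dist_inv_mul_apply]
      have h1 := f.2.2
      have h2 := f₀.2.2
      have h3 : (n : ℝ) ≤ dist o (f.1 o) := by rw [← hf]; exact Nat.floor_le dist_nonneg
      have h4 : (n : ℝ) ≤ dist o (f₀.1 o) := by rw [← hf₀]; exact Nat.floor_le dist_nonneg
      have h5 : dist o (f.1 o) < n + 1 := by rw [← hf]; exact Nat.lt_floor_add_one _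
      have h6 : dist o (f₀.1 o) < n + 1 := by rw [← hf₀]; exact Nat.lt_floor_add_one _
      have h7 := sub_le_gromovProduct_of_le_bdryProd (t := n - C)
        (show _ ≤ bdryProd (f₀.1 o) ξ o by linarith) (show _ ≤ bdryProd (f.1 o) ξ o by linarith)
      have h8 := dist_eq_sub_gromovProduct (f₀.1 o) (f.1 o) o
      rw [dist_comm _ o, dist_comm _ o] at h8
      linarith
    · exact ⟨1, fun f hf => (h ⟨f, hf⟩).elim⟩
  choose ρ hρ using hρ
  have := tsum_le_of_injective (f := fun f : NearRay o G ξ C =>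
    ENNReal.ofReal (b ^ (-(c * dist o (f.1 o)))))
    (u := fun n : ℕ => ENNReal.ofReal (b ^ (-(c * n))))
    (fun f => ((⟨(ρ ⌊dist o (f.1 o)⌋₊)⁻¹ * f.1, hρ _ f rfl⟩ : OrbitBall o G R),
      ⌊dist o (f.1 o)⌋₊)) ?_ ?_
  · exact ne_top_of_le_ne_top (ENNReal.mul_ne_top (by simp) (tsum_ofReal_rpow_ne_top hb hc)) this
  · intro f f' h
    rw [Prod.mk.injEq, Subtype.mk.injEq] at h
    obtain ⟨h1, h2⟩ := h
    rw [h2] at h1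
    exact Subtype.ext (mul_left_cancel h1)
  · intro f
    refine ENNReal.ofReal_le_ofReal (Real.rpow_le_rpow_of_exponent_le hb.le ?_)
    have := Nat.floor_le (dist_nonneg (x := o) (y := f.1 o))
    simp only
    nlinarith

end Counting

/-! ### Badly approximable points form an absolute winning set -/

section BadlyApproximable

variable {X : Type*} [MetricSpace X] [IsGromovHyperbolic X] [MetricSpace (GromovBoundary X)]
  {o : X} {b V : ℝ}

/-- Every ray from `o` to a point of `J` stays within distance `C` of the orbit of `o`. -/
def FollowsOrbit (o : X) (G : Subgroup (X ≃ᵢ X)) (J : Set (GromovBoundary X)) (C : ℝ) : Prop :=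
  ∀ η ∈ J, ∀ p : ℝ, 0 ≤ p → ∃ h ∈ G, |dist o (h o) - p| ≤ C ∧
    dist o (h o) - C ≤ bdryProd (h o) η o

/-- Diameters of shadows shrink by at most a constant factor from parent to child, so heights along
a branch have bounded gaps. The first vertex of height at least `p` serves. -/
theorem IsVisualConst.exists_followsOrbit (hb : 1 < b) (hV : IsVisualConst o b V)
    {G : Subgroup (X ≃ᵢ X)} {T : Set (List ℕ)} {x : List ℕ → X} {σ c : ℝ}
    (hP : IsPartitionStructure T fun ω => shadow o (x ω) σ)
    (horb : ∀ ω ∈ T, ∃ g ∈ G, x ω = g o)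
    (hx : ∀ ω ∈ T, b ^ (-(c + dist o (x ω))) ≤ Metric.diam (shadow o (x ω) σ)) :
    ∃ C, FollowsOrbit o G (partitionLimitSet T fun ω => shadow o (x ω) σ) C := by
  have hb0 : 0 < b := by linarith
  obtain ⟨κ, hκ, _, _, _, hsep⟩ := hP.separation
  have hH := hypConst_nonneg X
  set Cg := V + σ + 2 * hypConst X + c - Real.logb b κ with hCg
  have hgap : ∀ ω ∈ T, ∀ a, ω ++ [a] ∈ T →
      dist o (x (ω ++ [a])) ≤ dist o (x ω) + Cg := fun ω hω a ha => by
    have h1 := (hsep ω hω a ha).2.1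
    have h2 : κ * b ^ (-(c + dist o (x ω))) ≤
        b ^ (V + σ + 2 * hypConst X - dist o (x (ω ++ [a]))) :=
      le_trans (by have := hx ω hω; gcongr) (h1.trans (hV.diam_shadow_le hb _ _))
    rw [← Real.rpow_logb hb0 hb.ne' hκ, ← Real.rpow_add hb0,
      Real.rpow_le_rpow_left_iff hb] at h2
    linarith
  refine ⟨|Cg| + |σ| + 2 * hypConst X + dist o (x []), ?_⟩
  rintro η ⟨ω, hω, hη⟩ p hp
  have hω' : ∀ n, initialWord ω n ∈ T := hω
  have hη' : ∀ n, η ∈ shadow o (x (initialWord ω n)) σ := hη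
  have hex : ∃ n, p ≤ dist o (x (initialWord ω n)) :=
    ((tendsto_atTop.1 (tendsto_dist_branch hb hP hx hω')) p).exists
  classical
  have hn := Nat.find_spec hex
  set n := Nat.find hex with hndef
  have hbound : dist o (x (initialWord ω n)) ≤ p + |Cg| + dist o (x []) := by
    rcases Nat.eq_zero_or_pos n with h0 | h0
    · rw [h0, initialWord_zero]
      linarith [abs_nonneg Cg]
    · obtain ⟨m, hm⟩ : ∃ m, n = m + 1 := ⟨n - 1, by omega⟩
      have h1 := Nat.find_min hex (m := m) (by omega)
      have h2 := hω' (m + 1)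
      rw [initialWord_succ] at h2
      have h3 := hgap _ (hω' m) _ h2
      rw [hm, initialWord_succ]
      have := le_abs_self Cg
      have h4 : 0 ≤ dist o (x []) := dist_nonneg
      linarith
  obtain ⟨g, hg, hgx⟩ := horb _ (hω' n)
  refine ⟨g, hg, ?_, ?_⟩
  · rw [← hgx, abs_of_nonneg (by linarith)]
    linarith [abs_nonneg σ]
  · have h1 := le_bdryProd_of_mem_shadow (hη' n)
    rw [← hgx]
    have := le_abs_self σ
    have h4 : 0 ≤ dist o (x []) := dist_nonneg
    linarith [abs_nonneg Cg]

/-- If `gξ` is close to a point `η`, then `g⁻¹ h` follows the ray to `ξ` for an element `h` that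
branches off the ray to `η` where `g` does. -/
theorem IsVisualConst.exists_near_of_dist_le (hb : 1 < b) (hV : IsVisualConst o b V)
    {G : Subgroup (X ≃ᵢ X)} {J : Set (GromovBoundary X)} {C : ℝ} (hJ : FollowsOrbit o G J C)
    {g : X ≃ᵢ X} {ξ η z : GromovBoundary X} (hη : η ∈ J)
    (hd : dist (boundaryMap g ξ) η ≤ b ^ (-dist o (g o))) {p : ℝ}
    (hp : p ≤ bdryProd (g o) (boundaryMap g ξ) o) (hz : dist η z ≤ b ^ (-p)) :
    ∃ h ∈ G, dist o (h o) ≤ bdryProd (g o) (boundaryMap g ξ) o + C ∧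
      p - 2 * C - V ≤ bdryProd (h o) z o ∧
      dist (g o) (h o) ≤ dist o (g o) - bdryProd (g o) (boundaryMap g ξ) o +
        (5 * C + 2 * V + 2 * hypConst X) ∧
      dist (g o) (h o) - (6 * C + 2 * V + 5 * hypConst X) ≤
        bdryProd ((g⁻¹ * h) o) ξ o := by
  have hH := hypConst_nonneg X
  have hV0 := hV.nonneg
  set pg := bdryProd (g o) (boundaryMap g ξ) o with hpg
  have hpg0 : 0 ≤ pg := bdryProd_nonneg _ _ _
  have hpgle : pg ≤ dist o (g o) := by
    rw [dist_comm]
    exact bdryProd_le_dist _ _ _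
  obtain ⟨h, hhG, h1, h2⟩ := hJ η hη pg hpg0
  obtain ⟨h3, h4⟩ := abs_le.1 h1
  have hC : 0 ≤ C := (abs_nonneg _).trans h1
  have h5 := hV.le_bdryProd (g o) (boundaryMap g ξ) η pg
    (hd.trans (Real.rpow_le_rpow_of_exponent_le hb.le (by linarith))) le_rfl
  have h6 := hV.le_bdryProd (h o) η z (p - 2 * C)
    (hz.trans (Real.rpow_le_rpow_of_exponent_le hb.le (by linarith))) (by linarith)
  have h7 := sub_le_gromovProduct_of_le_bdryProd (t := pg - V - 2 * C)
    (show _ ≤ bdryProd (g o) η o by linarith) (show _ ≤ bdryProd (h o) η o by linarith)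
  have h8 := dist_eq_sub_gromovProduct (g o) (h o) o
  rw [dist_comm _ o, dist_comm _ o] at h8
  have h9 : dist (g o) (h o) ≤ dist o (g o) - pg + (5 * C + 2 * V + 2 * hypConst X) := by linarith
  refine ⟨h, hhG, by linarith, by linarith, h9, ?_⟩
  -- Seen from `g o`, both `h o` and `g ξ` lie in the direction of `o` up to the branch point, and
  -- `h o` is near that point. Translating by `g⁻¹` turns this into a statement about `ξ`.
  have h10 : bdryProd ((g⁻¹ * h) o) ξ o = bdryProd (h o) (boundaryMap g ξ) (g o) := by
    have := bdryProd_inv o g (h o) (boundaryMap g ξ)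
    rw [boundaryMap_inv_apply] at this
    exact this
  have h11 := gromovProduct_add_gromovProduct (h o) o (g o)
  have h12 := gromovProduct_le_dist_left (h o) (g o) o
  rw [dist_comm _ o] at h12
  have h13 := le_bdryProd_add o (g o) (boundaryMap g ξ)
  have h14 := sub_le_bdryProd (x := h o) (y := o) (z := g o) (ξ := boundaryMap g ξ)
    (t := dist o (g o) - pg - C - 2 * hypConst X) (by linarith) (by linarith)
  rw [h10]
  linarith

/-- The scale records where `g o` leaves the ray to `g ξ`, the weight how far `g o` is from `o`.
Members of scale about `r` near `z` factor as `h * f⁻¹` with `h o` near the point of height `-log r`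
on the ray to `z` and `f o` near the ray to `ξ`, and `w ^ c` is about `r ^ c * b ^ (-c * d(o, f
o))`. -/
theorem IsVisualConst.isSparseFamily (hb : 1 < b) (hV : IsVisualConst o b V)
    {G : Subgroup (X ≃ᵢ X)} (hG : IsStronglyDiscrete o G) {J : Set (GromovBoundary X)} {C : ℝ}
    (hJ : FollowsOrbit o G J C) (ξ : GromovBoundary X) :
    IsSparseFamily (Z := J) (fun g : G => b ^ (-dist o (g.1 o)))
      (fun g : G => b ^ (-bdryProd (g.1 o) (boundaryMap g.1 ξ) o))
      (fun ε g => {η : J | dist (boundaryMap g.1 ξ) η ≤ ε * b ^ (-dist o (g.1 o))}) where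
  weight_pos g := by positivity
  scale_pos g := by positivity
  scale_lt := ⟨2, fun g => lt_of_le_of_lt (Real.rpow_le_one_of_one_le_of_nonpos hb.le
    (neg_nonpos.2 (bdryProd_nonneg _ _ _))) one_lt_two⟩
  dist_le ε g z hz z' hz' := by
    have h := dist_triangle_left (z : GromovBoundary X) z' (boundaryMap g.1 ξ)
    have h1 : dist (boundaryMap g.1 ξ) z ≤ ε * b ^ (-dist o (g.1 o)) := hz
    have h2 : dist (boundaryMap g.1 ξ) z' ≤ ε * b ^ (-dist o (g.1 o)) := hz'
    rw [Subtype.dist_eq]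
    linarith
  mono ε hε g z hz := by
    have h : dist (boundaryMap g.1 ξ) z ≤ ε * b ^ (-dist o (g.1 o)) := hz
    have h' : ε * b ^ (-dist o (g.1 o)) ≤ 1 * b ^ (-dist o (g.1 o)) := by gcongr
    exact h.trans h'
  sum_le := by
    intro c hc θ hθ
    have hb0 : 0 < b := by linarith
    have hH := hypConst_nonneg X
    set τ := -Real.logb b θ with hτ
    set R := 2 * (τ + 3 * C + V + hypConst X) with hR
    set C₄ := 5 * C + 2 * V + 2 * hypConst X with hC₄
    set C₆ := 6 * C + 2 * V + 5 * hypConst X with hC₆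
    have hfin := hG.finite_orbit R
    have : Fintype (OrbitBall o G R) := hfin.fintype
    set S := ∑' f : NearRay o G ξ C₆, ENNReal.ofReal (b ^ (-(c * dist o (f.1 o)))) with hS
    have hS' : S ≠ ∞ := tsum_nearRay_ne_top hb hG ξ C₆ hc
    set N : ℝ≥0∞ := Fintype.card (OrbitBall o G R) * S with hN
    have hN' : N ≠ ∞ := ENNReal.mul_ne_top (by simp) hS'
    refine ⟨N.toReal * b ^ (c * C₄), by positivity, fun r hr z => ?_⟩
    rw [← tsum_subtype]
    set p := -Real.logb b r with hp
    have hrp : r = b ^ (-p) := by rw [hp, neg_neg, Real.rpow_logb hb0 hb.ne' hr]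
    have hθτ : θ = b ^ (-τ) := by rw [hτ, neg_neg, Real.rpow_logb hb0 hb.ne' hθ]
    set I := {g : G | θ * r ≤ b ^ (-bdryProd (g.1 o) (boundaryMap g.1 ξ) o) ∧
      b ^ (-bdryProd (g.1 o) (boundaryMap g.1 ξ) o) < r ∧
      ({η : J | dist (boundaryMap g.1 ξ) η ≤ 1 * b ^ (-dist o (g.1 o))} ∩
        Metric.closedBall z r).Nonempty} with hI
    have hh : ∀ g : I, ∃ h ∈ G, dist o (h o) ≤ p + τ + C ∧
        p - 2 * C - V ≤ bdryProd (h o) z o ∧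
        p + dist o ((g.1.1⁻¹ * h) o) - C₄ ≤ dist o (g.1.1 o) ∧
        dist o ((g.1.1⁻¹ * h) o) - C₆ ≤ bdryProd ((g.1.1⁻¹ * h) o) ξ o := by
      rintro ⟨⟨g, hg⟩, h1, h2, η, hη, hηz⟩
      have hη' : dist (boundaryMap g ξ) η ≤ 1 * b ^ (-dist o (g o)) := hη
      rw [one_mul] at hη'
      rw [Metric.mem_closedBall, Subtype.dist_eq, hrp] at hηz
      rw [hrp, hθτ, ← Real.rpow_add hb0, Real.rpow_le_rpow_left_iff hb] at h1
      rw [hrp, Real.rpow_lt_rpow_left_iff hb] at h2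
      simp only at h1 h2
      obtain ⟨h, hhG, a1, a2, a3, a4⟩ :=
        hV.exists_near_of_dist_le hb hJ η.2 hη' (p := p) (by linarith) hηz
      rw [← dist_inv_mul_apply] at a3 a4
      exact ⟨h, hhG, by linarith, a2, by simp only; linarith, a4⟩
    choose h hhG hh1 hh2 hh3 hh4 using hh
    rcases isEmpty_or_nonempty I with hIe | ⟨⟨g₀⟩⟩
    · rw [tsum_empty]
      exact zero_le
    -- All the branching elements `h g` are near the same point of the ray to `z`, hence in a fixed
    -- orbit ball relative to one of them.
    have hball : ∀ g : I, ((h g₀)⁻¹ * h g) ∈ G ∧ dist o (((h g₀)⁻¹ * h g) o) ≤ R := fun g => by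
      refine ⟨G.mul_mem (G.inv_mem (hhG g₀)) (hhG g), ?_⟩
      rw [dist_inv_mul_apply]
      have h1 := sub_le_gromovProduct_of_le_bdryProd (hh2 g₀) (hh2 g)
      have h2 := dist_eq_sub_gromovProduct (h g₀ o) (h g o) o
      rw [dist_comm _ o, dist_comm _ o] at h2
      linarith [hh1 g, hh1 g₀]
    -- The pair formed by `h g` (up to the reference) and `f = g⁻¹ * h g` determines `g`.
    have key := tsum_le_of_injective
      (f := fun g : I => ENNReal.ofReal ((b ^ (-dist o (g.1.1 o))) ^ c))
      (u := fun f : NearRay o G ξ C₆ => ENNReal.ofReal (b ^ (c * C₄) * r ^ c) *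
        ENNReal.ofReal (b ^ (-(c * dist o (f.1 o)))))
      (fun g => ((⟨(h g₀)⁻¹ * h g, hball g⟩ : OrbitBall o G R),
        (⟨g.1.1⁻¹ * h g, G.mul_mem (G.inv_mem g.1.2) (hhG g), hh4 g⟩ : NearRay o G ξ C₆))) ?_ ?_
    · refine key.trans (le_of_eq ?_)
      rw [ENNReal.tsum_mul_left, mul_assoc N.toReal, ENNReal.ofReal_mul ENNReal.toReal_nonneg,
        ENNReal.ofReal_toReal hN', hN, mul_assoc, mul_comm S]
    · intro g g' hgg
      rw [Prod.mk.injEq, Subtype.mk.injEq, Subtype.mk.injEq] at hgg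
      obtain ⟨e1, e2⟩ := hgg
      have e3 := mul_left_cancel e1
      rw [e3] at e2
      exact Subtype.ext (Subtype.ext (inv_injective (mul_right_cancel e2)))
    · intro g
      rw [← ENNReal.ofReal_mul (by positivity)]
      refine ENNReal.ofReal_le_ofReal ?_
      rw [hrp, ← Real.rpow_mul hb0.le, ← Real.rpow_mul hb0.le, ← Real.rpow_add hb0,
        ← Real.rpow_add hb0]
      refine Real.rpow_le_rpow_of_exponent_le hb.le ?_
      have := mul_le_mul_of_nonneg_left (hh3 g) hc.le
      simp only
      linarith

theorem IsBetaAbsoluteWinning.mono {Z : Type*} [MetricSpace Z] {β : ℝ} {S S' : Set Z}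
    (h : IsBetaAbsoluteWinning β S) (hS : S ⊆ S') : IsBetaAbsoluteWinning β S' := by
  obtain ⟨F, h1, h2⟩ := h
  exact ⟨F, h1, fun B hB => (h2 B hB).mono (inter_subset_inter_right _ hS)⟩

/-- If the annulus is empty, the balls of radii `r` and `c * r` have comparable masses, which
regularity excludes for small `c`. -/
theorem IsAhlforsRegular.exists_isUniformlyPerfect {s : ℝ} (hs : 0 < s) {Z : Type*} [MetricSpace Z]
    (h : IsAhlforsRegular s Z) : ∃ c, IsUniformlyPerfect c Z := by
  obtain ⟨μ, C, hC, h⟩ := h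
  obtain ⟨ε₀, hε₀, hε⟩ := exists_rpow_mul_le hs (show (0 : ℝ) ≤ C by positivity)
    (show (0 : ℝ) < C⁻¹ / 2 by positivity)
  set c := min ε₀ (1 / 2) with hc
  have hc0 : 0 < c := by positivity
  have hc1 : c < 1 := (min_le_right _ _).trans_lt (by norm_num)
  refine ⟨c, hc0, hc1, fun z r hr hr1 => ?_⟩
  by_contra hne
  rw [not_nonempty_iff_eq_empty, sdiff_eq_empty] at hne
  have h1 := (h z r hr hr1).1.trans ((μ.mono hne).trans
    (h z (c * r) (by positivity) (by nlinarith)).2)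
  rw [ENNReal.ofReal_le_ofReal_iff (by positivity), Real.mul_rpow hc0.le hr.le] at h1
  have h2 := hε c hc0.le (min_le_left _ _)
  have h3 : 0 < r ^ s := by positivity
  have h4 : 0 < C⁻¹ := by positivity
  have h5 : C⁻¹ * r ^ s ≤ (c ^ s * C) * r ^ s := by linarith
  have h6 := le_of_mul_le_mul_right h5 h3
  linarith

theorem IsShadowStructure.isAbsoluteWinning (hb : 1 < b) (hV : IsVisualConst o b V)
    {G : Subgroup (X ≃ᵢ X)} (hG : IsStronglyDiscrete o G) {s σ c : ℝ} (hs : 0 < s)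
    (hc : ∀ g : X ≃ᵢ X, b ^ (-(c + dist o (g o))) ≤ Metric.diam (shadow o (g o) σ))
    {T : Set (List ℕ)} {x : List ℕ → X} (h : IsShadowStructure o G s σ T x)
    (ξ : GromovBoundary X) :
    IsAbsoluteWinning {η : partitionLimitSet T (fun ω => shadow o (x ω) σ) |
      (η : GromovBoundary X) ∈ badlyApproximable o b G ξ} := by
  refine ⟨h.ahlfors.exists_isUniformlyPerfect hs, fun c' hc' β hβ hβ' => ?_⟩
  have hx : ∀ ω ∈ T, b ^ (-(c + dist o (x ω))) ≤ Metric.diam (shadow o (x ω) σ) := fun ω hω => by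
    obtain ⟨g, -, hg⟩ := h.orbit ω hω
    rw [hg]
    exact hc g
  have hcomp : CompactSpace (partitionLimitSet T fun ω => shadow o (x ω) σ) :=
    isCompact_iff_compactSpace.1 (h.partition.isCompact_limitSet
      (hV.finite_children hb hG h.partition h.orbit h.injOn)
      fun ω hω => hV.exists_mem_branch hb h.partition hx hω)
  obtain ⟨C, hC⟩ := hV.exists_followsOrbit hb h.partition h.orbit hx
  refine ((hV.isSparseFamily hb hG hC ξ).isBetaAbsoluteWinning hβ
    (by linarith [hc'.2.1])).mono ?_
  rintro η ⟨ε, hε, hη⟩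
  refine ⟨?_, ε, hε, fun g hg => ?_⟩
  · obtain ⟨σ', h1, g, h2, h3, h4, -⟩ := h.uniformlyRadial η.2
    exact ⟨σ', h1, g, h2, h3, h4⟩
  · exact (not_le.1 (hη ⟨g, hg⟩)).le

end BadlyApproximable

/-! ### Loxodromic elements -/

section Loxodromic

variable {X : Type*} [MetricSpace X] [IsGromovHyperbolic X] [MetricSpace (GromovBoundary X)]
  {o : X} {b V : ℝ}

theorem IsVisualConst.exists_not_both (hb : 1 < b) (hV : IsVisualConst o b V)
    {ξ η : GromovBoundary X} (h : ξ ≠ η) :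
    ∃ t : ℝ, ∀ y : X, bdryProd y ξ o ≤ t ∨ bdryProd y η o ≤ t := by
  have hb0 : 0 < b := by linarith
  refine ⟨V + 1 - Real.logb b (dist ξ η), fun y => ?_⟩
  by_contra! hcon
  have h1 := hV.dist_le y ξ η _ hcon.1.le hcon.2.le
  rw [← Real.logb_le_iff_le_rpow hb (dist_pos.2 h)] at h1
  linarith

theorem AttractsOff.tendsto {g : X ≃ᵢ X} {p q u : GromovBoundary X} (h : AttractsOff g p q)
    (hu : u ≠ q) : Tendsto (fun n => boundaryMap (g ^ n) u) atTop (𝓝 p) := by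
  have := (h {u}ᶜ (isOpen_compl_singleton.mem_nhds hu.symm)).tendsto_at (x := u) (by simp)
  simpa only [boundaryMap_iterate] using this

theorem AttractsOff.pow_injective {g : X ≃ᵢ X} {p q u : GromovBoundary X} (h : AttractsOff g p q)
    (hu : u ≠ q) (hup : u ≠ p) : Function.Injective fun n : ℕ => g ^ n := by
  rw [injective_pow_iff_not_isOfFinOrder, isOfFinOrder_iff_pow_eq_one]
  rintro ⟨n, hn, hgn⟩
  have h1 := (h.tendsto hu).comp (tendsto_id.const_mul_atTop' hn)
  refine hup (tendsto_nhds_unique (tendsto_const_nhds.congr fun m => ?_) h1)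
  simp only [Function.comp, id]
  rw [pow_mul, hgn, one_pow, boundaryMap_one]

/-- Turns boundary dynamics into convergence of the orbit. Of the points `u` and `p`, one is not in
the direction of `g⁻ⁿ o`, so its image under `gⁿ` lies in a shadow of `gⁿ o` of bounded parameter;
this image tends to `p`, and `gⁿ o` escapes by strong discreteness. -/
theorem AttractsOff.tendsto_bdryProd (hb : 1 < b) (hV : IsVisualConst o b V)
    {G : Subgroup (X ≃ᵢ X)} (hG : IsStronglyDiscrete o G) {g : X ≃ᵢ X} (hg : g ∈ G)
    {p q u : GromovBoundary X} (h : AttractsOff g p q) (hpq : p ≠ q) (hu : u ≠ q) (hup : u ≠ p) :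
    Tendsto (fun n : ℕ => bdryProd ((g ^ n) o) p o) atTop atTop := by
  have hdist : Tendsto (fun n : ℕ => dist o ((g ^ n) o)) atTop atTop := by
    refine tendsto_atTop.2 fun M => ?_
    have hfin := (hG.finite_orbit M).preimage ((h.pow_injective hu hup).injOn)
    rw [← Nat.cofinite_eq_atTop]
    filter_upwards [hfin.compl_mem_cofinite] with n hn
    by_contra hcon
    exact hn ⟨G.pow_mem hg n, (not_le.1 hcon).le⟩
  obtain ⟨t, ht⟩ := hV.exists_not_both hb hup
  refine tendsto_atTop.2 fun M => ?_
  have hnear : ∀ v, v ≠ q → ∀ᶠ n in atTop, dist (boundaryMap (g ^ n) v) p < b ^ (-(M + V)) :=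
    fun v hv => Metric.tendsto_nhds.1 (h.tendsto hv) _ (by positivity)
  filter_upwards [hnear u hu, hnear p hpq,
    (tendsto_atTop.1 hdist) (M + V + t + 2 * hypConst X)] with n h1 h2 h3
  have key : ∀ v, dist (boundaryMap (g ^ n) v) p < b ^ (-(M + V)) →
      bdryProd ((g ^ n)⁻¹ o) v o ≤ t → M ≤ bdryProd ((g ^ n) o) p o := fun v hv1 hv2 => by
    have h4 := bdryProd_inv o (g ^ n) o (boundaryMap (g ^ n) v)
    rw [boundaryMap_inv_apply] at h4
    have h5 := le_bdryProd_add o ((g ^ n) o) (boundaryMap (g ^ n) v)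
    have h6 := hV.le_bdryProd ((g ^ n) o) _ p (M + V) hv1.le (by linarith)
    linarith
  rcases ht ((g ^ n)⁻¹ o) with h4 | h4
  · exact key u h1 h4
  · exact key p h2 h4

theorem IsGeneralType.exists_points {G : Subgroup (X ≃ᵢ X)} (h : IsGeneralType G) :
    ∃ g₁ ∈ G, ∃ g₂ ∈ G, ∃ p₁ q₁ p₂ q₂ : GromovBoundary X, p₁ ≠ q₁ ∧ p₂ ≠ q₂ ∧ p₁ ≠ p₂ ∧
      p₁ ≠ q₂ ∧ q₁ ≠ p₂ ∧ q₁ ≠ q₂ ∧ AttractsOff g₁ p₁ q₁ ∧ AttractsOff g₁⁻¹ q₁ p₁ ∧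
      AttractsOff g₂ p₂ q₂ ∧ AttractsOff g₂⁻¹ q₂ p₂ := by
  obtain ⟨g₁, hg₁, g₂, hg₂, ⟨p₁, q₁, h1, hp₁, hq₁, a1, a2⟩, ⟨p₂, q₂, h2, hp₂, hq₂, a3, a4⟩, hd⟩ := h
  have hne : ∀ u v, boundaryMap g₁ u = u → boundaryMap g₂ v = v → u ≠ v := by
    rintro u v hu hv rfl
    exact disjoint_left.1 hd hu hv
  exact ⟨g₁, hg₁, g₂, hg₂, p₁, q₁, p₂, q₂, h1, h2, hne _ _ hp₁ hp₂, hne _ _ hp₁ hq₂,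
    hne _ _ hq₁ hp₂, hne _ _ hq₁ hq₂, a1, a2, a3, a4⟩

theorem IsVisualConst.exists_gromovProduct_le (hb : 1 < b) (hV : IsVisualConst o b V)
    {ξ η : GromovBoundary X} (h : ξ ≠ η) {y z : ℕ → X}
    (hy : Tendsto (fun n => bdryProd (y n) ξ o) atTop atTop)
    (hz : Tendsto (fun n => bdryProd (z n) η o) atTop atTop) :
    ∃ Q : ℝ, ∀ᶠ n in atTop, gromovProduct (y n) (z n) o ≤ Q := by
  have hH := hypConst_nonneg X
  obtain ⟨t, ht⟩ := hV.exists_not_both hb h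
  refine ⟨t + 1 + hypConst X, ?_⟩
  filter_upwards [(tendsto_atTop.1 hy) (t + 1), (tendsto_atTop.1 hz) (t + 1 + hypConst X)]
    with n h1 h2
  by_contra! hcon
  have h3 := sub_le_bdryProd hcon.le h2
  rcases ht (y n) with h4 | h4 <;> linarith

theorem IsVisualConst.exists_forall_gromovProduct_le (hb : 1 < b) (hV : IsVisualConst o b V)
    {ξ : Fin 3 → GromovBoundary X} (h : Function.Injective ξ) {y : Fin 3 → ℕ → X}
    (hy : ∀ i, Tendsto (fun n => bdryProd (y i n) (ξ i) o) atTop atTop) :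
    ∃ Q : ℝ, ∀ᶠ n in atTop, ∀ i j, i ≠ j → gromovProduct (y i n) (y j n) o ≤ Q := by
  have h1 : ∀ i j, ∃ Q : ℝ, ∀ᶠ n in atTop, i ≠ j → gromovProduct (y i n) (y j n) o ≤ Q := by
    intro i j
    by_cases hij : i = j
    · exact ⟨0, Eventually.of_forall fun n hn => (hn hij).elim⟩
    · obtain ⟨Q, hQ⟩ := hV.exists_gromovProduct_le hb (h.ne hij) (hy i) (hy j)
      exact ⟨Q, hQ.mono fun n hn _ => hn⟩
  choose Q hQ using h1
  obtain ⟨M, hM⟩ := Finite.exists_le fun p : Fin 3 × Fin 3 => Q p.1 p.2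
  refine ⟨M, ?_⟩
  filter_upwards [eventually_all.2 fun i => eventually_all.2 fun j => hQ i j] with n hn i j hij
  exact (hn i j hij).trans (hM (i, j))

/-- High powers of `g₁`, `g₂`, `g₁⁻¹` move `o` towards `p₁`, `p₂`, `q₁`, and their inverses move it
towards `q₁`, `q₂`, `p₁`; both triples are distinct. It matters that `Q` does not depend on `M`. -/
theorem IsGeneralType.exists_triple (hb : 1 < b) (hV : IsVisualConst o b V)
    {G : Subgroup (X ≃ᵢ X)} (hG : IsStronglyDiscrete o G) (h : IsGeneralType G) :
    ∃ Q : ℝ, ∀ M : ℝ, ∃ k : Fin 3 → X ≃ᵢ X, (∀ i, k i ∈ G) ∧ (∀ i, M ≤ dist o (k i o)) ∧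
      (∀ i j, i ≠ j → gromovProduct (k i o) (k j o) o ≤ Q) ∧
      ∀ i j, i ≠ j → gromovProduct ((k i)⁻¹ o) ((k j)⁻¹ o) o ≤ Q := by
  obtain ⟨g₁, hg₁, g₂, hg₂, p₁, q₁, p₂, q₂, h1, h2, h3, h4, h5, h6, a1, a2, a3, a4⟩ :=
    h.exists_points
  have t1 := a1.tendsto_bdryProd hb hV hG hg₁ h1 h5.symm h3.symm
  have t2 := a2.tendsto_bdryProd hb hV hG (G.inv_mem hg₁) h1.symm h3.symm h5.symm
  have t3 := a3.tendsto_bdryProd hb hV hG hg₂ h2 h4 h3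
  have t4 := a4.tendsto_bdryProd hb hV hG (G.inv_mem hg₂) h2.symm h3 h4
  set k : ℕ → Fin 3 → X ≃ᵢ X := fun n => ![g₁ ^ n, g₂ ^ n, g₁⁻¹ ^ n] with hk
  have hf : ∀ i, Tendsto (fun n => bdryProd (k n i o) (![p₁, p₂, q₁] i) o) atTop atTop := by
    intro i
    fin_cases i
    exacts [t1, t3, t2]
  have hf' : ∀ i, Tendsto (fun n => bdryProd ((k n i)⁻¹ o) (![q₁, q₂, p₁] i) o) atTop atTop := by
    intro i
    fin_cases i
    · simpa [hk] using t2
    · simpa [hk] using t4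
    · simpa [hk] using t1
  have hinj : Function.Injective ![p₁, p₂, q₁] := by
    intro i j hij
    fin_cases i <;> fin_cases j <;> simp_all
  have hinj' : Function.Injective ![q₁, q₂, p₁] := by
    intro i j hij
    fin_cases i <;> fin_cases j <;> simp_all
  obtain ⟨Q, hQ⟩ := hV.exists_forall_gromovProduct_le hb hinj hf
  obtain ⟨Q', hQ'⟩ := hV.exists_forall_gromovProduct_le hb hinj' hf'
  refine ⟨max Q Q', fun M => ?_⟩
  obtain ⟨n, h1, h2, h3⟩ := (hQ.and (hQ'.and
    (eventually_all.2 fun i => (tendsto_atTop.1 (hf i)) M))).exists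
  refine ⟨k n, fun i => ?_, fun i => ?_, fun i j hij => (h1 i j hij).trans (le_max_left _ _),
    fun i j hij => (h2 i j hij).trans (le_max_right _ _)⟩
  · fin_cases i
    exacts [G.pow_mem hg₁ n, G.pow_mem hg₂ n, G.pow_mem (G.inv_mem hg₁) n]
  · refine (h3 i).trans ?_
    rw [dist_comm]
    exact bdryProd_le_dist _ _ _

/-- A finite set of elements of `G`, one of which always prevents backtracking. -/
theorem IsGeneralType.exists_twist (hb : 1 < b) (hV : IsVisualConst o b V)
    {G : Subgroup (X ≃ᵢ X)} (hG : IsStronglyDiscrete o G) (h : IsGeneralType G) :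
    ∃ C : ℝ, ∃ k : Fin 3 → X ≃ᵢ X, (∀ i, k i ∈ G) ∧
      ∀ u v : X, ∃ i, gromovProduct u (k i v) o ≤ C := by
  have hH := hypConst_nonneg X
  obtain ⟨Q, hQ⟩ := h.exists_triple hb hV hG
  set Q' := Q + hypConst X with hQ'
  obtain ⟨k, hkG, hk1, hk2, hk3⟩ := hQ (2 * Q' + hypConst X + 1)
  refine ⟨Q' + hypConst X, k, hkG, fun u v => ?_⟩
  have bad : ∀ (w : X) (y : Fin 3 → X),
      (∀ i j, i ≠ j → gromovProduct (y i) (y j) o ≤ Q) →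
      ∀ i j, i ≠ j → Q' < gromovProduct w (y i) o → ¬ Q' < gromovProduct w (y j) o := by
    intro w y hy i j hij h1 h2
    have h3 := min_gromovProduct_sub_le (y i) w (y j) o
    rw [gromovProduct_comm (y i) w] at h3
    have h4 := lt_min h1 h2
    have h5 := hy i j hij
    linarith
  -- The point `u` can be in the direction of only one of the `k i o`, and `v` in that of only one
  -- of the `(k i)⁻¹ o`; of three indices one is left.
  obtain ⟨i, hi1, hi2⟩ : ∃ i, gromovProduct u (k i o) o ≤ Q' ∧
      gromovProduct v ((k i)⁻¹ o) o ≤ Q' := by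
    by_contra! hcon
    have b1 := bad u (fun i => k i o) hk2
    have b2 := bad v (fun i => (k i)⁻¹ o) hk3
    have h' : ∀ i, Q' < gromovProduct u (k i o) o ∨ Q' < gromovProduct v ((k i)⁻¹ o) o := fun i => by
      by_cases hi : gromovProduct u (k i o) o ≤ Q'
      · exact Or.inr (hcon i hi)
      · exact Or.inl (not_le.1 hi)
    rcases h' 0 with c0 | c0 <;> rcases h' 1 with c1 | c1 <;> rcases h' 2 with c2 | c2
    exacts [b1 0 1 (by decide) c0 c1, b1 0 1 (by decide) c0 c1, b1 0 2 (by decide) c0 c2,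
      b2 1 2 (by decide) c1 c2, b1 1 2 (by decide) c1 c2, b2 0 2 (by decide) c0 c2,
      b2 0 1 (by decide) c0 c1, b2 0 1 (by decide) c0 c1]
  refine ⟨i, ?_⟩
  by_contra! hcon
  -- As `v` avoids `(k i)⁻¹ o` and `k i o` is far away, `k i v` lies in the direction of `k i o`,
  -- which `u` avoids.
  have h1 := gromovProduct_add_gromovProduct (k i v) (k i o) o
  have h2 : gromovProduct (k i v) o (k i o) = gromovProduct v ((k i)⁻¹ o) o := by
    have h3 := gromovProduct_map (k i) v ((k i)⁻¹ o) o
    rwa [show k i ((k i)⁻¹ o) = o from (k i).apply_symm_apply o] at h3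
  have h4 := hk1 i
  rw [dist_comm] at h4
  have h5 := min_gromovProduct_sub_le u (k i v) (k i o) o
  have h6 : Q' + hypConst X < min (gromovProduct u (k i v) o)
    (gromovProduct (k i v) (k i o) o) := lt_min hcon (by linarith)
  linarith

end Loxodromic

/-! ### Orbit growth -/

section Growth

variable {X : Type*} [MetricSpace X] {o : X} {b : ℝ}

/-- Otherwise the annuli contain `O(b ^ (s * n))` elements, and the Poincaré series converges at
every exponent `t` between `s` and `δ`. -/
theorem exists_large_annulus (hb : 1 < b) {G : Subgroup (X ≃ᵢ X)} (hG : IsStronglyDiscrete o G)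
    {s : ℝ} (hs : 0 < s) (hsδ : ENNReal.ofReal s < poincareExponent o b G) (A : ℝ) (n₀ : ℕ) :
    ∃ n ≥ n₀, ∃ F : Finset (X ≃ᵢ X), (∀ g ∈ F, g ∈ G ∧ n ≤ dist o (g o) ∧ dist o (g o) ≤ n + 1) ∧
      A * b ^ (s * n) ≤ F.card := by
  by_contra! hcon
  have hb0 : 0 < b := by linarith
  obtain ⟨t, hst, ht⟩ := ENNReal.lt_iff_exists_nnreal_btwn.1 hsδ
  have hst' : s < t := by
    rw [← ENNReal.ofReal_coe_nnreal, ENNReal.ofReal_lt_ofReal_iff_of_nonneg hs.le] at hst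
    exact hst
  have hns : ¬ Summable fun g : G => b ^ (-((t : ℝ) * dist o (g.1 o))) := fun hsum =>
    absurd ht (not_lt.2 (iInf₂_le t hsum))
  refine hns ?_
  set f : G → ℝ := fun g => b ^ (-((t : ℝ) * dist o (g.1 o))) with hf
  have hf0 : ∀ g, 0 ≤ f g := fun g => by positivity
  suffices hfin : ∑' g, ENNReal.ofReal (f g) ≠ ∞ by
    have := ENNReal.summable_toReal hfin
    simpa only [ENNReal.toReal_ofReal (hf0 _)] using this
  set lev : G → ℕ := fun g => ⌊dist o (g.1 o)⌋₊ with hlev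
  have hle : ∀ g, (lev g : ℝ) ≤ dist o (g.1 o) := fun g => Nat.floor_le dist_nonneg
  have hlt : ∀ g, dist o (g.1 o) ≤ lev g + 1 := fun g => (Nat.lt_floor_add_one _).le
  have hfib : ∀ n, Finite {g : G // lev g = n} := fun n => by
    have h1 := (hG.finite_orbit (n + 1)).preimage (Subtype.val_injective (p := (· ∈ G))).injOn
    refine Set.Finite.to_subtype (s := {g : G | lev g = n}) (h1.subset fun g hg => ?_)
    have hg' : lev g = n := hg
    refine ⟨g.2, ?_⟩
    rw [← hg']
    exact hlt g
  have hcard : ∀ n ≥ n₀, (Nat.card {g : G // lev g = n} : ℝ) < A * b ^ (s * n) := fun n hn => by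
    classical
    have : Fintype {g : G // lev g = n} := Fintype.ofFinite _
    set F := (Finset.univ : Finset {g : G // lev g = n}).image fun g => g.1.1 with hF
    have h1 := hcon n hn F fun g hg => by
      obtain ⟨g', -, rfl⟩ := Finset.mem_image.1 hg
      refine ⟨g'.1.2, ?_, ?_⟩
      · have := hle g'.1
        rwa [g'.2] at this
      · have := hlt g'.1
        rwa [g'.2] at this
    have hinj : Function.Injective fun g : {g : G // lev g = n} => g.1.1 :=
      Subtype.val_injective.comp Subtype.val_injective
    rwa [hF, Finset.card_image_of_injective _ hinj, Finset.card_univ,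
      ← Nat.card_eq_fintype_card] at h1
  obtain ⟨A', hA'⟩ : ∃ A' : ℝ, ∀ n, (Nat.card {g : G // lev g = n} : ℝ) ≤ A' * b ^ (s * n) := by
    refine ⟨|A| + ∑ m ∈ Finset.range n₀, (Nat.card {g : G // lev g = m} : ℝ), fun n => ?_⟩
    have h0 : 0 ≤ ∑ m ∈ Finset.range n₀, (Nat.card {g : G // lev g = m} : ℝ) :=
      Finset.sum_nonneg fun _ _ => Nat.cast_nonneg _
    rcases lt_or_ge n n₀ with hn | hn
    · have h1 := Finset.single_le_sum (f := fun m => (Nat.card {g : G // lev g = m} : ℝ))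
        (fun _ _ => Nat.cast_nonneg _) (Finset.mem_range.2 hn)
      have h2 : 1 ≤ b ^ (s * n) := Real.one_le_rpow hb.le (by positivity)
      have h3 := abs_nonneg A
      nlinarith
    · refine (hcard n hn).le.trans ?_
      have := le_abs_self A
      gcongr
      linarith
  have hsum : ∑' g, ENNReal.ofReal (f g) ≤
      ∑' n : ℕ, ENNReal.ofReal A' * ENNReal.ofReal (b ^ (-((t - s) * n))) := by
    rw [← (Equiv.sigmaFiberEquiv lev).tsum_eq, ENNReal.tsum_sigma']
    refine ENNReal.tsum_le_tsum fun n => ?_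
    have : Fintype {g : G // lev g = n} := Fintype.ofFinite _
    rw [tsum_fintype]
    have h1 : ∀ g ∈ (Finset.univ : Finset {g : G // lev g = n}),
        ENNReal.ofReal (f (Equiv.sigmaFiberEquiv lev ⟨n, g⟩)) ≤
          ENNReal.ofReal (b ^ (-(t * n : ℝ))) := fun g _ => by
      refine ENNReal.ofReal_le_ofReal (Real.rpow_le_rpow_of_exponent_le hb.le ?_)
      have h2 := hle g.1
      rw [g.2] at h2
      simp only [Equiv.sigmaFiberEquiv_apply]
      have := mul_le_mul_of_nonneg_left h2 t.2
      exact neg_le_neg this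
    refine (Finset.sum_le_card_nsmul _ _ _ h1).trans ?_
    have h3 := hA' n
    rw [Nat.card_eq_fintype_card] at h3
    have hA0 : 0 ≤ A' := by
      have := (Nat.cast_nonneg _).trans h3
      exact nonneg_of_mul_nonneg_left this (by positivity)
    rw [nsmul_eq_mul, Finset.card_univ, ← ENNReal.ofReal_natCast,
      ← ENNReal.ofReal_mul (by positivity), ← ENNReal.ofReal_mul hA0]
    refine ENNReal.ofReal_le_ofReal ?_
    calc (Fintype.card {g : G // lev g = n} : ℝ) * b ^ (-(t * n : ℝ))
        ≤ A' * b ^ (s * n) * b ^ (-(t * n : ℝ)) := by gcongr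
      _ = A' * b ^ (-((t - s) * n)) := by
        rw [mul_assoc, ← Real.rpow_add hb0]
        ring_nf
  refine ne_top_of_le_ne_top ?_ hsum
  rw [ENNReal.tsum_mul_left]
  exact ENNReal.mul_ne_top ENNReal.ofReal_ne_top
    (tsum_ofReal_rpow_ne_top hb (by linarith))

/-- Greedy choice: each chosen element discards at most `M` elements, itself included. -/
theorem exists_separated_subset {G : Subgroup (X ≃ᵢ X)} {E : ℝ} (hE : 0 ≤ E) {M : ℕ}
    (hM : ∀ B : Finset (X ≃ᵢ X), (∀ g ∈ B, g ∈ G ∧ dist o (g o) ≤ E) → B.card ≤ M)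
    (F : Finset (X ≃ᵢ X)) (hF : ∀ g ∈ F, g ∈ G) :
    ∃ B ⊆ F, (∀ g ∈ B, ∀ g' ∈ B, g ≠ g' → E < dist (g o) (g' o)) ∧ F.card ≤ M * B.card := by
  classical
  induction F using Finset.strongInduction with
  | H F ih =>
    rcases F.eq_empty_or_nonempty with rfl | ⟨g, hg⟩
    · exact ⟨∅, le_rfl, by simp, by simp⟩
    set F' := F.filter fun g' => E < dist (g o) (g' o) with hF'
    have hss : F' ⊂ F := Finset.filter_ssubset.2 ⟨g, hg, by simpa using hE⟩
    obtain ⟨B, hB, hB1, hB2⟩ := ih F' hss fun g' hg' => hF g' (hss.1 hg')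
    have hgB : g ∉ B := fun h => by
      have := (Finset.mem_filter.1 (hB h)).2
      rw [dist_self] at this
      linarith
    refine ⟨insert g B, Finset.insert_subset hg (hB.trans hss.1), ?_, ?_⟩
    · have h1 : ∀ g' ∈ B, E < dist (g o) (g' o) := fun g' hg' =>
        (Finset.mem_filter.1 (hB hg')).2
      intro a ha a' ha' hne
      rcases Finset.mem_insert.1 ha with rfl | ha₁
      · rcases Finset.mem_insert.1 ha' with rfl | ha'
        · exact (hne rfl).elim
        · exact h1 _ ha'
      · rcases Finset.mem_insert.1 ha' with rfl | ha'
        · rw [dist_comm]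
          exact h1 _ ha₁
        · exact hB1 _ ha₁ _ ha' hne
    · have h2 : (F.filter fun g' => ¬ E < dist (g o) (g' o)).card ≤ M := by
        rw [← Finset.card_image_of_injective _ (mul_right_injective g⁻¹)]
        refine hM _ fun h hh => ?_
        obtain ⟨g', hg', rfl⟩ := Finset.mem_image.1 hh
        obtain ⟨hg'1, hg'2⟩ := Finset.mem_filter.1 hg'
        refine ⟨G.mul_mem (G.inv_mem (hF g hg)) (hF g' hg'1), ?_⟩
        simp only [dist_inv_mul_apply]
        exact not_lt.1 hg'2
      have h3 := Finset.card_filter_add_card_filter_not (s := F)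
        (fun g' => E < dist (g o) (g' o))
      rw [Finset.card_insert_of_notMem hgB]
      rw [← hF'] at h3
      nlinarith

end Growth

/-! ### Branching -/

section Branching

variable {X : Type*} [MetricSpace X] {o : X} {b : ℝ}

/-- Each `h` has `N` children `S h a`, which lead away from `o`, are at distance about `ℓ` from `h`
and at distance more than `E` from each other. -/
structure IsBranching (o : X) (G : Subgroup (X ≃ᵢ X)) (N : ℕ) (C ℓ κ E : ℝ)
    (S : (X ≃ᵢ X) → ℕ → X ≃ᵢ X) : Prop where
  mem : ∀ h ∈ G, ∀ a < N, S h a ∈ G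
  prod_le : ∀ h ∈ G, ∀ a < N, gromovProduct o (S h a o) (h o) ≤ C
  le_dist : ∀ h ∈ G, ∀ a < N, ℓ - κ ≤ dist (h o) (S h a o)
  dist_le : ∀ h ∈ G, ∀ a < N, dist (h o) (S h a o) ≤ ℓ + κ
  separated : ∀ h ∈ G, ∀ a < N, ∀ a' < N, a ≠ a' → E < dist (S h a o) (S h a' o)

/-- The children of `h` are `h * k i * f a`, with `f a` from a separated part of a large annulus and
`k i` the twist. The error `κ` comes first, so that the separation `E` and then the step length `n`
may depend on it. -/
theorem exists_isBranching (hb : 1 < b) {G : Subgroup (X ≃ᵢ X)} (hG : IsStronglyDiscrete o G)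
    {s : ℝ} (hs : 0 < s) (hsδ : ENNReal.ofReal s < poincareExponent o b G) {C : ℝ}
    {k : Fin 3 → X ≃ᵢ X} (hk : ∀ i, k i ∈ G)
    (htw : ∀ u v : X, ∃ i, gromovProduct u (k i v) o ≤ C) :
    ∃ κ ≥ 0, ∀ E ≥ 0, ∀ n₀ : ℕ, ∃ n ≥ n₀, ∃ N : ℕ, b ^ (s * (n + κ)) ≤ N ∧
      N ≤ 2 * b ^ (s * (n + κ)) ∧ ∃ S, IsBranching o G N C n κ E S := by
  have hb0 : 0 < b := by linarith
  obtain ⟨κ₁, hκ₁⟩ := Finite.exists_le fun i => dist o (k i o)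
  have hκ₀ : 0 ≤ κ₁ := dist_nonneg.trans (hκ₁ 0)
  refine ⟨κ₁ + 1, by linarith, fun E hE n₀ => ?_⟩
  set κ := κ₁ + 1 with hκ
  have hfin := hG.finite_orbit E
  set M := hfin.toFinset.card with hM
  have hM' : ∀ B : Finset (X ≃ᵢ X), (∀ g ∈ B, g ∈ G ∧ dist o (g o) ≤ E) → B.card ≤ M :=
    fun B hB => Finset.card_le_card fun g hg => hfin.mem_toFinset.2 (hB g hg)
  -- `M` pays for the thinning; `6` is `3` for the choice among three twists times `2` for the
  -- rounding in `N`.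
  obtain ⟨n, hn, F, hF, hFcard⟩ := exists_large_annulus hb hG hs hsδ (M * 6 * b ^ (s * κ)) n₀
  set N := ⌈b ^ (s * (n + κ))⌉₊ with hN
  have hone : 1 ≤ b ^ (s * (n + κ)) := Real.one_le_rpow hb.le (by positivity)
  have hN2 : (N : ℝ) ≤ 2 * b ^ (s * (n + κ)) := by
    have := (Nat.ceil_lt_add_one (show 0 ≤ b ^ (s * (n + κ)) by positivity)).le
    linarith
  refine ⟨n, hn, N, Nat.le_ceil _, hN2, ?_⟩
  obtain ⟨B, hBF, hB, hBcard⟩ := exists_separated_subset (o := o) hE hM' F fun g hg => (hF g hg).1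
  have hMpos : 0 < M := Finset.card_pos.2 ⟨1, hfin.mem_toFinset.2 ⟨G.one_mem, by simpa using hE⟩⟩
  have h3N : 3 * N ≤ B.card := by
    have h1 : (F.card : ℝ) ≤ M * B.card := by exact_mod_cast hBcard
    have h2 : (M : ℝ) * (3 * N) ≤ M * B.card := by
      refine le_trans ?_ h1
      refine le_trans ?_ hFcard
      have h4 : b ^ (s * (n + κ)) = b ^ (s * κ) * b ^ (s * n) := by
        rw [← Real.rpow_add hb0]
        ring_nf
      rw [h4] at hN2
      calc (M : ℝ) * (3 * N) ≤ M * (3 * (2 * (b ^ (s * κ) * b ^ (s * n)))) := by gcongr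
        _ = _ := by ring
    have h5 : (0 : ℝ) < M := by exact_mod_cast hMpos
    exact_mod_cast le_of_mul_le_mul_left h2 h5
  have hS : ∀ h : X ≃ᵢ X, ∃ (i : Fin 3) (f : ℕ → X ≃ᵢ X), ∀ a < N, f a ∈ B ∧
      gromovProduct (h⁻¹ o) (k i (f a o)) o ≤ C ∧ ∀ a' < N, a ≠ a' → f a ≠ f a' := fun h => by
    classical
    -- By pigeonhole one twist serves `N` elements for this `h`. Using the same twist for all of
    -- them keeps them separated.
    choose i hi using fun g : X ≃ᵢ X => htw (h⁻¹ o) (g o)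
    obtain ⟨j, -, hj⟩ := Finset.exists_le_card_fiber_of_mul_le_card_of_maps_to (s := B)
      (t := Finset.univ) (f := i) (n := N) (fun _ _ => Finset.mem_univ _)
      ⟨0, Finset.mem_univ _⟩ (by simpa using h3N)
    set B' := B.filter fun g => i g = j with hB'
    refine ⟨j, fun a => if ha : a < B'.card then (B'.equivFin.symm ⟨a, ha⟩).1 else 1,
      fun a ha => ?_⟩
    have ha' : a < B'.card := ha.trans_le hj
    have hmem := (B'.equivFin.symm ⟨a, ha'⟩).2
    beta_reduce
    rw [dif_pos ha']
    obtain ⟨h1, h2⟩ := Finset.mem_filter.1 hmem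
    refine ⟨h1, ?_, fun c hc hac => ?_⟩
    · have h4 := hi (B'.equivFin.symm ⟨a, ha'⟩).1
      rwa [h2] at h4
    · have hc' : c < B'.card := hc.trans_le hj
      rw [dif_pos hc']
      intro heq
      have := B'.equivFin.symm.injective (Subtype.ext heq)
      simp only [Fin.mk.injEq] at this
      exact hac this
  choose i f hf using hS
  have hdist : ∀ h a, dist (h o) ((h * (k (i h) * f h a)) o) = dist o (k (i h) (f h a o)) :=
    fun h a => h.dist_eq _ _
  have hann : ∀ h, ∀ a < N, n ≤ dist o (f h a o) ∧ dist o (f h a o) ≤ n + 1 := fun h a ha =>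
    (hF _ (hBF (hf h a ha).1)).2
  refine ⟨fun h a => h * (k (i h) * f h a), ?_, ?_, ?_, ?_, ?_⟩
  · exact fun h hh a ha => G.mul_mem hh (G.mul_mem (hk _) (hF _ (hBF (hf h a ha).1)).1)
  · intro h _ a ha
    have h1 := gromovProduct_map h (h⁻¹ o) (k (i h) (f h a o)) o
    rw [show h (h⁻¹ o) = o from h.apply_symm_apply o] at h1
    exact h1.trans_le (hf h a ha).2.1
  · intro h _ a ha
    rw [hdist]
    have h1 := dist_triangle (k (i h) o) o (k (i h) (f h a o))
    rw [(k (i h)).dist_eq, dist_comm _ o] at h1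
    linarith [(hann h a ha).1, hκ₁ (i h)]
  · intro h _ a ha
    rw [hdist]
    have h1 := dist_triangle o (k (i h) o) (k (i h) (f h a o))
    rw [(k (i h)).dist_eq] at h1
    linarith [(hann h a ha).2, hκ₁ (i h)]
  · intro h _ a ha a' ha' hne
    have h1 : dist ((h * (k (i h) * f h a)) o) ((h * (k (i h) * f h a')) o) =
        dist (f h a o) (f h a' o) := (h.dist_eq _ _).trans ((k (i h)).dist_eq _ _)
    rw [h1]
    exact hB _ (hf h a ha).1 _ (hf h a' ha').1 ((hf h a ha).2.2 a' ha' hne)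

end Branching

/-! ### Shadows of children -/

section Children

variable {X : Type*} [MetricSpace X] [IsGromovHyperbolic X] {o : X} {b V : ℝ}

/-- As `x` is nearly between `o` and `x'`, the points `o` and `x` lie in the same direction from
`x'`. So `η` is also in a shadow of `x'` cast from `x`, follows `x'` far from `x`, and leaves `x`
away from `o`. -/
theorem bdryProd_of_mem_shadow_child {x x' : X} {C σ : ℝ} {η : GromovBoundary X}
    (h₁ : gromovProduct o x' x ≤ C) (h₂ : C + σ + 4 * hypConst X < dist x x')
    (hη : η ∈ shadow o x' σ) :
    dist x x' - σ - 3 * hypConst X ≤ bdryProd x' η x ∧ bdryProd o η x ≤ C + hypConst X := by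
  have hH := hypConst_nonneg X
  rw [mem_shadow_iff] at hη
  have h3 := gromovProduct_add_gromovProduct o x' x
  have h4 : bdryProd x η x' ≤ σ + hypConst X := by
    refine le_of_forall_pos_le_add fun ε hε => ?_
    by_contra! hcon
    have hd : dist x x' = dist x' x := dist_comm _ _
    have h5 := sub_le_bdryProd (x := o) (y := x) (z := x') (ξ := η)
      (t := min (bdryProd x η x') (dist x x' - C))
      ((min_le_right _ _).trans (by linarith)) (min_le_left _ _)
    have h6 : σ + hypConst X < min (bdryProd x η x') (dist x x' - C) :=
      lt_min (by linarith) (by linarith)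
    linarith
  have h5 := le_bdryProd_add x x' η
  have h6 : dist x x' - σ - 3 * hypConst X ≤ bdryProd x' η x := by linarith
  refine ⟨h6, ?_⟩
  by_contra! hcon
  have h7 := sub_le_gromovProduct_of_le_bdryProd (x := o) (y := x') (z := x) (ξ := η)
    (t := min (bdryProd o η x) (bdryProd x' η x)) (min_le_left _ _) (min_le_right _ _)
  have h8 : C + hypConst X < min (bdryProd o η x) (bdryProd x' η x) :=
    lt_min hcon (by linarith)
  linarith

variable [MetricSpace (GromovBoundary X)]

/-- After applying `g⁻¹` the two points are `b ^ (-σ)` apart, and `g` contracts by a bounded factor.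
The margin `V` makes room between a shadow and the complement of a larger one. -/
theorem IsVisualConst.le_dist_of_notMem_shadow (hb : 1 < b) (hV : IsVisualConst o b V)
    {g : X ≃ᵢ X} {σ : ℝ} {z w : GromovBoundary X} (hz : bdryProd o z (g o) < σ - V)
    (hw : w ∉ shadow o (g o) σ) : b ^ (-(V + dist o (g o) + σ)) ≤ dist z w := by
  have hb0 : 0 < b := by linarith
  rw [mem_shadow_iff, not_le, ← bdryProd_inv] at hw
  rw [← bdryProd_inv] at hz
  have h1 : b ^ (-σ) ≤ dist (boundaryMap g⁻¹ z) (boundaryMap g⁻¹ w) := by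
    by_contra! hcon
    rw [dist_comm] at hcon
    have := hV.le_bdryProd (g⁻¹ o) _ _ σ hcon.le hw.le
    linarith
  have h2 := hV.le_dist_map hb g (boundaryMap g⁻¹ z) (boundaryMap g⁻¹ w)
  rw [boundaryMap_apply_inv, boundaryMap_apply_inv] at h2
  refine le_trans ?_ h2
  calc b ^ (-(V + dist o (g o) + σ)) = b ^ (-(V + dist o (g o))) * b ^ (-σ) := by
        rw [← Real.rpow_add hb0]
        ring_nf
    _ ≤ _ := by gcongr

end Children

/-! ### The tree -/

section Tree

/-- The words on the letters `0, …, N - 1`. -/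
def wordTree (N : ℕ) : Set (List ℕ) := {ω | ∀ a ∈ ω, a < N}

theorem isTree_wordTree (N : ℕ) : IsTree (wordTree N) := fun _ _ h hτ a ha =>
  hτ a (h.subset ha)

theorem append_mem_wordTree {N : ℕ} {ω : List ℕ} {a : ℕ} :
    ω ++ [a] ∈ wordTree N ↔ ω ∈ wordTree N ∧ a < N := by
  simp only [wordTree, mem_ofPred_eq, List.mem_append, List.mem_singleton]
  constructor
  · exact fun h => ⟨fun c hc => h c (Or.inl hc), h a (Or.inr rfl)⟩
  · rintro ⟨h1, h2⟩ c (hc | rfl)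
    exacts [h1 c hc, h2]

theorem exists_branching_of_incomparable (ω : List ℕ) : ∀ τ : List ℕ, ¬ ω <+: τ → ¬ τ <+: ω →
    ∃ υ a a', a ≠ a' ∧ υ ++ [a] <+: ω ∧ υ ++ [a'] <+: τ := by
  induction ω with
  | nil => exact fun τ h _ => (h (List.nil_prefix)).elim
  | cons x ω ih =>
    intro τ h h'
    cases τ with
    | nil => exact (h' (List.nil_prefix)).elim
    | cons y τ =>
      by_cases hxy : x = y
      · subst hxy
        rw [List.prefix_cons_inj] at h h'
        obtain ⟨υ, a, a', h1, h2, h3⟩ := ih τ h h'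
        refine ⟨x :: υ, a, a', h1, ?_, ?_⟩
        · rw [List.cons_append, List.prefix_cons_inj]
          exact h2
        · rw [List.cons_append, List.prefix_cons_inj]
          exact h3
      · exact ⟨[], x, y, hxy, by simp, by simp⟩

theorem subset_of_prefix {Z : Type*} {T : Set (List ℕ)} {P : List ℕ → Set Z} (hT : IsTree T)
    (h : ∀ ω a, ω ++ [a] ∈ T → P (ω ++ [a]) ⊆ P ω) {ω τ : List ℕ} (hτ : τ ∈ T)
    (hp : ω <+: τ) : P τ ⊆ P ω := by
  obtain ⟨ρ, rfl⟩ := hp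
  induction ρ using List.reverseRecOn with
  | nil => rw [List.append_nil]
  | append_singleton ρ a ih =>
    rw [← List.append_assoc] at hτ ⊢
    exact (h _ a hτ).trans (ih (hT _ _ (List.prefix_append _ _) hτ))

theorem IsPartitionStructure.of_children {Z : Type*} [MetricSpace Z] {T : Set (List ℕ)}
    {P : List ℕ → Set Z} (hT : IsTree T) (hclosed : ∀ ω ∈ T, IsClosed (P ω))
    (hdiam : ∀ ω ∈ T, 0 < Metric.diam (P ω)) (hsub : ∀ ω a, ω ++ [a] ∈ T → P (ω ++ [a]) ⊆ P ω)
    (hdisj : ∀ ω a a', ω ++ [a] ∈ T → ω ++ [a'] ∈ T → a ≠ a' →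
      Disjoint (P (ω ++ [a])) (P (ω ++ [a'])))
    (hsep : ∃ κ : ℝ, 0 < κ ∧ ∃ lam : ℝ, 0 < lam ∧ lam < 1 ∧
      ∀ ω ∈ T, ∀ a : ℕ, ω ++ [a] ∈ T →
        (∀ z ∈ P (ω ++ [a]), ∀ w ∉ P ω, κ * Metric.diam (P ω) ≤ dist z w) ∧
        κ * Metric.diam (P ω) ≤ Metric.diam (P (ω ++ [a])) ∧
        Metric.diam (P (ω ++ [a])) ≤ lam * Metric.diam (P ω)) :
    IsPartitionStructure T P where
  tree := hT
  closed := hclosed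
  diam_pos := hdiam
  nested _ _ _ hτ h := subset_of_prefix hT hsub hτ h
  disjoint ω hω τ hτ h h' := by
    obtain ⟨υ, a, a', hne, h1, h2⟩ := exists_branching_of_incomparable ω τ h h'
    exact (hdisj υ a a' (hT _ _ h1 hω) (hT _ _ h2 hτ) hne).mono
      (subset_of_prefix hT hsub hω h1) (subset_of_prefix hT hsub hτ h2)
  separation := hsep

variable {X : Type*} [MetricSpace X]

/-- Comparable words have shadows of different diameters, incomparable ones have disjoint nonempty
shadows. -/
theorem IsPartitionStructure.injOn_of_shadow [IsGromovHyperbolic X]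
    [MetricSpace (GromovBoundary X)] {o : X} {T : Set (List ℕ)} {x : List ℕ → X} {σ : ℝ}
    (hP : IsPartitionStructure T fun ω => shadow o (x ω) σ) : Set.InjOn x T := by
  have hpre : ∀ ω τ, τ ∈ T → ω <+: τ → x ω = x τ → ω = τ := by
    rintro ω _ hτ ⟨ρ, rfl⟩ hx
    cases ρ with
    | nil => rw [List.append_nil]
    | cons a ρ =>
      exfalso
      obtain ⟨_, _, lam, _, h1, hsep⟩ := hP.separation
      have ha : ω ++ [a] <+: ω ++ a :: ρ := by simp
      have haT := hP.tree _ _ ha hτ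
      have hω := hP.tree ω _ (List.prefix_append _ _) hτ
      have h2 := (hsep ω hω a haT).2.2
      have h3 := Metric.diam_mono (hP.nested _ haT _ hτ ha)
        (isBounded_of_diam_pos (hP.diam_pos _ haT))
      have h4 := hP.diam_pos ω hω
      simp only [← hx] at h2 h3 h4
      nlinarith
  intro ω hω τ hτ hx
  by_contra hne
  have hd := hP.disjoint ω hω τ hτ (fun h => hne (hpre _ _ hτ h hx))
    (fun h => hne (hpre _ _ hω h hx.symm).symm)
  simp only [hx, disjoint_self] at hd
  have := hP.diam_pos τ hτ
  simp only [hd] at this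
  simp at this

/-- The elements attached to the words, together with the lengths of the words: a word whose
element falls short of the length prescribed by `L` is extended by two generations at once. -/
noncomputable def treeState (o : X) (L : ℝ) (S : (X ≃ᵢ X) → ℕ → X ≃ᵢ X) (ω : List ℕ) :
    (X ≃ᵢ X) × ℕ :=
  ω.foldl (fun st a => open scoped Classical in
    (if st.2 * L ≤ dist o (st.1 o) then S st.1 a else S (S st.1 a) 0, st.2 + 1)) (1, 0)

noncomputable def treeElement (o : X) (L : ℝ) (S : (X ≃ᵢ X) → ℕ → X ≃ᵢ X) (ω : List ℕ) : X ≃ᵢ X :=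
  (treeState o L S ω).1

theorem treeState_snd (o : X) (L : ℝ) (S : (X ≃ᵢ X) → ℕ → X ≃ᵢ X) (ω : List ℕ) :
    (treeState o L S ω).2 = ω.length := by
  induction ω using List.reverseRecOn with
  | nil => rfl
  | append_singleton ω a ih =>
    rw [treeState, List.foldl_append, List.length_append] at *
    simp only [List.foldl_cons, List.foldl_nil, ih, List.length_singleton]

theorem treeElement_nil (o : X) (L : ℝ) (S : (X ≃ᵢ X) → ℕ → X ≃ᵢ X) :
    treeElement o L S [] = 1 := rfl

theorem treeElement_append_of_le {o : X} {L : ℝ} {S : (X ≃ᵢ X) → ℕ → X ≃ᵢ X} {ω : List ℕ}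
    (h : ω.length * L ≤ dist o (treeElement o L S ω o)) (a : ℕ) :
    treeElement o L S (ω ++ [a]) = S (treeElement o L S ω) a := by
  have h2 := treeState_snd o L S ω
  unfold treeElement at *
  rw [← h2] at h
  rw [treeState, List.foldl_append]
  exact if_pos h

theorem treeElement_append_of_lt {o : X} {L : ℝ} {S : (X ≃ᵢ X) → ℕ → X ≃ᵢ X} {ω : List ℕ}
    (h : dist o (treeElement o L S ω o) < ω.length * L) (a : ℕ) :
    treeElement o L S (ω ++ [a]) = S (S (treeElement o L S ω) a) 0 := by
  have h2 := treeState_snd o L S ω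
  unfold treeElement at *
  rw [← h2] at h
  rw [treeState, List.foldl_append]
  exact if_neg (not_le.2 h)

end Tree

/-! ### The homogeneous tree of shadows -/

section TreePartition

variable {X : Type*} [MetricSpace X] {o : X} {G : Subgroup (X ≃ᵢ X)} {N : ℕ} {C ℓ κ E L : ℝ}
  {S : (X ≃ᵢ X) → ℕ → X ≃ᵢ X}

theorem IsBranching.dist_child_le (h : IsBranching o G N C ℓ κ E S) {g : X ≃ᵢ X} (hg : g ∈ G)
    {a : ℕ} (ha : a < N) : dist o (S g a o) ≤ dist o (g o) + (ℓ + κ) :=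
  (dist_triangle _ _ _).trans (add_le_add_right (h.dist_le g hg a ha) _)

theorem IsBranching.le_dist_child (h : IsBranching o G N C ℓ κ E S) {g : X ≃ᵢ X} (hg : g ∈ G)
    {a : ℕ} (ha : a < N) : dist o (g o) + (ℓ - κ - 2 * C) ≤ dist o (S g a o) := by
  have h1 := dist_eq_sub_gromovProduct o (S g a o) (g o)
  rw [dist_comm (S g a o) (g o)] at h1
  linarith [h.prod_le g hg a ha, h.le_dist g hg a ha]

theorem IsBranching.treeElement_mem (h : IsBranching o G N C ℓ κ E S) {ω : List ℕ}
    (hω : ω ∈ wordTree N) : treeElement o L S ω ∈ G := by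
  induction ω using List.reverseRecOn with
  | nil => exact G.one_mem
  | append_singleton ω a ih =>
    obtain ⟨h1, h2⟩ := append_mem_wordTree.1 hω
    have h3 := h.mem _ (ih h1) a h2
    rcases le_or_gt (ω.length * L) (dist o (treeElement o L S ω o)) with h4 | h4
    · rwa [treeElement_append_of_le h4]
    · rw [treeElement_append_of_lt h4]
      exact h.mem _ h3 0 (by omega)

theorem IsBranching.treeElement_append (h : IsBranching o G N C ℓ κ E S)
    (hpos : 0 ≤ ℓ - κ - 2 * C) (hpos' : 0 ≤ ℓ + κ) {ω : List ℕ}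
    (hω : ω ∈ wordTree N) {a : ℕ} (ha : a < N) :
    dist o (treeElement o L S ω o) + (ℓ - κ - 2 * C) ≤ dist o (treeElement o L S (ω ++ [a]) o) ∧
      dist (treeElement o L S ω o) (treeElement o L S (ω ++ [a]) o) ≤ 2 * (ℓ + κ) := by
  have hmem := h.treeElement_mem (L := L) hω
  have hmem' := h.mem _ hmem a ha
  have h1 := h.le_dist_child hmem ha
  have h2 := h.dist_le _ hmem a ha
  rcases le_or_gt (ω.length * L) (dist o (treeElement o L S ω o)) with h4 | h4
  · rw [treeElement_append_of_le h4]
    exact ⟨h1, by linarith⟩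
  · rw [treeElement_append_of_lt h4]
    have h0 : 0 < N := by omega
    have h5 := h.le_dist_child hmem' h0
    have h6 := h.dist_le _ hmem' 0 h0
    refine ⟨by linarith, (dist_triangle _ (S (treeElement o L S ω) a o) _).trans ?_⟩
    linarith

/-- A vertex that is ahead makes one step, of height at most `L`, and its lead does not grow; a
vertex that lags makes two steps, of total height at least `L`, and its lag does not grow. -/
theorem IsBranching.abs_dist_treeElement_sub_le (h : IsBranching o G N C ℓ κ E S)
    (hC : 0 ≤ C) (hκ : 0 ≤ κ) (hℓ : 0 ≤ ℓ) (h₁ : ℓ + κ ≤ L) (h₂ : L ≤ 2 * (ℓ - κ - 2 * C))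
    {ω : List ℕ} (hω : ω ∈ wordTree N) :
    |dist o (treeElement o L S ω o) - ω.length * L| ≤ L + 2 * ℓ + 2 * κ + 2 * C := by
  induction ω using List.reverseRecOn with
  | nil =>
    rw [treeElement_nil]
    simp only [IsometryEquiv.coe_one, id, dist_self, List.length_nil, Nat.cast_zero, zero_mul,
      sub_zero, abs_zero]
    linarith
  | append_singleton ω a ih =>
    obtain ⟨hω', ha⟩ := append_mem_wordTree.1 hω
    obtain ⟨h3, h4⟩ := abs_le.1 (ih hω')
    have hmem := h.treeElement_mem (L := L) hω'
    have h5 := h.le_dist_child hmem ha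
    have h6 := h.dist_child_le hmem ha
    rw [List.length_append, List.length_singleton, Nat.cast_add, Nat.cast_one, abs_le]
    rcases le_or_gt (ω.length * L) (dist o (treeElement o L S ω o)) with h7 | h7
    · rw [treeElement_append_of_le h7]
      constructor <;> linarith
    · rw [treeElement_append_of_lt h7]
      have hmem' := h.mem _ hmem a ha
      have h0 : 0 < N := by omega
      have h8 := h.le_dist_child hmem' h0
      have h9 := h.dist_child_le hmem' h0
      constructor <;> linarith

variable [IsGromovHyperbolic X] {σ : ℝ}

theorem IsBranching.bdryProd_of_mem_shadow (h : IsBranching o G N C ℓ κ E S)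
    (hℓ : C + σ + 4 * hypConst X < ℓ - κ) {g : X ≃ᵢ X} (hg : g ∈ G) {a : ℕ} (ha : a < N)
    {η : GromovBoundary X} (hη : η ∈ shadow o (S g a o) σ) :
    ℓ - κ - σ - 3 * hypConst X ≤ bdryProd (S g a o) η (g o) ∧
      bdryProd o η (g o) ≤ C + hypConst X := by
  have h1 := h.le_dist g hg a ha
  have h2 := bdryProd_of_mem_shadow_child (h.prod_le g hg a ha) (by linarith) hη
  exact ⟨by linarith, h2.2⟩

theorem IsBranching.shadow_append_subset (h : IsBranching o G N C ℓ κ E S)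
    (hσ : C + hypConst X ≤ σ) (hℓ : C + σ + 4 * hypConst X < ℓ - κ) {ω : List ℕ}
    (hω : ω ∈ wordTree N) {a : ℕ} (ha : a < N) :
    shadow o (treeElement o L S (ω ++ [a]) o) σ ⊆ shadow o (S (treeElement o L S ω) a o) σ := by
  rcases le_or_gt (ω.length * L) (dist o (treeElement o L S ω o)) with h4 | h4
  · rw [treeElement_append_of_le h4]
  · rw [treeElement_append_of_lt h4]
    intro η hη
    rw [mem_shadow_iff]
    exact (h.bdryProd_of_mem_shadow hℓ (h.mem _ (h.treeElement_mem hω) a ha)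
      (show 0 < N by omega) hη).2.trans hσ

/-- A common point of the shadows would make the two children follow each other almost to their full
distance from `g o`, so they would be at most `E` apart. -/
theorem IsBranching.disjoint_shadow (h : IsBranching o G N C ℓ κ E S)
    (hℓ : C + σ + 4 * hypConst X < ℓ - κ) (hE : 4 * κ + 2 * σ + 8 * hypConst X ≤ E)
    {g : X ≃ᵢ X} (hg : g ∈ G) {a a' : ℕ} (ha : a < N) (ha' : a' < N) (hne : a ≠ a') :
    Disjoint (shadow o (S g a o) σ) (shadow o (S g a' o) σ) := by
  refine disjoint_left.2 fun η h1 h2 => ?_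
  have h3 := sub_le_gromovProduct_of_le_bdryProd (h.bdryProd_of_mem_shadow hℓ hg ha h1).1
    (h.bdryProd_of_mem_shadow hℓ hg ha' h2).1
  have h4 := dist_eq_sub_gromovProduct (S g a o) (S g a' o) (g o)
  rw [dist_comm _ (g o), dist_comm _ (g o)] at h4
  have h5 := h.separated g hg a ha a' ha' hne
  have h6 := h.dist_le g hg a ha
  have h7 := h.dist_le g hg a' ha'
  linarith

variable [MetricSpace (GromovBoundary X)] {b V c : ℝ}

/-- Shadows of children lie in a shadow of the parent with parameter `C + hypConst X`, smaller than
`σ` by more than `V`; this yields the separation from the complement. The other bounds compare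
diameters with heights. -/
theorem IsBranching.isPartitionStructure (hb : 1 < b) (hV : IsVisualConst o b V)
    (h : IsBranching o G N C ℓ κ E S) (hC : 0 ≤ C) (hκ : 0 ≤ κ)
    (hdiam : ∀ g : X ≃ᵢ X, b ^ (-(c + dist o (g o))) ≤ Metric.diam (shadow o (g o) σ))
    (hσ : C + hypConst X + V < σ) (hℓ : C + σ + 4 * hypConst X < ℓ - κ)
    (hℓC : 0 ≤ ℓ - κ - 2 * C) (hℓ' : V + σ + 2 * hypConst X + c < ℓ - κ - 2 * C)
    (hE : 4 * κ + 2 * σ + 8 * hypConst X ≤ E) :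
    IsPartitionStructure (wordTree N) fun ω => shadow o (treeElement o L S ω o) σ := by
  have hb0 : 0 < b := by linarith
  have hV0 := hV.nonneg
  have hH := hypConst_nonneg X
  have hsub : ∀ ω a, ω ++ [a] ∈ wordTree N → shadow o (treeElement o L S (ω ++ [a]) o) σ ⊆
      {η | bdryProd o η (treeElement o L S ω o) ≤ C + hypConst X} := fun ω a ha η hη => by
    obtain ⟨h1, h2⟩ := append_mem_wordTree.1 ha
    exact (h.bdryProd_of_mem_shadow hℓ (h.treeElement_mem h1) h2
      (h.shadow_append_subset (by linarith) hℓ h1 h2 hη)).2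
  refine .of_children (isTree_wordTree N) (fun _ _ => hV.isClosed_shadow hb _ _)
    (fun ω _ => lt_of_lt_of_le (by positivity) (hdiam (treeElement o L S ω)))
    (fun ω a ha η hη => ?_) (fun ω a a' ha ha' hne => ?_) ?_
  · rw [mem_shadow_iff]
    have h1 : bdryProd o η (treeElement o L S ω o) ≤ C + hypConst X := hsub ω a ha hη
    linarith
  · obtain ⟨h1, h2⟩ := append_mem_wordTree.1 ha
    obtain ⟨-, h2'⟩ := append_mem_wordTree.1 ha'
    exact (h.disjoint_shadow hℓ hE (h.treeElement_mem h1) h2 h2' hne).mono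
      (h.shadow_append_subset (by linarith) hℓ h1 h2)
      (h.shadow_append_subset (by linarith) hℓ h1 h2')
  · set k₁ := 2 * V + 2 * σ + 2 * hypConst X with hk₁
    set k₂ := c + 2 * (ℓ + κ) + V + σ + 2 * hypConst X with hk₂
    refine ⟨b ^ (-max k₁ k₂), by positivity, b ^ (V + σ + 2 * hypConst X + c - (ℓ - κ - 2 * C)),
      by positivity, Real.rpow_lt_one_of_one_lt_of_neg hb (by linarith), fun ω hω a ha => ?_⟩
    have haN := (append_mem_wordTree.1 ha).2
    obtain ⟨h1, h2⟩ := h.treeElement_append (L := L) hℓC (by linarith) hω haN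
    have h3 := hV.diam_shadow_le hb (treeElement o L S ω o) σ
    have h4 := hV.diam_shadow_le hb (treeElement o L S (ω ++ [a]) o) σ
    have h5 := hdiam (treeElement o L S ω)
    have h6 := hdiam (treeElement o L S (ω ++ [a]))
    have h7 := dist_triangle o (treeElement o L S ω o) (treeElement o L S (ω ++ [a]) o)
    have h8 : ∀ t, t ≤ max k₁ k₂ → b ^ (-max k₁ k₂) *
        Metric.diam (shadow o (treeElement o L S ω o) σ) ≤
        b ^ (-t + (V + σ + 2 * hypConst X - dist o (treeElement o L S ω o))) := fun t ht => by
      rw [Real.rpow_add hb0]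
      have := Real.rpow_le_rpow_of_exponent_le hb.le (neg_le_neg ht)
      gcongr
    refine ⟨fun z hz w hw => ?_, ?_, ?_⟩
    · have h9 : bdryProd o z (treeElement o L S ω o) ≤ C + hypConst X := hsub ω a ha hz
      refine ((h8 k₁ (le_max_left _ _)).trans (le_of_eq ?_)).trans
        (hV.le_dist_of_notMem_shadow hb (by linarith) hw)
      rw [hk₁]
      ring_nf
    · refine (h8 k₂ (le_max_right _ _)).trans (le_trans ?_ h6)
      refine Real.rpow_le_rpow_of_exponent_le hb.le ?_
      linarith
    · refine h4.trans (le_trans ?_ (mul_le_mul_of_nonneg_left h5 (by positivity)))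
      rw [← Real.rpow_add hb0]
      refine Real.rpow_le_rpow_of_exponent_le hb.le ?_
      linarith

/-- A tree of orbit points whose shadows form a partition structure, with `N` children at every
node, and whose levels are at the distances `n * L` from `o`, up to a bounded error. -/
structure IsHomogeneousTree (o : X) (G : Subgroup (X ≃ᵢ X)) (σ : ℝ) (N : ℕ) (L C : ℝ)
    (y : List ℕ → X ≃ᵢ X) : Prop where
  root : y [] = 1
  mem : ∀ ω ∈ wordTree N, y ω ∈ G
  abs_dist_sub_le : ∀ ω ∈ wordTree N, |dist o (y ω o) - ω.length * L| ≤ C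
  dist_le : ∀ ω ∈ wordTree N, ∀ a < N, dist (y ω o) (y (ω ++ [a]) o) ≤ C
  partition : IsPartitionStructure (wordTree N) fun ω => shadow o (y ω o) σ

theorem IsVisualConst.exists_isHomogeneousTree (hb : 1 < b) (hV : IsVisualConst o b V)
    (hG : IsStronglyDiscrete o G) {s : ℝ} (hs : 0 < s)
    (hsδ : ENNReal.ofReal s < poincareExponent o b G)
    {k : Fin 3 → X ≃ᵢ X} (hk : ∀ i, k i ∈ G)
    (htw : ∀ u v : X, ∃ i, gromovProduct u (k i v) o ≤ C)
    (hdiam : ∀ g : X ≃ᵢ X, b ^ (-(c + dist o (g o))) ≤ Metric.diam (shadow o (g o) σ))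
    (hσ : C + hypConst X + V < σ) :
    ∃ (N : ℕ) (L C' : ℝ) (y : List ℕ → X ≃ᵢ X), 0 < N ∧ 0 < L ∧ (N : ℝ) = b ^ (s * L) ∧
      IsHomogeneousTree o G σ N L C' y := by
  have hb0 : 0 < b := by linarith
  have hV0 := hV.nonneg
  have hH := hypConst_nonneg X
  have hC : 0 ≤ C := by
    obtain ⟨i, hi⟩ := htw o o
    exact (gromovProduct_nonneg _ _ _).trans hi
  obtain ⟨κ, hκ, hbr⟩ := exists_isBranching hb hG hs hsδ hk htw
  -- The steps must be long enough for the shadows to nest, for their diameters to contract, and for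
  -- two steps to gain at least `L`.
  obtain ⟨n₀, hn₀⟩ := exists_nat_gt (max (C + σ + 4 * hypConst X + κ)
    (max (V + σ + 2 * hypConst X + c + κ + 2 * C) (max (Real.logb b 2 / s + 3 * κ + 4 * C) 1)))
  obtain ⟨n, hn, N, hN1, hN2, S, hS⟩ := hbr (4 * κ + 2 * σ + 8 * hypConst X) (by linarith) n₀
  have hn' : (n₀ : ℝ) ≤ n := by exact_mod_cast hn
  replace hn₀ := hn₀.trans_le hn'
  simp only [max_lt_iff] at hn₀
  obtain ⟨a1, a2, a3, a4⟩ := hn₀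
  have hNpos : (0 : ℝ) < N := lt_of_lt_of_le (by positivity) hN1
  -- Chosen to make `N = b ^ (s * L)` exact; rounding in `N` raises `L` above `n + κ` by at most
  -- `logb b 2 / s`.
  set L := Real.logb b N / s with hL
  have hsL : s * L = Real.logb b N := by
    rw [hL]
    field_simp
  have hNL : (N : ℝ) = b ^ (s * L) := by rw [hsL, Real.rpow_logb hb0 hb.ne' hNpos]
  have hL1 : n + κ ≤ L := by
    rw [hNL, Real.rpow_le_rpow_left_iff hb] at hN1
    exact le_of_mul_le_mul_left hN1 hs
  have hlog : 0 ≤ Real.logb b 2 / s :=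
    div_nonneg (Real.logb_nonneg hb one_le_two) hs.le
  have hL2 : L ≤ 2 * (n - κ - 2 * C) := by
    have h2 : (2 : ℝ) = b ^ (s * (Real.logb b 2 / s)) := by
      rw [mul_div_cancel₀ _ hs.ne', Real.rpow_logb hb0 hb.ne' two_pos]
    have h3 : L ≤ Real.logb b 2 / s + (n + κ) := by
      have h4 : b ^ (s * L) ≤ b ^ (s * (Real.logb b 2 / s) + s * (n + κ)) := by
        rw [Real.rpow_add hb0, ← h2, ← hNL]
        exact hN2
      rw [Real.rpow_le_rpow_left_iff hb, ← mul_add] at h4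
      exact le_of_mul_le_mul_left h4 hs
    linarith
  have hℓC : 0 ≤ n - κ - 2 * C := by linarith
  refine ⟨N, L, L + 2 * n + 2 * κ + 2 * C, treeElement o L S, by exact_mod_cast hNpos,
    by linarith, hNL, treeElement_nil _ _ _, fun ω hω => hS.treeElement_mem hω,
    fun ω hω => hS.abs_dist_treeElement_sub_le hC hκ n.cast_nonneg hL1 hL2 hω,
    fun ω hω a ha => (hS.treeElement_append hℓC (by linarith) hω ha).2.trans (by linarith),
    hS.isPartitionStructure hb hV hC hκ hdiam hσ (by linarith) hℓC (by linarith) le_rfl⟩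

end TreePartition

/-! ### Ahlfors regularity of homogeneous limit sets -/

section Ahlfors

open MeasureTheory

/-- The uniform Bernoulli measure on infinite words. -/
noncomputable def bernoulliMeasure (N : ℕ) [NeZero N] : Measure (ℕ → Fin N) :=
  Measure.infinitePi fun _ => (PMF.uniformOfFintype (Fin N)).toMeasure

instance (N : ℕ) [NeZero N] : IsProbabilityMeasure (bernoulliMeasure N) := by
  unfold bernoulliMeasure
  infer_instance

theorem bernoulliMeasure_cylinder {N : ℕ} [NeZero N] (u : ℕ → Fin N) (n : ℕ) :
    bernoulliMeasure N {v | ∀ i < n, v i = u i} = ((N : ℝ≥0∞)⁻¹) ^ n := by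
  have h : {v : ℕ → Fin N | ∀ i < n, v i = u i} =
      Set.pi (Finset.range n : Set ℕ) fun i => {u i} := by
    ext v
    simp [Set.mem_pi]
  rw [h, bernoulliMeasure, Measure.infinitePi_pi _ (fun i _ => MeasurableSet.singleton _)]
  simp

variable {Z : Type*} [MetricSpace Z] {P : List ℕ → Set Z} {N : ℕ}

theorem initialWord_mem_wordTree (u : ℕ → Fin N) (n : ℕ) :
    initialWord (fun i => (u i : ℕ)) n ∈ wordTree N := by
  intro a ha
  obtain ⟨i, -, rfl⟩ := List.mem_map.1 ha
  exact (u i).2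

theorem exists_eq_of_initialWord_mem_wordTree {ω : ℕ → ℕ}
    (hω : ∀ n, initialWord ω n ∈ wordTree N) : ∃ u : ℕ → Fin N, ω = fun i => (u i : ℕ) := by
  have h : ∀ i, ω i < N := fun i => by
    have := hω (i + 1)
    rw [initialWord_succ] at this
    exact (append_mem_wordTree.1 this).2
  exact ⟨fun i => ⟨ω i, h i⟩, rfl⟩

theorem IsPartitionStructure.eq_of_mem_of_length_eq {T : Set (List ℕ)}
    (hP : IsPartitionStructure T P) {ω τ : List ℕ} (hω : ω ∈ T) (hτ : τ ∈ T)
    (hlen : ω.length = τ.length) {z : Z} (hz : z ∈ P ω) (hz' : z ∈ P τ) : ω = τ := by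
  by_contra hne
  exact disjoint_left.1 (hP.disjoint ω hω τ hτ (fun h => hne (h.eq_of_length hlen))
    (fun h => hne (h.eq_of_length hlen.symm).symm)) hz hz'

/-- The measure is the image of the Bernoulli measure under the coding map. A ball of radius `r`
contains a cylinder and is contained in one, both of length `-log r / L + O(1)`; the second
inclusion uses the separation of the sets. -/
theorem IsPartitionStructure.isAhlforsRegular [NeZero N]
    (hP : IsPartitionStructure (wordTree N) P)
    (hne : ∀ ω : ℕ → ℕ, (∀ n, initialWord ω n ∈ wordTree N) → ∃ z, ∀ n, z ∈ P (initialWord ω n))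
    {b s L A : ℝ} (hb : 1 < b) (hs : 0 < s) (hL : 0 < L) (hN : (N : ℝ) = b ^ (s * L))
    (hlow : ∀ ω ∈ wordTree N, b ^ (-(ω.length * L + A)) ≤ Metric.diam (P ω))
    (hup : ∀ ω ∈ wordTree N, Metric.diam (P ω) ≤ b ^ (-(ω.length * L - A))) :
    IsAhlforsRegular s (partitionLimitSet (wordTree N) P) := by
  have hb0 : 0 < b := by linarith
  obtain ⟨κ, hκ, _, _, _, hsep⟩ := hP.separation
  choose f hf using fun u : ℕ → Fin N => hne _ (initialWord_mem_wordTree u)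
  set F : (ℕ → Fin N) → partitionLimitSet (wordTree N) P :=
    fun u => ⟨f u, _, initialWord_mem_wordTree u, hf u⟩ with hF
  have hword : Continuous fun (u : ℕ → Fin N) (i : ℕ) => (u i : ℕ) :=
    continuous_pi fun i => continuous_of_discreteTopology.comp (continuous_apply i)
  have hFc : Continuous F :=
    (hP.continuous_of_branch hword initialWord_mem_wordTree hf).subtype_mk _
  have hsurj : ∀ z, ∃ u, F u = z := by
    rintro ⟨z, ω, hω, hz⟩
    obtain ⟨u, rfl⟩ := exists_eq_of_initialWord_mem_wordTree hω
    exact ⟨u, Subtype.ext (hP.eq_of_mem_branch hω (hf u) hz)⟩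
  let : MeasurableSpace (partitionLimitSet (wordTree N) P) := borel _
  have : BorelSpace (partitionLimitSet (wordTree N) P) := ⟨rfl⟩
  have hball : ∀ z r, (bernoulliMeasure N).map F (Metric.closedBall z r) =
      bernoulliMeasure N (F ⁻¹' Metric.closedBall z r) := fun z r =>
    Measure.map_apply hFc.measurable Metric.isClosed_closedBall.measurableSet
  have hcyl : ∀ (u : ℕ → Fin N) (n : ℕ), bernoulliMeasure N {v | ∀ i < n, v i = u i} =
      ENNReal.ofReal (b ^ (-(s * L * n))) := fun u n => by
    rw [bernoulliMeasure_cylinder, ← ENNReal.ofReal_natCast, hN,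
      ← ENNReal.ofReal_inv_of_pos (by positivity), ← ENNReal.ofReal_pow (by positivity),
      ← Real.rpow_neg hb0.le, ← Real.rpow_natCast, ← Real.rpow_mul hb0.le]
    ring_nf
  have hA : 0 ≤ A := by
    have h1 := (hlow [] (by simp [wordTree])).trans (hup [] (by simp [wordTree]))
    rw [Real.rpow_le_rpow_left_iff hb] at h1
    linarith
  set A' := A - Real.logb b κ with hA'
  set c₁ := s * (A + L) with hc₁
  set c₂ := s * (A' + 1 + L) with hc₂
  refine ⟨(bernoulliMeasure N).map F, b ^ c₁ + b ^ c₂, by positivity, fun z r hr hr1 => ?_⟩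
  obtain ⟨u, rfl⟩ := hsurj z
  have hrb : r = b ^ Real.logb b r := (Real.rpow_logb hb0 hb.ne' hr).symm
  have hrneg : Real.logb b r < 0 := Real.logb_neg hb hr hr1
  have hrs : r ^ s = b ^ (s * Real.logb b r) := by
    conv_lhs => rw [hrb]
    rw [← Real.rpow_mul hb0.le, mul_comm]
  rw [hball]
  constructor
  -- The least length for which `b ^ (-(n * L - A)) ≤ r`.
  · set n := ⌈(A - Real.logb b r) / L⌉₊ with hn
    have h1 : (A - Real.logb b r) / L ≤ n := Nat.le_ceil _
    have h2 : (n : ℝ) < (A - Real.logb b r) / L + 1 :=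
      Nat.ceil_lt_add_one (div_nonneg (by linarith) hL.le)
    rw [div_le_iff₀ hL] at h1
    rw [← sub_lt_iff_lt_add, lt_div_iff₀ hL] at h2
    have hsub : {v : ℕ → Fin N | ∀ i < n, v i = u i} ⊆ F ⁻¹' Metric.closedBall (F u) r := by
      intro v hv
      have h3 : initialWord (fun i => (v i : ℕ)) n = initialWord (fun i => (u i : ℕ)) n :=
        initialWord_congr fun i hi => by rw [hv i hi]
      have h4 := hf v n
      rw [h3] at h4
      have hT := initialWord_mem_wordTree u n
      have h5 := (hP.dist_le_diam hT h4 (hf u n)).trans (hup _ hT)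
      rw [length_initialWord] at h5
      rw [mem_preimage, Metric.mem_closedBall, Subtype.dist_eq]
      refine h5.trans ?_
      rw [hrb]
      exact Real.rpow_le_rpow_of_exponent_le hb.le (by linarith)
    refine le_trans ?_ (measure_mono hsub)
    rw [hcyl]
    refine ENNReal.ofReal_le_ofReal ?_
    have h6 : (b ^ c₁ + b ^ c₂)⁻¹ ≤ b ^ (-c₁) := by
      rw [Real.rpow_neg hb0.le]
      exact inv_anti₀ (by positivity) (le_add_of_nonneg_right (by positivity))
    calc (b ^ c₁ + b ^ c₂)⁻¹ * r ^ s ≤ b ^ (-c₁) * b ^ (s * Real.logb b r) := by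
          rw [hrs]
          gcongr
      _ = b ^ (-c₁ + s * Real.logb b r) := (Real.rpow_add hb0 _ _).symm
      _ ≤ _ := by
        refine Real.rpow_le_rpow_of_exponent_le hb.le ?_
        have := mul_le_mul_of_nonneg_left h2.le hs.le
        rw [hc₁]
        linarith
  -- Short enough that leaving the cylinder costs a distance greater than `r`; the `1` makes this
  -- strict. If the floor is truncated to `0`, the cylinder is the whole space.
  · set n := ⌊(-Real.logb b r - A' - 1) / L⌋₊ with hn
    have h1 : (-Real.logb b r - A' - 1) / L < n + 1 := Nat.lt_floor_add_one _
    rw [div_lt_iff₀ hL] at h1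
    have hsub : F ⁻¹' Metric.closedBall (F u) r ⊆ {v : ℕ → Fin N | ∀ i < n, v i = u i} := by
      intro v hv
      rcases Nat.eq_zero_or_pos n with h0 | h0
      · intro i hi
        omega
      have h2 : (n : ℝ) ≤ (-Real.logb b r - A' - 1) / L :=
        (Nat.le_floor_iff' h0.ne').1 le_rfl
      rw [le_div_iff₀ hL] at h2
      rw [mem_preimage, Metric.mem_closedBall, Subtype.dist_eq] at hv
      have hT := initialWord_mem_wordTree u n
      have hT' := initialWord_mem_wordTree u (n + 1)
      rw [initialWord_succ] at hT'
      have h3 : f v ∈ P (initialWord (fun i => (u i : ℕ)) n) := by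
        by_contra hcon
        have h4 := hf u (n + 1)
        rw [initialWord_succ] at h4
        have h5 := (hsep _ hT _ hT').1 _ h4 _ hcon
        have h6 : κ * b ^ (-(n * L + A)) ≤ r := by
          have h7 := hlow _ hT
          rw [length_initialWord] at h7
          rw [dist_comm] at hv
          exact ((mul_le_mul_of_nonneg_left h7 hκ.le).trans h5).trans hv
        rw [← Real.rpow_logb hb0 hb.ne' hκ, ← Real.rpow_add hb0, hrb,
          Real.rpow_le_rpow_left_iff hb] at h6
        linarith
      have h4 := hP.eq_of_mem_of_length_eq (initialWord_mem_wordTree v n) hT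
        (by rw [length_initialWord, length_initialWord]) (hf v n) h3
      exact fun i hi => Fin.ext (eq_of_initialWord_eq h4 i hi)
    refine (measure_mono hsub).trans ?_
    rw [hcyl]
    refine ENNReal.ofReal_le_ofReal ?_
    calc b ^ (-(s * L * n)) ≤ b ^ (c₂ + s * Real.logb b r) := by
          refine Real.rpow_le_rpow_of_exponent_le hb.le ?_
          have := mul_le_mul_of_nonneg_left h1.le hs.le
          rw [hc₂]
          linarith
      _ = b ^ c₂ * r ^ s := by rw [Real.rpow_add hb0, hrs]
      _ ≤ _ := by
        gcongr
        exact le_add_of_nonneg_left (by positivity)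

end Ahlfors

/-! ### From the homogeneous tree to a shadow structure -/

section Existence

theorem convergesToBoundary_of_tendsto {X : Type*} [MetricSpace X] [IsGromovHyperbolic X] {o : X}
    {y : ℕ → X} {η : GromovBoundary X}
    (h : Tendsto (fun n => bdryProd (y n) η o) atTop atTop) : ConvergesToBoundary o y η := by
  unfold ConvergesToBoundary
  simp_rw [← coe_bdryProd]
  exact EReal.tendsto_coe_nhds_top_iff.2 h

variable {X : Type*} [MetricSpace X] [IsGromovHyperbolic X] [MetricSpace (GromovBoundary X)]
  {o : X} {b V : ℝ}

theorem IsHomogeneousTree.isShadowStructure (hb : 1 < b) (hV : IsVisualConst o b V)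
    {G : Subgroup (X ≃ᵢ X)} {s σ c L C : ℝ} {N : ℕ} [NeZero N] {y : List ℕ → X ≃ᵢ X}
    (hs : 0 < s) (hσ : 0 < σ) (hL : 0 < L) (hN : (N : ℝ) = b ^ (s * L))
    (hdiam : ∀ g : X ≃ᵢ X, b ^ (-(c + dist o (g o))) ≤ Metric.diam (shadow o (g o) σ))
    (h : IsHomogeneousTree o G σ N L C y) :
    IsShadowStructure o G s σ (wordTree N) (fun ω => y ω o) ∧
      (partitionLimitSet (wordTree N) fun ω => shadow o (y ω o) σ).Nonempty := by
  have hne : ∀ ω : ℕ → ℕ, (∀ n, initialWord ω n ∈ wordTree N) →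
      ∃ η, ∀ n, η ∈ shadow o (y (initialWord ω n) o) σ := fun ω hω =>
    hV.exists_mem_branch hb h.partition (fun ω _ => hdiam (y ω)) hω
  refine ⟨⟨fun ω hω => ⟨y ω, h.mem ω hω, rfl⟩, h.partition.injOn_of_shadow, h.partition, ?_, ?_⟩, ?_⟩
  · rintro η ⟨ω, hω, hη⟩
    have hω' : ∀ n, initialWord ω n ∈ wordTree N := hω
    have hη' : ∀ n, η ∈ shadow o (y (initialWord ω n) o) σ := hη
    have hd := tendsto_dist_branch hb h.partition (fun ω _ => hdiam (y ω)) hω'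
    refine ⟨max σ C, lt_max_of_lt_left hσ, fun n => y (initialWord ω n),
      fun n => h.mem _ (hω' n), convergesToBoundary_of_tendsto ?_, fun n => ?_, fun n => ?_, ?_⟩
    · refine tendsto_atTop_mono (fun n => le_bdryProd_of_mem_shadow (hη' n)) ?_
      simp only [sub_eq_add_neg]
      exact tendsto_atTop_add_const_right _ _ (tendsto_atTop_add_const_right _ _ hd)
    · have := hη' n
      rw [mem_shadow_iff] at this ⊢
      exact this.trans (le_max_left _ _)
    · have h1 := hω' (n + 1)
      rw [initialWord_succ] at h1
      simp only [initialWord_succ]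
      exact (h.dist_le _ (hω' n) _ (append_mem_wordTree.1 h1).2).trans (le_max_right _ _)
    · simp only [initialWord_zero, h.root]
      rfl
  · have hH := hypConst_nonneg X
    have hV0 := hV.nonneg
    set A := max (c + C) (V + σ + 2 * hypConst X + C) with hA
    have h1 : c + C ≤ A := le_max_left _ _
    have h2 : V + σ + 2 * hypConst X + C ≤ A := le_max_right _ _
    refine h.partition.isAhlforsRegular hne hb hs hL hN (A := A) (fun ω hω => ?_) fun ω hω => ?_
    · refine le_trans (Real.rpow_le_rpow_of_exponent_le hb.le ?_) (hdiam (y ω))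
      linarith [(abs_le.1 (h.abs_dist_sub_le ω hω)).2]
    · refine (hV.diam_shadow_le hb _ _).trans (Real.rpow_le_rpow_of_exponent_le hb.le ?_)
      linarith [(abs_le.1 (h.abs_dist_sub_le ω hω)).1]
  · obtain ⟨η, hη⟩ := hne _ (initialWord_mem_wordTree fun _ => (0 : Fin N))
    exact ⟨η, _, initialWord_mem_wordTree _, hη⟩

end Existence

end HypDioph

theorem mainTheorem3 {X : Type*} [MetricSpace X] [IsGromovHyperbolic X] (o : X) (b : ℝ)
    (hb : 1 < b) [MetricSpace (GromovBoundary X)]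
    (hvis : IsVisualMetric (X := X) o b)
    (G : Subgroup (X ≃ᵢ X)) (hdisc : IsStronglyDiscrete o G) (hgen : IsGeneralType G)
    (s : ℝ) (hs : 0 < s) (hsδ : ENNReal.ofReal s < poincareExponent o b G) :
    ∃ σ₀ : ℝ, 0 < σ₀ ∧ ∀ σ : ℝ, σ₀ ≤ σ →
      (∃ (T : Set (List ℕ)) (x : List ℕ → X), IsShadowStructure o G s σ T x ∧
        (partitionLimitSet T (fun ω => shadow o (x ω) σ)).Nonempty) ∧
      ∀ (T : Set (List ℕ)) (x : List ℕ → X), IsShadowStructure o G s σ T x →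
        ∀ ξ : GromovBoundary X,
          IsAbsoluteWinning
            {η : partitionLimitSet T (fun ω => shadow o (x ω) σ) |
              (η : GromovBoundary X) ∈ badlyApproximable o b G ξ} := by
  obtain ⟨V, hV⟩ := exists_isVisualConst hb hvis
  obtain ⟨C, k, hk, htw⟩ := hgen.exists_twist hb hV hdisc
  obtain ⟨_, _, _, _, p, q, r, _, hpq, _, hpr, _, hqr, _⟩ := hgen.exists_points
  obtain ⟨σ₁, c, hc⟩ := hV.exists_le_diam_shadow hb hpq hpr hqr
  -- `σ₁` is needed for the lower bound on diameters of shadows, the last term for nesting with a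
  -- margin.
  refine ⟨max 1 (max σ₁ (C + hypConst X + V + 1)), lt_max_of_lt_left one_pos, fun σ hσ => ?_⟩
  obtain ⟨hσ0, hσ1, hσ2⟩ : 1 ≤ σ ∧ σ₁ ≤ σ ∧ C + hypConst X + V + 1 ≤ σ := by
    simpa only [max_le_iff] using hσ
  refine ⟨?_, fun T x h ξ => h.isAbsoluteWinning hb hV hdisc hs (hc σ hσ1) ξ⟩
  obtain ⟨N, L, C', y, hN, hL, hNL, hy⟩ := hV.exists_isHomogeneousTree hb hdisc hs hsδ hk htw
    (hc σ hσ1) (by linarith)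
  have : NeZero N := ⟨hN.ne'⟩
  exact ⟨_, _, hy.isShadowStructure hb hV hs (by linarith) hL hNL (hc σ hσ1)⟩
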